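/- **Setting.** Let $n,m\ge 0$ and $q\ge 1$ be integers. Work in local coordinates $x=(x^1,\dots,x^n)$ on an open set $U\subseteq\mathbb R^n$, with $E=U\times\mathbb R^m$, $T^*$ the cotangent bundle, and $J_q(E)$ the bundle of $q$-jets with coordinates $y^k_\mu$ ($1\le k\le m$, $|\mu|\le q$); everything is smooth. A multi-index $\mu\neq0$ has *class* $i$ if $\mu_1=\dots=\mu_{i-1}=0$ and $\mu_i\ne 0$. A system of linear equations $\Phi^\tau\equiv a^{\tau\mu}_k(x)y^k_\mu=0$ of order $q$ is in *solved form* if each $\Phi^\tau$ has a leading jet, which has coefficient $1$ in $\Phi^\tau$ and does not occur in the other equations, and $\Phi^\tau$ contains no jet of order $q$ whose class is larger than the class $c(\tau)$ of the equation; here $c(\tau)$ is the class of the leading jet if this has order $q$, and $c(\tau)=0$ if it has order $<q$ (so that $\Phi^\tau$ then has order $\le q-1$). The variables $x^1,\dots,x^{c(\tau)}$ are called multiplicative for $\Phi^\tau$. A family $R_q$ of subspaces of the fibres of $J_q(E)$ is an *involutive system* (in the given, $\delta$-regular, coordinates) if it is locally defined by smooth equations in solved form whose first prolongation is already defined by the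 equations $\Phi^\tau=0$ and $d_j\Phi^\tau=0$ with $x^j$ multiplicative for $\Phi^\tau$. Let $R_q\subseteq J_q(E)$ be an involutive system over $U$, let $S_{q+1}T^*\otimes E\subseteq J_{q+1}(E)$ be the jets with vanishing components of order $\le q$, let $(\delta\omega)^k_\mu=dx^i\wedge\omega^k_{\mu+1_i}$, and let $$F_0=J_q(E)/R_q,\qquad F_r=\wedge^rT^*\otimes J_q(E)\big/\big(\wedge^rT^*\otimes R_q+\delta(\wedge^{r-1}T^*\otimes S_{q+1}T^*\otimes E)\big)\quad(r\ge1)$$ be the Janet bundles. Let $\mathcal D:E\to F_0$ be $j_q$ followed by the projection, and let $\mathcal D_{r+1}:F_r\to F_{r+1}$ be induced by the Spencer operator $D:\wedge^rT^*\otimes J_{q+1}(E)\to\wedge^{r+1}T^*\otimes J_q(E)$, $(D\omega)^k_\mu=d\omega^k_\mu-dx^i\wedge\omega^k_{\mu+1_i}$, that is, $\mathcal D_{r+1}$ maps the class of the projection of $\omega$ to $\wedge^rT^*\otimes J_q(E)$ to the class of $D\omega$. Fibre coordinates of the $F_r$ over an open set $V\subseteq U$ are called *adapted* if, written in them, the equations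 of $\mathcal D$ and successively those of $\mathcal D_1,\mathcal D_2,\dots$ are in solved form. A first order system with unknowns $y^1,\dots,y^N$ is in *reduced Spencer form* if it is involutive, has no equation of order zero and, after a permutation of the unknowns, there is a $\beta$ such that: the equations can be solved with respect to $y^1_n,\dots,y^\beta_n$; they contain no $y^{\beta+1}_n,\dots,y^N_n$; and the equations of class $\le n-1$, that is, the linear combinations of the equations which contain no $y^k_n$ at all, contain neither $y^{\beta+1},\dots,y^N$ nor any of their jets. **Theorem 2.12.** (1) Every point of $U$ has an open neighbourhood over which the $F_r$ are smooth vector bundles with adapted fibre coordinates, and over which the $\mathcal D_{r}$ $(r\ge 1)$ are well-defined linear differential operators of order one with smooth coefficients. (2) Over every open $V\subseteq U$ and in all adapted fibre coordinates, each operator of the sequence $E\xrightarrow{\mathcal D}F_0\xrightarrow{\mathcal D_1}F_1\xrightarrow{\mathcal D_2}\cdots\xrightarrow{\mathcal D_n}F_n\to0$ generates the compatibility conditions of the preceding one (the composites vanish, and the prolonged sequences $J_{q+s+1}(E)\to J_{s+1}(F_0)\to J_s(F_1)$ and $J_{s+2}(F_{r-1})\to J_{s+1}(F_{r})\to J_{s}(F_{r+1})$,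 $r\geq 1$, are exact for all $s\ge0$), and each of the first order operators $\mathcal D_1,\dots,\mathcal D_n$ is involutive and is *automatically* in reduced Spencer form, that is, without any change of the unknowns except for their numbering. -/

import Mathlib

open scoped ContDiff

namespace Janet

/-! ### Jets in local coordinates

Everything is written in local coordinates `(x¹, …, xⁿ)` on an open set of `ℝⁿ` and in fibre
coordinates `(yᵏ)`, `k ∈ κ`, of a vector bundle over it. -/

/-- Points of the coordinate space. -/
abbrev Pt (n : ℕ) : Type := Fin n → ℝ

/-- The multi-indices `μ` with `|μ| ≤ q`. -/
def multiIdx (n q : ℕ) : Finset (Fin n → ℕ) :=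
  (Fintype.piFinset fun _ => Finset.range (q + 1)).filter fun μ => ∑ i, μ i ≤ q

theorem mem_multiIdx {n q : ℕ} {μ : Fin n → ℕ} : μ ∈ multiIdx n q ↔ ∑ i, μ i ≤ q := by
  simp only [multiIdx, Finset.mem_filter, Fintype.mem_piFinset, Finset.mem_range,
    Nat.lt_succ_iff, and_iff_right_iff_imp]
  exact fun h i => (Finset.single_le_sum (fun j _ => Nat.zero_le (μ j)) (Finset.mem_univ i)).trans h

/-- The finite type of multi-indices of length at most `q`. -/
abbrev MIdx (n q : ℕ) : Type := ↥(multiIdx n q)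

/-- The length `|μ|`. -/
def MIdx.len {n q : ℕ} (μ : MIdx n q) : ℕ := ∑ i, μ.1 i

/-- `μ`, seen as a multi-index of length at most `q + 1`. -/
def MIdx.emb {n q : ℕ} (μ : MIdx n q) : MIdx n (q + 1) :=
  ⟨μ.1, mem_multiIdx.2 ((mem_multiIdx.1 μ.2).trans (Nat.le_succ q))⟩

/-- The multi-index `μ + 1ᵢ`. -/
def MIdx.succ {n q : ℕ} (μ : MIdx n q) (i : Fin n) : MIdx n (q + 1) :=
  ⟨μ.1 + Pi.single i 1, mem_multiIdx.2 (by
    simpa [Finset.sum_add_distrib] using mem_multiIdx.1 μ.2)⟩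

/-- The multi-index `0`. -/
def MIdx.zero (n q : ℕ) : MIdx n q := ⟨0, mem_multiIdx.2 (by simp)⟩

/-- The multi-index `1ᵢ`, of length one. -/
def MIdx.unit {n : ℕ} (i : Fin n) : MIdx n 1 := (MIdx.zero n 0).succ i

/-- The class of a multi-index: the number `i ∈ {1, …, n}` such that
`μ₁ = … = μᵢ₋₁ = 0` and `μᵢ ≠ 0`; it is `0` for `μ = 0`. -/
noncomputable def jetClass {n : ℕ} (μ : Fin n → ℕ) : ℕ :=
  sInf {c | ∃ i : Fin n, i.val + 1 = c ∧ μ i ≠ 0}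

/-- The fibre of the jet bundle `J_q(E)`, with coordinates `yᵏ_μ`, `|μ| ≤ q`. -/
abbrev Jet (n q : ℕ) (κ : Type) : Type := MIdx n q → κ → ℝ

/-- The projection `J_{q+1}(E) → J_q(E)`. -/
def trunc (n q : ℕ) (κ : Type) : Jet n (q + 1) κ →L[ℝ] Jet n q κ :=
  ContinuousLinearMap.pi fun μ => ContinuousLinearMap.proj μ.emb

/-- The map `J_{q+1}(E) → J_q(E)` with `(yᵏ_μ) ↦ (yᵏ_{μ+1ᵢ})`. -/
def shift (n q : ℕ) (κ : Type) (i : Fin n) : Jet n (q + 1) κ →L[ℝ] Jet n q κ :=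
  ContinuousLinearMap.pi fun μ => ContinuousLinearMap.proj (μ.succ i)

/-- `S_qT* ⊗ E ⊆ J_q(E)`: the jets whose components of order `< q` vanish. -/
def symTop (n q : ℕ) (κ : Type) : Submodule ℝ (Jet n q κ) where
  carrier := {y | ∀ μ : MIdx n q, μ.len < q → y μ = 0}
  add_mem' := fun ha hb μ h => by simp [ha μ h, hb μ h]
  zero_mem' := fun _ _ => rfl
  smul_mem' := fun c a ha μ h => by simp [ha μ h]

/-- The partial derivative `∂ᵢ f`. -/
noncomputable def pderiv {n : ℕ} (i : Fin n) (f : Pt n → ℝ) : Pt n → ℝ :=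
  fun x => fderiv ℝ f x (Pi.single i 1)

/-- The iterated partial derivative `∂_μ f = ∂₁^{μ₁} ⋯ ∂ₙ^{μₙ} f`. -/
noncomputable def mderiv {n : ℕ} (μ : Fin n → ℕ) (f : Pt n → ℝ) : Pt n → ℝ :=
  (List.finRange n).foldr (fun i g => (pderiv i)^[μ i] g) f

/-! ### Linear operators, systems and involution -/

/-- A linear differential operator of order `≤ q` in coordinates, or the family of its equations
`Φ^τ ≡ a^{τμ}_k(x) yᵏ_μ`: the coefficient `a x τ μ k` is `a^{τμ}_k(x)`. -/
abbrev LinOp (n q : ℕ) (κ ι : Type) : Type := Pt n → ι → MIdx n q → κ → ℝ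

section Op

variable {n q : ℕ} {κ ι : Type} [Fintype κ]

/-- The coefficients are smooth on `V`. -/
def LinOp.Smooth (a : LinOp n q κ ι) (V : Set (Pt n)) : Prop :=
  ∀ τ μ k, ContDiffOn ℝ ∞ (fun x => a x τ μ k) V

/-- The value of `Φ^τ` on a jet `y` over `x`. -/
def LinOp.eval (a : LinOp n q κ ι) (x : Pt n) (τ : ι) (y : Jet n q κ) : ℝ :=
  ∑ μ, ∑ k, a x τ μ k * y μ k

/-- The value on a jet `y` of order `q + 1` over `x` of the formal derivative
`dⱼΦ^τ ≡ a^{τμ}_k yᵏ_{μ+1ⱼ} + ∂ⱼa^{τμ}_k yᵏ_μ`. -/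
noncomputable def LinOp.evalD (a : LinOp n q κ ι) (x : Pt n) (j : Fin n) (τ : ι)
    (y : Jet n (q + 1) κ) : ℝ :=
  ∑ μ, ∑ k, (a x τ μ k * y (μ.succ j) k + pderiv j (fun z => a z τ μ k) x * y μ.emb k)

/-- The action of the operator on a section: `f ↦ (a^{τμ}_k(x) ∂_μ fᵏ(x))`. -/
noncomputable def LinOp.apply (a : LinOp n q κ ι) (f : Pt n → κ → ℝ) : Pt n → ι → ℝ :=
  fun x τ => ∑ μ : MIdx n q, ∑ k, a x τ μ k * mderiv μ.1 (fun z => f z k) x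

/-- The system of equations defined by the operator: its kernel in `J_q(E)`. -/
def LinOp.system (a : LinOp n q κ ι) (x : Pt n) : Submodule ℝ (Jet n q κ) where
  carrier := {y | ∀ τ, a.eval x τ y = 0}
  add_mem' := fun {y z} hy hz τ => by
    have h1 : a.eval x τ y = 0 := hy τ
    have h2 : a.eval x τ z = 0 := hz τ
    have h3 : a.eval x τ (y + z) = a.eval x τ y + a.eval x τ z := by
      simp [LinOp.eval, mul_add, Finset.sum_add_distrib]
    rw [h3, h1, h2, add_zero]
  zero_mem' := fun τ => by simp [LinOp.eval]
  smul_mem' := fun c y hy τ => by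
    have h1 : a.eval x τ y = 0 := hy τ
    have h3 : a.eval x τ (c • y) = c * a.eval x τ y := by
      simp only [LinOp.eval, Pi.smul_apply, smul_eq_mul, Finset.mul_sum]
      exact Finset.sum_congr rfl fun _ _ => Finset.sum_congr rfl fun _ _ => by ring
    rw [h3, h1, mul_zero]

/-- The class of the equation `Φ^τ` with leading jet `piv τ`: the class of its leading jet if this
jet has order `q`, and `0` for an equation of order `≤ q - 1`. The variables `x¹, …, xᶜ` are the
multiplicative variables of an equation of class `c`. -/
noncomputable def eqClass (piv : ι → MIdx n q × κ) (τ : ι) : ℕ :=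
  if (piv τ).1.len = q then jetClass (piv τ).1.1 else 0

open Classical in
/-- The equations are in solved form over `V`, with leading (principal) jets `piv τ`: the leading
jet of `Φ^τ` has coefficient `1` in `Φ^τ` and does not occur in any other equation, and an equation
of class `c` contains no jet of order `q` and of class `> c` (so that an equation of class `0` has
order `≤ q - 1`). -/
def LinOp.SolvedForm (a : LinOp n q κ ι) (V : Set (Pt n)) (piv : ι → MIdx n q × κ) : Prop :=
  (∀ x ∈ V, ∀ σ τ, a x σ (piv τ).1 (piv τ).2 = if σ = τ then 1 else 0) ∧
  ∀ x ∈ V, ∀ τ μ k, μ.len = q → eqClass piv τ < jetClass μ.1 → a x τ μ k = 0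

/-- The first prolongation is obtained by prolonging each equation with respect to its
multiplicative variables only. -/
def LinOp.MultiplicativeProlongation (a : LinOp n q κ ι) (V : Set (Pt n))
    (piv : ι → MIdx n q × κ) : Prop :=
  ∀ x ∈ V, ∀ y : Jet n (q + 1) κ, (∀ τ, a.eval x τ (trunc n q κ y) = 0) →
    (∀ τ, ∀ j : Fin n, j.val + 1 ≤ eqClass piv τ → a.evalD x j τ y = 0) →
    ∀ τ, ∀ j : Fin n, a.evalD x j τ y = 0

/-- The family `R` of subspaces of the fibres of `J_q(E)` over `U` is an involutive system of
order `q` (and the given coordinates are `δ`-regular): locally it is defined by smooth equations in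
solved form, and its first prolongation is obtained by using the multiplicative variables only. -/
def IsInvolutive (U : Set (Pt n)) (R : Pt n → Submodule ℝ (Jet n q κ)) : Prop :=
  ∀ x₀ ∈ U, ∃ V : Set (Pt n), IsOpen V ∧ x₀ ∈ V ∧ V ⊆ U ∧
    ∃ (N : ℕ) (a : LinOp n q κ (Fin N)) (piv : Fin N → MIdx n q × κ),
      a.Smooth V ∧ (∀ x ∈ V, a.system x = R x) ∧
      a.SolvedForm V piv ∧ a.MultiplicativeProlongation V piv

/-- The first order operator `b : F → F'` generates the compatibility conditions of the operator
`a : E → F`: the composite vanishes, and `J_{q+s+1}(E) → J_{s+1}(F) → J_s(F')` is exact for all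
`s ≥ 0`. Jets of order `s + 1` of sections of `F` are represented by sections `u`. -/
def GeneratesCC {ι' : Type} [Fintype ι] (V : Set (Pt n)) (a : LinOp n q κ ι)
    (b : LinOp n 1 ι ι') : Prop :=
  (∀ f : Pt n → κ → ℝ, ContDiffOn ℝ ∞ f V → ∀ x ∈ V, b.apply (a.apply f) x = 0) ∧
  ∀ x ∈ V, ∀ (s : ℕ) (u : Pt n → ι → ℝ), ContDiffOn ℝ ∞ u V →
    (∀ ν : MIdx n s, ∀ τ', mderiv ν.1 (fun z => b.apply u z τ') x = 0) →
    ∃ f : Pt n → κ → ℝ, ContDiffOn ℝ ∞ f V ∧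
      ∀ ν : MIdx n (s + 1), ∀ τ, mderiv ν.1 (fun z => u z τ - a.apply f z τ) x = 0

/-- The first order system `b` in the unknowns `yᵏ`, `k ∈ κ`, is in reduced Spencer form over `V`.
The unknowns in `S` are those called `y¹, …, y^β`, and those outside `S` are those called
`y^{β+1}, …, y^m`; an equation at `x` is a linear combination (with coefficients `c`) of the rows
of `b x`, and it is of class `≤ n - 1` if it contains no jet `yᵏ_n` at all. -/
structure ReducedSpencerForm [Fintype ι] (b : LinOp n 1 κ ι) (V : Set (Pt n)) : Prop where
  /-- the system is involutive -/
  involutive : IsInvolutive V b.system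
  /-- there is no equation of order zero -/
  no_zero_order : ∀ x ∈ V, ∀ c : ι → ℝ,
    (∀ i k, ∑ τ, c τ * b x τ (MIdx.unit i) k = 0) →
    ∀ k, ∑ τ, c τ * b x τ (MIdx.zero n 1) k = 0
  /-- the equations of class `n` can be solved with respect to the `yᵏ_n`, `k ∈ S`, they contain no
  `yˡ_n` with `l ∉ S`, and the equations of class `≤ n - 1` contain neither the `yˡ` with `l ∉ S`
  nor their jets -/
  reduced : ∀ i : Fin n, i.val + 1 = n → ∃ S : Set κ,
    (∀ x ∈ V, ∀ τ, ∀ l ∉ S, b x τ (MIdx.unit i) l = 0) ∧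
    (∀ x ∈ V, ∀ k ∈ S, ∃ c : ι → ℝ, ∑ τ, c τ * b x τ (MIdx.unit i) k = 1 ∧
      ∀ l, l ≠ k → ∑ τ, c τ * b x τ (MIdx.unit i) l = 0) ∧
    (∀ x ∈ V, ∀ c : ι → ℝ, (∀ k, ∑ τ, c τ * b x τ (MIdx.unit i) k = 0) →
      ∀ l ∉ S, ∀ μ, ∑ τ, c τ * b x τ μ l = 0)

end Op

/-! ### The Janet sequence -/

section Sequence

variable {n q m : ℕ}

/-- The fibre of `⋀ʳT* ⊗ J_q(E)`: the alternating `r`-forms with values in `J_q(E)`, where `E` has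
fibre dimension `m`. -/
abbrev FormJet (n q m r : ℕ) : Type := (Pt n) [⋀^Fin r]→L[ℝ] (Jet n q (Fin m))

/-- `⋀ʳT* ⊗ P ⊆ ⋀ʳT* ⊗ J_q(E)` for a subspace `P` of the fibre of `J_q(E)`. -/
def valuedIn (r : ℕ) (P : Submodule ℝ (Jet n q (Fin m))) :
    Submodule ℝ (FormJet n q m r) where
  carrier := {θ | ∀ v, θ v ∈ P}
  add_mem' := fun ha hb v => P.add_mem (ha v) (hb v)
  zero_mem' := fun _ => P.zero_mem
  smul_mem' := fun c _ ha v => P.smul_mem c (ha v)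

/-- The projection `⋀ʳT* ⊗ J_{q+1}(E) → ⋀ʳT* ⊗ J_q(E)`. -/
noncomputable def truncForm (n q m r : ℕ) : FormJet n (q + 1) m r →L[ℝ] FormJet n q m r :=
  ContinuousLinearMap.compContinuousAlternatingMapCLM ℝ (Pt n) _ _ (Fin r) (trunc n q (Fin m))

/-- The map `δ : ⋀ʳT* ⊗ J_{q+1}(E) → ⋀ʳ⁺¹T* ⊗ J_q(E)` with
`(δθ)ᵏ_μ = dxⁱ ∧ θᵏ_{μ+1ᵢ}`. -/
noncomputable def delta (n q m r : ℕ) : FormJet n (q + 1) m r →L[ℝ] FormJet n q m (r + 1) :=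
  (ContinuousAlternatingMap.alternatizeUncurryFinCLM ℝ (Pt n) (Jet n q (Fin m))).comp
    (∑ i : Fin n, (ContinuousLinearMap.smulRightL ℝ (Pt n) (FormJet n q m r)
      (ContinuousLinearMap.proj i)).comp
        (ContinuousLinearMap.compContinuousAlternatingMapCLM ℝ (Pt n) _ _ (Fin r) (shift n q (Fin m) i)))

/-- The Spencer operator `D : ⋀ʳT* ⊗ J_{q+1}(E) → ⋀ʳ⁺¹T* ⊗ J_q(E)` on sections, with
`(Dθ)ᵏ_μ = dθᵏ_μ - dxⁱ ∧ θᵏ_{μ+1ᵢ}`. -/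
noncomputable def spencerD (r : ℕ) (θ : Pt n → FormJet n (q + 1) m r) :
    Pt n → FormJet n q m (r + 1) :=
  fun x => extDeriv (fun z => truncForm n q m r (θ z)) x - delta n q m r (θ x)

/-- The fibre over `x` of `⋀ʳT* ⊗ R_q + δ(⋀ʳ⁻¹T* ⊗ S_{q+1}T* ⊗ E)`; the Janet bundle `F_r` is the
quotient of `⋀ʳT* ⊗ J_q(E)` by it. For `r = 0` there is no second term. -/
noncomputable def janetDenom (R : Pt n → Submodule ℝ (Jet n q (Fin m))) (x : Pt n) :
    (r : ℕ) → Submodule ℝ (FormJet n q m r)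
  | 0 => valuedIn 0 (R x)
  | r + 1 => valuedIn (r + 1) (R x) ⊔
      (valuedIn r (symTop n (q + 1) (Fin m))).map (delta n q m r).toLinearMap

/-- The Janet sequence of the system `R = R_q` over `V`, written in fibre coordinates of the Janet
bundles `F_r = ⋀ʳT* ⊗ J_q(E) / (⋀ʳT* ⊗ R_q + δ(⋀ʳ⁻¹T* ⊗ S_{q+1}T* ⊗ E))`. -/
structure JanetSequence (V : Set (Pt n)) (R : Pt n → Submodule ℝ (Jet n q (Fin m))) where
  /-- the fibre dimension of `F_r` -/
  rank : ℕ → ℕ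
  /-- the fibre coordinates of `F_r`, as smooth functions on `⋀ʳT* ⊗ J_q(E)` -/
  coord : ∀ r, Pt n → FormJet n q m r →L[ℝ] (Fin (rank r) → ℝ)
  coord_smooth : ∀ r, ContDiffOn ℝ ∞ (coord r) V
  coord_surjective : ∀ r, ∀ x ∈ V, Function.Surjective (coord r x)
  coord_ker : ∀ r, ∀ x ∈ V, (coord r x).toLinearMap.ker = janetDenom R x r
  /-- `op r` is the operator `𝒟_{r+1} : F_r → F_{r+1}` in these coordinates -/
  op : ∀ r, LinOp n 1 (Fin (rank r)) (Fin (rank (r + 1)))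
  op_smooth : ∀ r, (op r).Smooth V
  /-- `𝒟_{r+1}` is induced by the Spencer operator `D` -/
  op_induced : ∀ r, ∀ θ : Pt n → FormJet n (q + 1) m r, ContDiffOn ℝ ∞ θ V → ∀ x ∈ V,
    (op r).apply (fun z => coord r z (truncForm n q m r (θ z))) x =
      coord (r + 1) x (spencerD r θ x)

variable {V : Set (Pt n)} {R : Pt n → Submodule ℝ (Jet n q (Fin m))}

/-- The operator `𝒟 = Φ ∘ j_q : E → J_q(E) → F_0 = J_q(E)/R_q` in the coordinates of `F_0`. -/
noncomputable def JanetSequence.op₀ (J : JanetSequence V R) :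
    LinOp n q (Fin m) (Fin (J.rank 0)) :=
  fun x τ μ k => J.coord 0 x
    (ContinuousAlternatingMap.constOfIsEmpty ℝ (Pt n) (Fin 0)
      (Pi.single μ (Pi.single k 1))) τ

/-- The fibre coordinates of the Janet bundles are adapted: the equations of `𝒟`, and successively
those of `𝒟₁, 𝒟₂, …`, are in solved form. -/
def JanetSequence.IsSolved (J : JanetSequence V R) : Prop :=
  (∃ piv, J.op₀.SolvedForm V piv) ∧ ∀ r, ∃ piv, (J.op r).SolvedForm V piv

end Sequence

end Janet

open Janet

/-! Everything is controlled by symbols, and the symbols by counting leading jets.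

In solved form the symbols of the multiplicative prolongations are independent: among the splittings
`μ + ν` of a multi-index with `|ν|` fixed, the one with `ν` multiplicative for `μ` has the smallest
weight of `ν`, so the leading jets give a triangular matrix (`LinOp.SolvedForm.exists_symbol`).
Hence some section has an image with any prescribed multiplicative derivatives at a point
(`LinOp.SolvedForm.exists_section`).

The symbol of `𝒟_{r+1}` sends `∑ dxʲ ⊗ wⱼ` to `∑ dxʲ ∧ wⱼ` (`Induced.symb_eq`). It is onto, and
exactness of the Koszul complex identifies its kernel with the image of the prolonged symbol of the
preceding operator (`sum_wd_mem_projOp_iff`, `sum_wd_mem_iff`).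

If the symbol of the preceding operator is involutive, a dimension count forces the leading jets of
the next operator to be exactly the `u^τ_j` with `xʲ` nonmultiplicative for `Φ^τ` (`leadsComplete`).
Its equations therefore express the nonmultiplicative derivatives through the multiplicative ones
(`LeadsComplete.flat`). Subtracting from `u` the image of a section with the same multiplicative
derivatives leaves something flat. This yields both the generation of the compatibility conditions
(`generatesCC`) and the involution of the next operator (`multiplicativeProlongation`), so the
argument repeats along the sequence.

Reduced Spencer form follows by testing the composite on single jets: a leading jet of class `n`
involves only `xⁿ`, so its image has very few components (`reducedSpencerForm`).

Adapted coordinates are arbitrary, while involution is given only for some local equations;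
`SymbolInvolutive.of_same_kernel` bridges the gap. For existence, the image of an involutive symbol
has smooth equations in solved form (`exists_symbol_equations`). They serve as coordinates of the
next bundle (`exists_coord_succ`), and the Spencer operator descends
(`spencerD_mem_janetDenom_zero`, `spencerD_mem_janetDenom_succ`, `exists_induced`). -/

namespace Janet

/-! ### Iterated partial derivatives and polynomials with prescribed jets -/

section Derivatives

variable {n : ℕ} {V : Set (Pt n)}

theorem contDiffOn_pderiv (hV : IsOpen V) {f : Pt n → ℝ} (hf : ContDiffOn ℝ ∞ f V) (i : Fin n) :
    ContDiffOn ℝ ∞ (pderiv i f) V := by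
  have h := hf.fderiv_of_isOpen (m := ∞) hV (by simp)
  exact h.clm_apply contDiffOn_const

theorem pderiv_eqOn (hV : IsOpen V) {f g : Pt n → ℝ} (h : Set.EqOn f g V) (i : Fin n) :
    Set.EqOn (pderiv i f) (pderiv i g) V := fun x hx => by
  have : f =ᶠ[nhds x] g := h.eventuallyEq_of_mem (hV.mem_nhds hx)
  simp only [pderiv, this.fderiv_eq]

theorem differentiableAt_of_contDiffOn {F : Type*} [NormedAddCommGroup F] [NormedSpace ℝ F]
    (hV : IsOpen V) {f : Pt n → F} (hf : ContDiffOn ℝ ∞ f V) {x : Pt n} (hx : x ∈ V) :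
    DifferentiableAt ℝ f x :=
  (hf.contDiffAt (hV.mem_nhds hx)).differentiableAt (by simp)

theorem pderiv_comm (hV : IsOpen V) {f : Pt n → ℝ} (hf : ContDiffOn ℝ ∞ f V) (i j : Fin n) :
    Set.EqOn (pderiv i (pderiv j f)) (pderiv j (pderiv i f)) V := fun x hx => by
  have hd : DifferentiableAt ℝ (fderiv ℝ f) x :=
    differentiableAt_of_contDiffOn hV (hf.fderiv_of_isOpen (m := ∞) hV (by simp)) hx
  have hs : IsSymmSndFDerivAt ℝ f x :=
    (hf.contDiffAt (hV.mem_nhds hx)).isSymmSndFDerivAt (by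
      simp only [minSmoothness_of_isRCLikeNormedField]
      exact WithTop.coe_le_coe.2 le_top)
  have h : ∀ k l : Fin n, pderiv k (pderiv l f) x
      = fderiv ℝ (fderiv ℝ f) x (Pi.single k 1) (Pi.single l 1) := fun k l => by
    unfold pderiv
    rw [fderiv_clm_apply hd (differentiableAt_const _)]
    simp
  rw [h, h, hs.eq]

theorem pderiv_mul (hV : IsOpen V) {f g : Pt n → ℝ} (hf : ContDiffOn ℝ ∞ f V)
    (hg : ContDiffOn ℝ ∞ g V) (i : Fin n) {x : Pt n} (hx : x ∈ V) :
    pderiv i (fun z => f z * g z) x = pderiv i f x * g x + f x * pderiv i g x := by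
  simp only [pderiv]
  rw [fderiv_fun_mul (differentiableAt_of_contDiffOn hV hf hx)
    (differentiableAt_of_contDiffOn hV hg hx)]
  simp
  ring

theorem pderiv_sum (hV : IsOpen V) {ι : Type*} (s : Finset ι) {f : ι → Pt n → ℝ}
    (hf : ∀ j ∈ s, ContDiffOn ℝ ∞ (f j) V) (i : Fin n) {x : Pt n} (hx : x ∈ V) :
    pderiv i (fun z => ∑ j ∈ s, f j z) x = ∑ j ∈ s, pderiv i (f j) x := by
  simp only [pderiv]
  rw [fderiv_fun_sum fun j hj => differentiableAt_of_contDiffOn hV (hf j hj) hx]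
  simp

/-- Iterated partial derivatives along a list of directions. -/
noncomputable def listDeriv (l : List (Fin n)) (μ : Fin n → ℕ) (f : Pt n → ℝ) : Pt n → ℝ :=
  l.foldr (fun i g => (pderiv i)^[μ i] g) f

theorem contDiffOn_iterate_pderiv (hV : IsOpen V) (i : Fin n) (k : ℕ) {f : Pt n → ℝ}
    (hf : ContDiffOn ℝ ∞ f V) : ContDiffOn ℝ ∞ ((pderiv i)^[k] f) V := by
  induction k with
  | zero => exact hf
  | succ k ih => rw [Function.iterate_succ_apply']; exact contDiffOn_pderiv hV ih i

theorem iterate_pderiv_eqOn (hV : IsOpen V) (i : Fin n) (k : ℕ) {f g : Pt n → ℝ}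
    (h : Set.EqOn f g V) : Set.EqOn ((pderiv i)^[k] f) ((pderiv i)^[k] g) V := by
  induction k with
  | zero => exact h
  | succ k ih => simp only [Function.iterate_succ_apply']; exact pderiv_eqOn hV ih i

theorem pderiv_iterate_comm (hV : IsOpen V) (i j : Fin n) (k : ℕ) {f : Pt n → ℝ}
    (hf : ContDiffOn ℝ ∞ f V) :
    Set.EqOn (pderiv i ((pderiv j)^[k] f)) ((pderiv j)^[k] (pderiv i f)) V := by
  induction k with
  | zero => exact fun _ _ => rfl
  | succ k ih =>
    simp only [Function.iterate_succ_apply']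
    exact (pderiv_comm hV (contDiffOn_iterate_pderiv hV j k hf) i j).trans (pderiv_eqOn hV ih j)

theorem contDiffOn_listDeriv (hV : IsOpen V) (l : List (Fin n)) (μ : Fin n → ℕ) {f : Pt n → ℝ}
    (hf : ContDiffOn ℝ ∞ f V) : ContDiffOn ℝ ∞ (listDeriv l μ f) V := by
  induction l with
  | nil => exact hf
  | cons a t ih => exact contDiffOn_iterate_pderiv hV a (μ a) ih

theorem listDeriv_eqOn (hV : IsOpen V) (l : List (Fin n)) (μ : Fin n → ℕ) {f g : Pt n → ℝ}
    (h : Set.EqOn f g V) : Set.EqOn (listDeriv l μ f) (listDeriv l μ g) V := by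
  induction l with
  | nil => exact h
  | cons a t ih => exact iterate_pderiv_eqOn hV a (μ a) ih

theorem pderiv_listDeriv (hV : IsOpen V) (l : List (Fin n)) (μ : Fin n → ℕ) (i : Fin n)
    {f : Pt n → ℝ} (hf : ContDiffOn ℝ ∞ f V) :
    Set.EqOn (pderiv i (listDeriv l μ f)) (listDeriv l μ (pderiv i f)) V := by
  induction l with
  | nil => exact fun _ _ => rfl
  | cons a t ih =>
    exact (pderiv_iterate_comm hV i a (μ a) (contDiffOn_listDeriv hV t μ hf)).trans
      (iterate_pderiv_eqOn hV a (μ a) ih)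

theorem listDeriv_add_single_of_notMem (l : List (Fin n)) (μ : Fin n → ℕ) (i : Fin n)
    (hi : i ∉ l) (f : Pt n → ℝ) : listDeriv l (μ + Pi.single i 1) f = listDeriv l μ f := by
  induction l with
  | nil => rfl
  | cons a t ih =>
    have hia : a ≠ i := fun h => hi (by simp [h])
    have : listDeriv (a :: t) (μ + Pi.single i 1) f
        = (pderiv a)^[(μ + Pi.single i 1 : Fin n → ℕ) a] (listDeriv t (μ + Pi.single i 1) f) := rfl
    rw [this, ih fun h => hi (by simp [h])]
    simp [listDeriv, hia]

/-- Since `i` occurs only once in `l`, the extra derivative enters at a single place, from where it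
commutes inward past the derivatives already applied. -/
theorem listDeriv_add_single (hV : IsOpen V) (l : List (Fin n)) (hl : l.Nodup) (μ : Fin n → ℕ)
    (i : Fin n) (hi : i ∈ l) {f : Pt n → ℝ} (hf : ContDiffOn ℝ ∞ f V) :
    Set.EqOn (listDeriv l (μ + Pi.single i 1) f) (listDeriv l μ (pderiv i f)) V := by
  induction l with
  | nil => simp at hi
  | cons a t ih =>
    have h1 : listDeriv (a :: t) (μ + Pi.single i 1) f
        = (pderiv a)^[(μ + Pi.single i 1 : Fin n → ℕ) a] (listDeriv t (μ + Pi.single i 1) f) := rfl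
    have h2 : listDeriv (a :: t) μ (pderiv i f)
        = (pderiv a)^[μ a] (listDeriv t μ (pderiv i f)) := rfl
    rw [List.nodup_cons] at hl
    rw [h1, h2]
    by_cases ha : a = i
    · subst ha
      rw [listDeriv_add_single_of_notMem t μ a hl.1 f]
      have : (μ + Pi.single a 1 : Fin n → ℕ) a = μ a + 1 := by simp
      rw [this, Function.iterate_succ_apply]
      exact iterate_pderiv_eqOn hV a (μ a) (pderiv_listDeriv hV t μ a hf)
    · have : (μ + Pi.single i 1 : Fin n → ℕ) a = μ a := by simp [ha]
      rw [this]
      have hit : i ∈ t := by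
        rcases List.mem_cons.1 hi with h | h
        · exact absurd h.symm ha
        · exact h
      exact iterate_pderiv_eqOn hV a (μ a) (ih hl.2 hit)

theorem contDiffOn_mderiv (hV : IsOpen V) (μ : Fin n → ℕ) {f : Pt n → ℝ}
    (hf : ContDiffOn ℝ ∞ f V) : ContDiffOn ℝ ∞ (mderiv μ f) V :=
  contDiffOn_listDeriv hV _ μ hf

theorem mderiv_eqOn (hV : IsOpen V) (μ : Fin n → ℕ) {f g : Pt n → ℝ} (h : Set.EqOn f g V) :
    Set.EqOn (mderiv μ f) (mderiv μ g) V :=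
  listDeriv_eqOn hV _ μ h

theorem mderiv_add_single (hV : IsOpen V) (μ : Fin n → ℕ) (i : Fin n) {f : Pt n → ℝ}
    (hf : ContDiffOn ℝ ∞ f V) :
    Set.EqOn (mderiv (μ + Pi.single i 1) f) (mderiv μ (pderiv i f)) V :=
  listDeriv_add_single hV _ (List.nodup_finRange n) μ i (List.mem_finRange i) hf

theorem pderiv_mderiv (hV : IsOpen V) (μ : Fin n → ℕ) (i : Fin n) {f : Pt n → ℝ}
    (hf : ContDiffOn ℝ ∞ f V) :
    Set.EqOn (pderiv i (mderiv μ f)) (mderiv (μ + Pi.single i 1) f) V :=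
  (pderiv_listDeriv hV _ μ i hf).trans (mderiv_add_single hV μ i hf).symm

@[simp]
theorem mderiv_zero (f : Pt n → ℝ) : mderiv (0 : Fin n → ℕ) f = f := by
  unfold mderiv
  induction List.finRange n with
  | nil => rfl
  | cons a t ih => simp

theorem multiIndex_induction {P : (Fin n → ℕ) → Prop} (h0 : P 0)
    (h1 : ∀ μ i, P μ → P (μ + Pi.single i 1)) (μ : Fin n → ℕ) : P μ := by
  induction hs : ∑ i, μ i generalizing μ with
  | zero =>
    have : μ = 0 := by
      funext i
      exact (Finset.sum_eq_zero_iff.1 hs) i (Finset.mem_univ i)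
    exact this ▸ h0
  | succ k ih =>
    obtain ⟨i, hi⟩ : ∃ i, μ i ≠ 0 := by
      by_contra! h
      simp [h] at hs
    have hμ : μ = (μ - Pi.single i 1) + Pi.single i 1 := by
      funext j
      by_cases hj : j = i
      · subst hj; simp; omega
      · simp [hj]
    rw [hμ]
    refine h1 _ _ (ih _ ?_)
    have h2 := congrArg (fun ν : Fin n → ℕ => ∑ j, ν j) hμ
    simp only [Pi.add_apply, Finset.sum_add_distrib, Finset.sum_pi_single', Finset.mem_univ,
      if_true] at h2
    omega

theorem mderiv_single (hV : IsOpen V) (i : Fin n) {f : Pt n → ℝ} (hf : ContDiffOn ℝ ∞ f V) :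
    Set.EqOn (mderiv (Pi.single i 1) f) (pderiv i f) V := by
  simpa using mderiv_add_single hV 0 i hf

theorem mderiv_mderiv (hV : IsOpen V) (μ ν : Fin n → ℕ) {f : Pt n → ℝ}
    (hf : ContDiffOn ℝ ∞ f V) : Set.EqOn (mderiv (μ + ν) f) (mderiv μ (mderiv ν f)) V := by
  induction ν using multiIndex_induction generalizing f with
  | h0 => simp [Set.EqOn]
  | h1 ν i ih =>
    rw [← add_assoc]
    exact ((mderiv_add_single hV (μ + ν) i hf).trans (ih (contDiffOn_pderiv hV hf i))).trans
      (mderiv_eqOn hV μ (mderiv_add_single hV ν i hf).symm)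

theorem mderiv_sum (hV : IsOpen V) {ι : Type*} (s : Finset ι) {f : ι → Pt n → ℝ}
    (hf : ∀ j ∈ s, ContDiffOn ℝ ∞ (f j) V) (μ : Fin n → ℕ) :
    Set.EqOn (mderiv μ fun z => ∑ j ∈ s, f j z) (fun z => ∑ j ∈ s, mderiv μ (f j) z) V := by
  induction μ using multiIndex_induction generalizing f with
  | h0 => simp [Set.EqOn]
  | h1 μ i ih =>
    intro x hx
    rw [mderiv_add_single hV μ i (ContDiffOn.sum hf) hx,
      mderiv_eqOn hV μ (fun z hz => pderiv_sum hV s hf i hz) hx,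
      ih (fun j hj => contDiffOn_pderiv hV (hf j hj) i) hx]
    exact Finset.sum_congr rfl fun j hj => (mderiv_add_single hV μ i (hf j hj) hx).symm

theorem mderiv_add (hV : IsOpen V) {f g : Pt n → ℝ} (hf : ContDiffOn ℝ ∞ f V)
    (hg : ContDiffOn ℝ ∞ g V) (μ : Fin n → ℕ) :
    Set.EqOn (mderiv μ fun z => f z + g z) (fun z => mderiv μ f z + mderiv μ g z) V := by
  have := mderiv_sum hV (Finset.univ : Finset Bool) (f := fun b => cond b f g)
    (by rintro (_ | _) _ <;> assumption) μ
  simpa using this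

/-- `h` has vanishing derivatives at `x` in all orders below that of `ν`: only the term with
all derivatives on `h` survives in the Leibniz rule. -/
theorem mderiv_mul_of_flat (hV : IsOpen V) {x : Pt n} (hx : x ∈ V) (ν : Fin n → ℕ)
    {g h : Pt n → ℝ} (hg : ContDiffOn ℝ ∞ g V) (hh : ContDiffOn ℝ ∞ h V)
    (hflat : ∀ ν' : Fin n → ℕ, ∑ i, ν' i < ∑ i, ν i → mderiv ν' h x = 0) :
    mderiv ν (fun z => g z * h z) x = g x * mderiv ν h x := by
  induction ν using multiIndex_induction generalizing g h with
  | h0 => simp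
  | h1 ν i ih =>
    have hsum : ∀ l : Fin n → ℕ, ∑ j, (l + Pi.single i 1 : Fin n → ℕ) j = ∑ j, l j + 1 := fun l => by
      simp [Finset.sum_add_distrib]
    have hgi := contDiffOn_pderiv hV hg i
    have hhi := contDiffOn_pderiv hV hh i
    rw [mderiv_add_single hV ν i (hg.mul hh) hx,
      mderiv_eqOn hV ν (fun z hz => pderiv_mul hV hg hh i hz) hx,
      mderiv_add hV (hgi.mul hh) (hg.mul hhi) ν hx]
    beta_reduce
    rw [ih hgi hh (fun ν' h' => hflat ν' (by rw [hsum]; omega)),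
      ih hg hhi (fun ν' h' => by
        rw [← mderiv_add_single hV ν' i hh hx]
        exact hflat _ (by rw [hsum, hsum]; omega)),
      hflat ν (by rw [hsum]; omega), mul_zero, zero_add, mderiv_add_single hV ν i hh hx]

theorem mderiv_const_mul (hV : IsOpen V) (c : ℝ) {f : Pt n → ℝ} (hf : ContDiffOn ℝ ∞ f V)
    (μ : Fin n → ℕ) : Set.EqOn (mderiv μ fun z => c * f z) (fun z => c * mderiv μ f z) V := by
  induction μ using multiIndex_induction generalizing f with
  | h0 => simp [Set.EqOn]
  | h1 μ i ih =>
    intro x hx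
    rw [mderiv_add_single hV μ i (contDiffOn_const.mul hf) hx]
    have : Set.EqOn (pderiv i fun z => c * f z) (fun z => c * pderiv i f z) V := fun z hz => by
      rw [pderiv_mul hV contDiffOn_const hf i hz]
      simp [pderiv]
    rw [mderiv_eqOn hV μ this hx, ih (contDiffOn_pderiv hV hf i) hx]
    simp only [mderiv_add_single hV μ i hf hx]

/-- The monomial `(z - x)^λ / λ!`. -/
noncomputable def mono (x : Pt n) (l : Fin n → ℕ) (z : Pt n) : ℝ :=
  ∏ i, (z i - x i) ^ l i / (l i).factorial

theorem contDiff_mono (x : Pt n) (l : Fin n → ℕ) : ContDiff ℝ ∞ (mono x l) := by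
  unfold mono
  fun_prop

theorem pderiv_mono (x : Pt n) (l : Fin n → ℕ) (i : Fin n) :
    pderiv i (mono x l) = if l i = 0 then fun _ => 0 else mono x (l - Pi.single i 1) := by
  funext z
  let g : Fin n → Pt n → ℝ := fun j z => (z j - x j) ^ l j / (l j).factorial
  let g' : Fin n → (Pt n →L[ℝ] ℝ) := fun j =>
    ((l j : ℝ) * (z j - x j) ^ (l j - 1) / (l j).factorial) • ContinuousLinearMap.proj j
  have hg : ∀ j ∈ Finset.univ, HasFDerivAt (g j) (g' j) z := fun j _ => by
    have h1 : HasFDerivAt (fun z : Pt n => z j - x j)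
        (ContinuousLinearMap.proj (R := ℝ) (φ := fun _ : Fin n => ℝ) j) z :=
      (hasFDerivAt_apply j z).sub_const _
    have h2 := ((hasDerivAt_pow (l j) (z j - x j)).div_const
      ((l j).factorial : ℝ)).comp_hasFDerivAt z h1
    exact h2
  have h := HasFDerivAt.finsetProd hg
  have h2 : pderiv i (mono x l) z
      = (∏ j ∈ Finset.univ.erase i, g j z) * ((l i : ℝ) * (z i - x i) ^ (l i - 1) / (l i).factorial) := by
    have h3 : HasFDerivAt (mono x l) _ z := h
    rw [pderiv, h3.fderiv]
    simp [g', Pi.single_apply]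
  rw [h2]
  split_ifs with hi
  · simp [hi]
  · rw [mono, ← Finset.mul_prod_erase _ _ (Finset.mem_univ i), mul_comm]
    congr 1
    · obtain ⟨k, hk⟩ := Nat.exists_eq_succ_of_ne_zero hi
      have : (l - Pi.single i 1 : Fin n → ℕ) i = k := by simp [hk]
      rw [this, hk, Nat.factorial_succ]
      have : (k.factorial : ℝ) ≠ 0 := by positivity
      have : (k : ℝ) + 1 ≠ 0 := by positivity
      push_cast
      field_simp
    · refine Finset.prod_congr rfl fun j hj => ?_
      simp [g, (Finset.mem_erase.1 hj).1]

theorem mono_self (x : Pt n) (l : Fin n → ℕ) : mono x l x = if l = 0 then 1 else 0 := by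
  split_ifs with h
  · simp [mono, h]
  · obtain ⟨i, hi⟩ : ∃ i, l i ≠ 0 := by
      by_contra! h'
      exact h (funext h')
    exact Finset.prod_eq_zero (Finset.mem_univ i) (by simp [hi])

theorem mderiv_mono (x : Pt n) (μ l : Fin n → ℕ) :
    mderiv μ (mono x l) x = if μ = l then 1 else 0 := by
  induction μ using multiIndex_induction generalizing l with
  | h0 => simp [mono_self, eq_comm]
  | h1 μ i ih =>
    rw [mderiv_add_single isOpen_univ μ i (contDiff_mono x l).contDiffOn (Set.mem_univ x),
      pderiv_mono]
    by_cases hi : l i = 0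
    · have h1 : μ + Pi.single i 1 ≠ l := fun h => by
        have := congrFun h i
        simp [hi] at this
      have h2 := mderiv_const_mul isOpen_univ 0 (f := fun _ : Pt n => (0 : ℝ)) contDiffOn_const μ
        (Set.mem_univ x)
      simp only [mul_zero, zero_mul] at h2
      simp [hi, h1, h2]
    · rw [if_neg hi, ih]
      congr 1
      refine propext ⟨fun h => ?_, fun h => ?_⟩
      · rw [h]
        funext j
        by_cases hj : j = i
        · subst hj; simp; omega
        · simp [hj]
      · rw [← h]
        funext j
        simp

/-- The polynomial section with derivatives `y` at `x` up to order `N`. -/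
noncomputable def jetPoly {κ : Type} (x : Pt n) (N : ℕ) (y : (Fin n → ℕ) → κ → ℝ) (z : Pt n)
    (k : κ) : ℝ :=
  ∑ l ∈ multiIdx n N, y l k * mono x l z

theorem contDiff_jetPoly_apply {κ : Type} (x : Pt n) (N : ℕ) (y : (Fin n → ℕ) → κ → ℝ) (k : κ) :
    ContDiff ℝ ∞ (fun z => jetPoly x N y z k) :=
  ContDiff.sum fun l _ => contDiff_const.mul (contDiff_mono x l)

theorem contDiff_jetPoly {κ : Type} [Fintype κ] (x : Pt n) (N : ℕ) (y : (Fin n → ℕ) → κ → ℝ) :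
    ContDiff ℝ ∞ (jetPoly x N y) :=
  contDiff_pi.2 (contDiff_jetPoly_apply x N y)

theorem mderiv_jetPoly {κ : Type} (x : Pt n) (N : ℕ) (y : (Fin n → ℕ) → κ → ℝ) (μ : Fin n → ℕ)
    (k : κ) : mderiv μ (fun z => jetPoly x N y z k) x = if ∑ i, μ i ≤ N then y μ k else 0 := by
  unfold jetPoly
  rw [mderiv_sum isOpen_univ _
    (fun l _ => (contDiff_const.mul (contDiff_mono x l)).contDiffOn) μ (Set.mem_univ x)]
  have : ∀ l, mderiv μ (fun z => y l k * mono x l z) x = if μ = l then y l k else 0 := fun l => by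
    rw [mderiv_const_mul isOpen_univ _ (contDiff_mono x l).contDiffOn μ (Set.mem_univ x)]
    simp only [mderiv_mono]
    simp
  simp only [this, Finset.sum_ite_eq, mem_multiIdx]

end Derivatives

/-- The `q`-jet of a section. -/
noncomputable def jet {n : ℕ} {κ : Type} (q : ℕ) (f : Pt n → κ → ℝ) (x : Pt n) : Jet n q κ :=
  fun μ k => mderiv μ.1 (fun z => f z k) x

theorem trunc_jet {n q : ℕ} {κ : Type} (f : Pt n → κ → ℝ) (x : Pt n) :
    trunc n q κ (jet (q + 1) f x) = jet q f x := rfl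

/-- The polynomial section with a given jet at `x`. -/
noncomputable def jetSection {n q : ℕ} {κ : Type} (x : Pt n) (y : Jet n q κ) : Pt n → κ → ℝ :=
  jetPoly x q fun l k => if hl : l ∈ multiIdx n q then y ⟨l, hl⟩ k else 0

theorem contDiff_jetSection {n q : ℕ} {κ : Type} [Fintype κ] (x : Pt n) (y : Jet n q κ) :
    ContDiff ℝ ∞ (jetSection x y) :=
  contDiff_jetPoly _ _ _

theorem jet_jetSection {n q : ℕ} {κ : Type} (x : Pt n) (y : Jet n q κ) :
    jet q (jetSection x y) x = y := by
  funext μ k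
  unfold jet jetSection
  rw [mderiv_jetPoly, if_pos (mem_multiIdx.1 μ.2), dif_pos μ.2]

/-! ### Linear differential operators acting on sections -/

section Apply

variable {n q : ℕ} {κ ι : Type} [Fintype κ] {V : Set (Pt n)}

theorem contDiffOn_apply {a : LinOp n q κ ι} (hV : IsOpen V) (ha : a.Smooth V)
    {f : Pt n → κ → ℝ} (hf : ∀ k, ContDiffOn ℝ ∞ (fun z => f z k) V) (τ : ι) :
    ContDiffOn ℝ ∞ (fun z => a.apply f z τ) V :=
  ContDiffOn.sum fun μ _ => ContDiffOn.sum fun k _ =>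
    (ha τ μ k).mul (contDiffOn_mderiv hV μ.1 (hf k))

theorem apply_eqOn {a : LinOp n q κ ι} (hV : IsOpen V) {f g : Pt n → κ → ℝ}
    (h : Set.EqOn f g V) : Set.EqOn (a.apply f) (a.apply g) V := fun x hx => by
  funext τ
  refine Finset.sum_congr rfl fun μ _ => Finset.sum_congr rfl fun k _ => ?_
  rw [mderiv_eqOn hV μ.1 (fun z hz => congrFun (h hz) k) hx]

theorem apply_add {a : LinOp n q κ ι} (hV : IsOpen V) {f g : Pt n → κ → ℝ}
    (hf : ∀ k, ContDiffOn ℝ ∞ (fun z => f z k) V) (hg : ∀ k, ContDiffOn ℝ ∞ (fun z => g z k) V) :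
    Set.EqOn (a.apply fun z k => f z k + g z k) (fun z => a.apply f z + a.apply g z) V :=
  fun x hx => by
  funext τ
  simp only [LinOp.apply, Pi.add_apply, ← Finset.sum_add_distrib]
  refine Finset.sum_congr rfl fun μ _ => Finset.sum_congr rfl fun k _ => ?_
  rw [mderiv_add hV (hf k) (hg k) μ.1 hx, mul_add]

theorem apply_const_mul {a : LinOp n q κ ι} (hV : IsOpen V) (c : ℝ) {f : Pt n → κ → ℝ}
    (hf : ∀ k, ContDiffOn ℝ ∞ (fun z => f z k) V) :
    Set.EqOn (a.apply fun z k => c * f z k) (fun z => c • a.apply f z) V :=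
  fun x hx => by
  funext τ
  simp only [LinOp.apply, Pi.smul_apply, smul_eq_mul, Finset.mul_sum]
  refine Finset.sum_congr rfl fun μ _ => Finset.sum_congr rfl fun k _ => ?_
  rw [mderiv_const_mul hV c (hf k) μ.1 hx]
  ring

theorem apply_sub {a : LinOp n q κ ι} (hV : IsOpen V) {f g : Pt n → κ → ℝ}
    (hf : ∀ k, ContDiffOn ℝ ∞ (fun z => f z k) V) (hg : ∀ k, ContDiffOn ℝ ∞ (fun z => g z k) V) :
    Set.EqOn (a.apply fun z k => f z k - g z k) (fun z => a.apply f z - a.apply g z) V :=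
  fun x hx => by
  have h1 : (fun z k => f z k - g z k) = fun z k => f z k + (-1) * g z k := by
    funext z k; ring
  rw [h1, apply_add hV hf (fun k => contDiffOn_const.mul (hg k)) hx]
  simp only [apply_const_mul hV (-1) hg hx]
  simp [sub_eq_add_neg]

theorem apply_eq_eval (a : LinOp n q κ ι) (f : Pt n → κ → ℝ) (x : Pt n) (τ : ι) :
    a.apply f x τ = a.eval x τ (jet q f x) := rfl

theorem pderiv_apply {a : LinOp n q κ ι} (hV : IsOpen V) (ha : a.Smooth V)
    {f : Pt n → κ → ℝ} (hf : ∀ k, ContDiffOn ℝ ∞ (fun z => f z k) V) (τ : ι) (j : Fin n)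
    {x : Pt n} (hx : x ∈ V) :
    pderiv j (fun z => a.apply f z τ) x = a.evalD x j τ (jet (q + 1) f x) := by
  unfold LinOp.apply LinOp.evalD
  rw [pderiv_sum hV _ (fun μ _ => ContDiffOn.sum fun k _ =>
    (ha τ μ k).mul (contDiffOn_mderiv hV μ.1 (hf k))) j hx]
  refine Finset.sum_congr rfl fun μ _ => ?_
  rw [pderiv_sum hV _ (fun k _ => (ha τ μ k).mul (contDiffOn_mderiv hV μ.1 (hf k))) j hx]
  refine Finset.sum_congr rfl fun k _ => ?_
  rw [pderiv_mul hV (ha τ μ k) (contDiffOn_mderiv hV μ.1 (hf k)) j hx,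
    pderiv_mderiv hV μ.1 j (hf k) hx, add_comm]
  rfl

/-- Derivatives at `x` of the image of a section whose jets at `x` vanish in low orders. -/
theorem mderiv_apply_of_flat {a : LinOp n q κ ι} (hV : IsOpen V) (ha : a.Smooth V)
    {f : Pt n → κ → ℝ} (hf : ∀ k, ContDiffOn ℝ ∞ (fun z => f z k) V) (τ : ι)
    {x : Pt n} (hx : x ∈ V) (ν : Fin n → ℕ)
    (hflat : ∀ l : Fin n → ℕ, ∑ i, l i < ∑ i, ν i + q → ∀ k, mderiv l (fun z => f z k) x = 0) :
    mderiv ν (fun z => a.apply f z τ) x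
      = ∑ μ : MIdx n q, ∑ k, if μ.len = q then
          a x τ μ k * mderiv (μ.1 + ν) (fun z => f z k) x else 0 := by
  unfold LinOp.apply
  rw [mderiv_sum hV _ (fun μ _ => ContDiffOn.sum fun k _ =>
    (ha τ μ k).mul (contDiffOn_mderiv hV μ.1 (hf k))) ν hx]
  refine Finset.sum_congr rfl fun μ _ => ?_
  rw [mderiv_sum hV _ (fun k _ => (ha τ μ k).mul (contDiffOn_mderiv hV μ.1 (hf k))) ν hx]
  refine Finset.sum_congr rfl fun k _ => ?_
  have hμ : ∑ i, μ.1 i ≤ q := mem_multiIdx.1 μ.2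
  rw [mderiv_mul_of_flat hV hx ν (ha τ μ k) (contDiffOn_mderiv hV μ.1 (hf k)),
    ← mderiv_mderiv hV ν μ.1 (hf k) hx, add_comm ν]
  · split_ifs with h
    · rfl
    · rw [hflat _ _ k, mul_zero]
      have : ∑ i, μ.1 i ≠ q := h
      simp only [Pi.add_apply, Finset.sum_add_distrib]
      omega
  · intro ν' h'
    rw [← mderiv_mderiv hV ν' μ.1 (hf k) hx]
    apply hflat
    simp only [Pi.add_apply, Finset.sum_add_distrib]
    omega

end Apply


/-! ### Classes, multiplicative variables and weights of multi-indices -/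

section MultiIndices

variable {n q : ℕ}

theorem exists_jetClass_eq {μ : Fin n → ℕ} (hμ : μ ≠ 0) :
    ∃ i : Fin n, jetClass μ = i.val + 1 ∧ μ i ≠ 0 ∧ ∀ j, j < i → μ j = 0 := by
  have hne : {c | ∃ i : Fin n, i.val + 1 = c ∧ μ i ≠ 0}.Nonempty := by
    obtain ⟨i, hi⟩ := Function.ne_iff.1 hμ
    exact ⟨_, i, rfl, hi⟩
  obtain ⟨i, hi, h⟩ := Nat.sInf_mem hne
  refine ⟨i, hi.symm, h, fun j hj => ?_⟩
  by_contra h0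
  have : sInf {c | ∃ i : Fin n, i.val + 1 = c ∧ μ i ≠ 0} ≤ j.val + 1 := Nat.sInf_le ⟨j, rfl, h0⟩
  have : j.val < i.val := hj
  omega

theorem jetClass_le {μ : Fin n → ℕ} {i : Fin n} (hi : μ i ≠ 0) : jetClass μ ≤ i.val + 1 :=
  Nat.sInf_le ⟨i, rfl, hi⟩

theorem jetClass_single (i : Fin n) : jetClass (Pi.single i 1 : Fin n → ℕ) = i.val + 1 := by
  obtain ⟨j, hj, h, -⟩ := exists_jetClass_eq (μ := (Pi.single i 1 : Fin n → ℕ))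
    (fun h => by simpa using congrFun h i)
  have : j = i := by
    by_contra hji
    simp [hji] at h
  rw [hj, this]

theorem MIdx.ne_zero_of_len (hq : 1 ≤ q) {μ : MIdx n q} (h : μ.len = q) : μ.1 ≠ 0 := fun h0 => by
  simp only [MIdx.len, h0, Pi.zero_apply, Finset.sum_const_zero] at h
  omega

theorem unit_val (i : Fin n) : (MIdx.unit i).1 = Pi.single i 1 := by
  simp [MIdx.unit, MIdx.succ, MIdx.zero]

theorem unit_injective : Function.Injective (MIdx.unit : Fin n → MIdx n 1) := fun i j h => by
  have h1 := congrArg (fun μ : MIdx n 1 => μ.1 j) h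
  by_contra hij
  simp [unit_val, Ne.symm hij] at h1

theorem len_unit (i : Fin n) : (MIdx.unit i).len = 1 := by
  simp [MIdx.len, unit_val]

theorem len_zero : (MIdx.zero n q).len = 0 := by
  simp [MIdx.len, MIdx.zero]

theorem eq_zero_or_eq_unit (μ : MIdx n 1) : μ = MIdx.zero n 1 ∨ ∃ i, μ = MIdx.unit i := by
  by_cases h : μ.1 = 0
  · exact Or.inl (Subtype.ext h)
  · obtain ⟨i, hi⟩ := Function.ne_iff.1 h
    have hs : ∑ j, μ.1 j ≤ 1 := mem_multiIdx.1 μ.2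
    rw [← Finset.add_sum_erase _ _ (Finset.mem_univ i)] at hs
    have hi' : μ.1 i ≠ 0 := hi
    have h0 : ∑ j ∈ Finset.univ.erase i, μ.1 j = 0 := by omega
    refine Or.inr ⟨i, Subtype.ext (funext fun j => ?_)⟩
    rw [unit_val]
    by_cases hj : j = i
    · subst hj; simp; omega
    · rw [Finset.sum_eq_zero_iff.1 h0 j (by simp [hj])]
      simp [hj]

theorem sum_midx_one {M : Type*} [AddCommMonoid M] (F : MIdx n 1 → M) :
    ∑ μ, F μ = F (MIdx.zero n 1) + ∑ i, F (MIdx.unit i) := by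
  classical
  have h0 : MIdx.zero n 1 ∉ Finset.univ.image (MIdx.unit : Fin n → MIdx n 1) := fun h => by
    obtain ⟨i, -, hi⟩ := Finset.mem_image.1 h
    have := congrArg MIdx.len hi
    simp [len_unit, len_zero] at this
  have hu : (Finset.univ : Finset (MIdx n 1)) =
      insert (MIdx.zero n 1) (Finset.univ.image (MIdx.unit : Fin n → MIdx n 1)) := by
    ext μ
    rcases eq_zero_or_eq_unit μ with h | ⟨i, h⟩ <;> simp [h]
  rw [hu, Finset.sum_insert h0, Finset.sum_image fun i _ j _ h => unit_injective h]

/-- `ν` involves only the variables `x¹, …, xᶜ`. -/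
def IsMult (c : ℕ) (ν : Fin n → ℕ) : Prop := ∀ i : Fin n, ν i ≠ 0 → i.val + 1 ≤ c

theorem isMult_single {c : ℕ} {i : Fin n} (h : i.val + 1 ≤ c) :
    IsMult c (Pi.single i 1 : Fin n → ℕ) := fun j hj => by
  by_cases hji : j = i
  · exact hji ▸ h
  · simp [hji] at hj

theorem pos_of_isMult {c : ℕ} {ν : Fin n → ℕ} (h : IsMult c ν) (hν : ν ≠ 0) : 0 < c := by
  obtain ⟨i, hi⟩ := Function.ne_iff.1 hν
  exact lt_of_lt_of_le (Nat.succ_pos _) (h i hi)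

theorem eq_zero_of_sum_eq_zero {ν : Fin n → ℕ} (h : ∑ i, ν i = 0) : ν = 0 :=
  funext fun i => Finset.sum_eq_zero_iff.1 h i (Finset.mem_univ i)

/-- The weight `∑ i νᵢ`, by which multi-indices of the same length are compared. -/
def weight (ν : Fin n → ℕ) : ℕ := ∑ i, i.val * ν i

/-- Among the splittings `l = μ + ν` with `|ν|` fixed, the one with `ν` multiplicative for `μ`
has a `ν` of the smallest weight. -/
theorem weight_lt_or_eq {μ ν μ' ν' : Fin n → ℕ} (h : μ + ν = μ' + ν')
    (hs : ∑ i, ν i = ∑ i, ν' i) (hμ' : μ' ≠ 0) (hν' : IsMult (jetClass μ') ν') :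
    weight ν' < weight ν ∨ ν = ν' := by
  obtain ⟨c, hc, -, hlt⟩ := exists_jetClass_eq hμ'
  have h1 : ∀ i, i < c → ν i ≤ ν' i := fun i hi => by
    have := congrFun h i
    simp only [Pi.add_apply, hlt i hi] at this
    omega
  have h2 : ∀ i, c < i → ν' i = 0 := fun i hi => by
    by_contra h0
    have := hν' i h0
    have : c.val < i.val := hi
    omega
  -- As `|ν| = |ν'|`, the weights may be measured from the class `c`. Below `c` the whole entry of
  -- `μ' + ν'` belongs to `ν'`, above `c` nothing does, so each summand is nonnegative.
  have hterm : ∀ i, (0 : ℤ) ≤ ((i.val : ℤ) - c.val) * ((ν i : ℤ) - ν' i) := fun i => by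
    rcases lt_trichotomy i c with hi | hi | hi
    · have := h1 i hi
      have hi' : i.val < c.val := hi
      exact mul_nonneg_of_nonpos_of_nonpos (by omega) (by omega)
    · simp [hi]
    · have := h2 i hi
      have hi' : c.val < i.val := hi
      exact mul_nonneg (by omega) (by omega)
  have hsum : (weight ν : ℤ) - weight ν' = ∑ i, ((i.val : ℤ) - c.val) * ((ν i : ℤ) - ν' i) := by
    have hs' : ∑ i, (ν i : ℤ) = ∑ i, (ν' i : ℤ) := by exact_mod_cast hs
    have : ∑ i, ((i.val : ℤ) - c.val) * ((ν i : ℤ) - ν' i)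
        = ∑ i, (i.val : ℤ) * ν i - ∑ i, (i.val : ℤ) * ν' i
          - c.val * (∑ i, (ν i : ℤ) - ∑ i, (ν' i : ℤ)) := by
      simp only [Finset.mul_sum, ← Finset.sum_sub_distrib]
      exact Finset.sum_congr rfl fun _ _ => by ring
    rw [this, hs']
    simp [weight]
  rcases (Finset.sum_nonneg fun i _ => hterm i).lt_or_eq with hlt' | heq
  · left
    rw [← hsum] at hlt'
    omega
  · right
    have hz := (Finset.sum_eq_zero_iff_of_nonneg fun i _ => hterm i).1 heq.symm
    have hne : ∀ i, i ≠ c → ν i = ν' i := fun i hi => by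
      rcases mul_eq_zero.1 (hz i (Finset.mem_univ i)) with h0 | h0
      · exact absurd (Fin.ext (by omega)) hi
      · omega
    have hcc : ν c = ν' c := by
      have h3 : ∑ i ∈ Finset.univ.erase c, ν i = ∑ i ∈ Finset.univ.erase c, ν' i :=
        Finset.sum_congr rfl fun i hi => hne i (Finset.ne_of_mem_erase hi)
      rw [← Finset.add_sum_erase _ ν (Finset.mem_univ c),
        ← Finset.add_sum_erase _ ν' (Finset.mem_univ c)] at hs
      omega
    exact funext fun i => if hi : i = c then hi ▸ hcc else hne i hi

end MultiIndices

/-- Off the diagonal, nonzero entries strictly lower `w`, so a kernel vector vanishes by induction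
on `w`; an injective square matrix is onto. -/
theorem exists_of_triangular {P : Type*} [Fintype P] (M : P → P → ℝ) (w : P → ℕ)
    (h1 : ∀ p, M p p = 1) (h2 : ∀ p p', M p p' ≠ 0 → p = p' ∨ w p' < w p) (t : P → ℝ) :
    ∃ c : P → ℝ, ∀ p, ∑ p', M p p' * c p' = t p := by
  classical
  have hinj : Function.Injective (Matrix.mulVecLin (Matrix.of M)) := by
    rw [← LinearMap.ker_eq_bot, LinearMap.ker_eq_bot']
    intro c hc
    have key : ∀ N p, w p = N → c p = 0 := fun N => by
      induction N using Nat.strong_induction_on with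
      | _ N ih =>
        intro p hp
        have h := congrFun hc p
        simp only [Matrix.mulVecLin_apply, Matrix.mulVec, dotProduct, Matrix.of_apply,
          Pi.zero_apply] at h
        rw [Finset.sum_eq_single p] at h
        · simpa [h1] using h
        · intro p' _ hp'
          by_cases h0 : M p p' = 0
          · simp [h0]
          · rcases h2 p p' h0 with h | h
            · exact absurd h.symm hp'
            · rw [ih (w p') (hp ▸ h) p' rfl, mul_zero]
        · simp
    exact funext fun p => key _ p rfl
  obtain ⟨c, hc⟩ := (LinearMap.injective_iff_surjective.1 hinj) t
  exact ⟨c, fun p => congrFun hc p⟩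

/-! ### Equations in solved form: prescribing multiplicative derivatives -/

section SolvedForm

variable {n q : ℕ} {κ ι : Type} {V : Set (Pt n)} {a : LinOp n q κ ι}
  {piv : ι → MIdx n q × κ}

theorem LinOp.SolvedForm.coeff_self (h : a.SolvedForm V piv) {x : Pt n} (hx : x ∈ V) (τ : ι) :
    a x τ (piv τ).1 (piv τ).2 = 1 := by
  simpa using h.1 x hx τ τ

theorem LinOp.SolvedForm.coeff_of_ne (h : a.SolvedForm V piv) {x : Pt n} (hx : x ∈ V) {σ τ : ι}
    (hne : σ ≠ τ) : a x σ (piv τ).1 (piv τ).2 = 0 := by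
  simpa [hne] using h.1 x hx σ τ

theorem LinOp.SolvedForm.piv_injective (h : a.SolvedForm V piv) {x : Pt n} (hx : x ∈ V) :
    Function.Injective piv := fun σ τ hst => by
  by_contra hne
  have h1 := h.coeff_of_ne hx hne
  rw [← hst, h.coeff_self hx] at h1
  exact one_ne_zero h1

theorem len_eq_of_eqClass_pos {τ : ι} (h : 0 < eqClass piv τ) :
    (piv τ).1.len = q ∧ eqClass piv τ = jetClass (piv τ).1.1 := by
  unfold eqClass at h ⊢
  split_ifs with h'
  · exact ⟨h', rfl⟩
  · simp [h'] at h

variable [Fintype κ]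

/-- The values of the order `q` parts of the `ν`-th prolongations, `ν` multiplicative, can be
prescribed. -/
theorem LinOp.SolvedForm.exists_symbol [Fintype ι] (hq : 1 ≤ q) (h : a.SolvedForm V piv)
    {x : Pt n} (hx : x ∈ V) (s : ℕ) (t : ι → (Fin n → ℕ) → ℝ) :
    ∃ y : (Fin n → ℕ) → κ → ℝ, ∀ τ ν, 0 < eqClass piv τ → ∑ i, ν i = s →
      IsMult (eqClass piv τ) ν →
      ∑ μ : MIdx n q, ∑ k, (if μ.len = q then a x τ μ k * y (μ.1 + ν) k else 0) = t τ ν := by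
  classical
  -- `P` indexes the multiplicative prolongations of order `s`, each with its own leading jet `piv τ
  -- + ν`; `M` evaluates the symbol of one prolongation on the leading jet of another.
  let P := {p : ι × MIdx n s // 0 < eqClass piv p.1 ∧ p.2.len = s ∧ IsMult (eqClass piv p.1) p.2.1}
  let e : P → (Fin n → ℕ) → κ → ℝ := fun p l k =>
    if l = (piv p.1.1).1.1 + p.1.2.1 ∧ k = (piv p.1.1).2 then 1 else 0
  let M : P → P → ℝ := fun p p' => ∑ μ : MIdx n q, ∑ k,
    if μ.len = q then a x p.1.1 μ k * e p' (μ.1 + p.1.2.1) k else 0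
  obtain ⟨c, hc⟩ := exists_of_triangular M (fun p => weight p.1.2.1) (fun p => by
      obtain ⟨hl, -⟩ := len_eq_of_eqClass_pos p.2.1
      simp only [M]
      rw [Finset.sum_eq_single (piv p.1.1).1, Finset.sum_eq_single (piv p.1.1).2]
      · simp [hl, e, h.coeff_self hx]
      · intro k _ hk
        simp [e, hk]
      · simp
      · intro μ _ hμ
        refine Finset.sum_eq_zero fun k _ => ?_
        have : μ.1 ≠ (piv p.1.1).1.1 := fun h => hμ (Subtype.ext h)
        simp [e, this]
      · simp) (fun p p' hM => by
      obtain ⟨μ, -, hμ⟩ := Finset.exists_ne_zero_of_sum_ne_zero hM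
      obtain ⟨k, -, hk⟩ := Finset.exists_ne_zero_of_sum_ne_zero hμ
      have hl : μ.len = q := by
        by_contra h0
        simp [h0] at hk
      rw [if_pos hl] at hk
      have he : μ.1 + p.1.2.1 = (piv p'.1.1).1.1 + p'.1.2.1 ∧ k = (piv p'.1.1).2 := by
        by_contra h0
        simp [e, h0] at hk
      obtain ⟨hl', hc'⟩ := len_eq_of_eqClass_pos p'.2.1
      -- A prolongation containing the leading jet of another one has a `ν` of larger weight or the
      -- same `ν`. In the latter case both leading jets come from the same `piv`, and the solved
      -- form leaves only the same equation.
      rcases weight_lt_or_eq he.1 (p.2.2.1.trans p'.2.2.1.symm) (MIdx.ne_zero_of_len hq hl')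
        (hc' ▸ p'.2.2.2) with hw | hν
      · exact Or.inr hw
      · left
        have hμ' : μ = (piv p'.1.1).1 := Subtype.ext (by
          have := he.1
          rw [hν] at this
          exact add_right_cancel this)
        by_cases hτ : p.1.1 = p'.1.1
        · exact Subtype.ext (Prod.ext hτ (Subtype.ext hν))
        · rw [hμ', he.2, h.coeff_of_ne hx hτ, zero_mul] at hk
          exact absurd rfl hk) (fun p => t p.1.1 p.1.2.1)
  refine ⟨fun l k => ∑ p, e p l k * c p, fun τ ν hτ hν hm => ?_⟩
  have h1 := hc ⟨(τ, ⟨ν, mem_multiIdx.2 hν.le⟩), hτ, hν, hm⟩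
  rw [← h1]
  simp only [M, Finset.sum_mul, Finset.mul_sum]
  symm
  rw [Finset.sum_comm]
  refine Finset.sum_congr rfl fun μ _ => ?_
  rw [Finset.sum_comm]
  refine Finset.sum_congr rfl fun k _ => ?_
  split_ifs
  · exact Finset.sum_congr rfl fun p _ => by ring
  · simp

/-- The jet with prescribed values of the leading coordinates and all other coordinates zero. -/
noncomputable def pivJet [Fintype ι] (piv : ι → MIdx n q × κ) (t : ι → ℝ) : Jet n q κ :=
  open Classical in fun μ k => ∑ σ, if piv σ = (μ, k) then t σ else 0

theorem LinOp.SolvedForm.eval_pivJet [Fintype ι] (h : a.SolvedForm V piv) {x : Pt n} (hx : x ∈ V)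
    (t : ι → ℝ) (τ : ι) : a.eval x τ (pivJet piv t) = t τ := by
  classical
  have h1 : ∀ σ, ∑ μ, ∑ k, a x τ μ k * (if piv σ = (μ, k) then t σ else 0)
      = if τ = σ then t σ else 0 := fun σ => by
    rw [Finset.sum_eq_single (piv σ).1, Finset.sum_eq_single (piv σ).2]
    · simp [h.1 x hx τ σ]
    · intro k _ hk
      rw [if_neg (fun h0 => hk (by rw [h0])), mul_zero]
    · simp
    · intro μ _ hμ
      refine Finset.sum_eq_zero fun k _ => ?_
      rw [if_neg (fun h0 => hμ (by rw [h0])), mul_zero]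
    · simp
  simp only [LinOp.eval, pivJet, Finset.mul_sum]
  calc _ = ∑ σ, ∑ μ, ∑ k, a x τ μ k * (if piv σ = (μ, k) then t σ else 0) := by
        exact (Finset.sum_congr rfl fun μ _ => Finset.sum_comm).trans Finset.sum_comm
    _ = t τ := by simp only [h1, Finset.sum_ite_eq, Finset.mem_univ, if_true]

/-- A section with prescribed multiplicative derivatives of its image at a point. -/
theorem LinOp.SolvedForm.exists_section [Fintype ι] (hq : 1 ≤ q) (hV : IsOpen V) (ha : a.Smooth V)
    (h : a.SolvedForm V piv) {x : Pt n} (hx : x ∈ V) (s : ℕ) (t : ι → (Fin n → ℕ) → ℝ) :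
    ∃ f : Pt n → κ → ℝ, ContDiff ℝ ∞ f ∧ ∀ τ ν, ∑ i, ν i ≤ s → IsMult (eqClass piv τ) ν →
      mderiv ν (fun z => a.apply f z τ) x = t τ ν := by
  induction s with
  | zero =>
    refine ⟨jetSection x (pivJet piv fun τ => t τ 0), contDiff_jetSection _ _, fun τ ν hν _ => ?_⟩
    rw [eq_zero_of_sum_eq_zero (Nat.le_zero.1 hν), mderiv_zero, apply_eq_eval, jet_jetSection,
      h.eval_pivJet hx]
  | succ s ih =>
    -- The error in order `s + 1` is corrected by a polynomial `g`, homogeneous of degree `s + 1 +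
    -- q` about `x`: the derivatives of its image of order at most `s` vanish at `x`, and those of
    -- order `s + 1` see only the symbol.
    obtain ⟨f, hf, hft⟩ := ih
    obtain ⟨y, hy⟩ := h.exists_symbol hq hx (s + 1)
      fun τ ν => t τ ν - mderiv ν (fun z => a.apply f z τ) x
    let g : Pt n → κ → ℝ := jetPoly x (s + 1 + q) fun l k => if ∑ i, l i = s + 1 + q then y l k else 0
    have hfk : ∀ k, ContDiffOn ℝ ∞ (fun z => f z k) V := fun k => (contDiff_pi.1 hf k).contDiffOn
    have hgk : ∀ k, ContDiffOn ℝ ∞ (fun z => g z k) V :=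
      fun k => (contDiff_jetPoly_apply _ _ _ _).contDiffOn
    have hg : ∀ l : Fin n → ℕ, ∑ i, l i ≤ s + 1 + q → ∀ k, mderiv l (fun z => g z k) x
        = if ∑ i, l i = s + 1 + q then y l k else 0 := fun l hl k => by
      simp only [g]
      rw [mderiv_jetPoly, if_pos hl]
    refine ⟨fun z k => f z k + g z k, contDiff_pi.2 fun k =>
      (contDiff_pi.1 hf k).add (contDiff_jetPoly_apply _ _ _ _), fun τ ν hν hm => ?_⟩
    rw [mderiv_eqOn hV ν (fun z hz => congrFun (apply_add (a := a) hV hfk hgk hz) τ) hx]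
    simp only [Pi.add_apply]
    rw [mderiv_add hV (contDiffOn_apply hV ha hfk τ) (contDiffOn_apply hV ha hgk τ) ν hx]
    beta_reduce
    rw [mderiv_apply_of_flat (f := g) hV ha hgk τ hx ν fun l hl k => by
      rw [hg l (by omega), if_neg (by omega)]]
    rcases hν.lt_or_eq with hlt | heq
    · rw [hft τ ν (by omega) hm, Finset.sum_eq_zero, add_zero]
      refine fun μ _ => Finset.sum_eq_zero fun k _ => ?_
      have hμ : ∑ i, μ.1 i ≤ q := mem_multiIdx.1 μ.2
      have hsum : ∑ i, (μ.1 + ν) i = ∑ i, μ.1 i + ∑ i, ν i := by simp [Finset.sum_add_distrib]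
      rw [hg (μ.1 + ν) (by omega),
        if_neg (show ¬∑ i, (μ.1 + ν) i = s + 1 + q by omega), mul_zero, ite_self]
    · have hν0 : ν ≠ 0 := fun h0 => by simp [h0] at heq
      have := hy τ ν (pos_of_isMult hm hν0) heq hm
      rw [← eq_sub_iff_add_eq', ← this]
      refine Finset.sum_congr rfl fun μ _ => Finset.sum_congr rfl fun k _ => ?_
      split_ifs with hl
      · have hsum : ∑ i, (μ.1 + ν) i = q + ∑ i, ν i := by
          have : ∑ i, μ.1 i = q := hl
          simp [Finset.sum_add_distrib, this]
        rw [hg (μ.1 + ν) (by omega), if_pos (by omega)]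
      · rfl

end SolvedForm


/-! ### Jets with a single nonzero coordinate -/

section BasisJet

variable {n q : ℕ} {κ ι : Type}

open Classical in
/-- The jet all of whose coordinates vanish except `yᵏ_μ = 1`. -/
noncomputable def basisJet (μ : MIdx n q) (k : κ) : Jet n q κ :=
  fun l k' => if l = μ ∧ k' = k then 1 else 0

theorem len_succ (μ : MIdx n q) (j : Fin n) : (μ.succ j).len = μ.len + 1 := by
  simp [MIdx.len, MIdx.succ, Finset.sum_add_distrib]

theorem succ_injective (j : Fin n) : Function.Injective fun μ : MIdx n q => μ.succ j :=
  fun _ _ h => Subtype.ext (add_right_cancel (congrArg Subtype.val h))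

@[simp]
theorem shift_apply (i : Fin n) (z : Jet n (q + 1) κ) (μ : MIdx n q) :
    shift n q κ i z μ = z (μ.succ i) := rfl

@[simp]
theorem trunc_apply (z : Jet n (q + 1) κ) (μ : MIdx n q) : trunc n q κ z μ = z μ.emb := rfl

theorem shift_basisJet_succ (μ : MIdx n q) (k : κ) (j : Fin n) :
    shift n q κ j (basisJet (μ.succ j) k) = basisJet μ k := by
  funext l k'
  have : l.succ j = μ.succ j ↔ l = μ := (succ_injective j).eq_iff
  classical
  rw [shift_apply, basisJet, basisJet]
  exact if_congr (and_congr_left' this) rfl rfl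

theorem shift_basisJet_eq_zero {μ : MIdx n (q + 1)} {i : Fin n} (h : μ.1 i = 0) (k : κ) :
    shift n q κ i (basisJet μ k) = 0 := by
  funext l k'
  have : l.succ i ≠ μ := fun h' => by
    rw [← h'] at h
    simp [MIdx.succ] at h
  simp [basisJet, this]

theorem succ_apply_of_ne (μ : MIdx n q) {i j : Fin n} (h : i ≠ j) : (μ.succ j).1 i = μ.1 i := by
  simp [MIdx.succ, h]

theorem basisJet_mem_symTop {μ : MIdx n q} (h : μ.len = q) (k : κ) :
    basisJet μ k ∈ symTop n q κ := fun l hl => by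
  funext k'
  have : l ≠ μ := fun h' => by rw [h'] at hl; omega
  simp [basisJet, this]

theorem eval_basisJet [Fintype κ] (a : LinOp n q κ ι) (x : Pt n) (τ : ι) (μ : MIdx n q) (k : κ) :
    a.eval x τ (basisJet μ k) = a x τ μ k := by
  rw [LinOp.eval, Finset.sum_eq_single μ, Finset.sum_eq_single k]
  · simp [basisJet]
  · intro k' _ h
    simp [basisJet, h]
  · simp
  · intro l _ h
    simp [basisJet, h]
  · simp

/-- `a.eval x τ` as a linear map. -/
noncomputable def LinOp.evalLin [Fintype κ] (a : LinOp n q κ ι) (x : Pt n) :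
    Jet n q κ →ₗ[ℝ] (ι → ℝ) where
  toFun y τ := a.eval x τ y
  map_add' y z := by
    funext τ
    simp [LinOp.eval, mul_add, Finset.sum_add_distrib]
  map_smul' c y := by
    funext τ
    simp only [LinOp.eval, Pi.smul_apply, smul_eq_mul, Finset.mul_sum, RingHom.id_apply]
    exact Finset.sum_congr rfl fun _ _ => Finset.sum_congr rfl fun _ _ => by ring

theorem evalD_eq [Fintype κ] (a : LinOp n q κ ι) (x : Pt n) (j : Fin n) (τ : ι)
    (y : Jet n (q + 1) κ) : a.evalD x j τ y = a.eval x τ (shift n q κ j y)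
      + ∑ μ : MIdx n q, ∑ k, pderiv j (fun z => a z τ μ k) x * trunc n q κ y μ k := by
  simp only [LinOp.evalD, LinOp.eval, Finset.sum_add_distrib]
  rfl

theorem emb_val (μ : MIdx n q) : μ.emb.1 = μ.1 := rfl

theorem emb_injective : Function.Injective (MIdx.emb : MIdx n q → MIdx n (q + 1)) := by
  intro μ ν h
  have h1 : μ.emb.1 = ν.emb.1 := by rw [h]
  rw [emb_val, emb_val] at h1
  exact Subtype.ext h1

theorem trunc_basisJet (μ : MIdx n q) (k : κ) :
    trunc n q κ (basisJet μ.emb k) = basisJet μ k := by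
  classical
  funext l k'
  have : l.emb = μ.emb ↔ l = μ := emb_injective.eq_iff
  rw [trunc_apply, basisJet, basisJet]
  exact if_congr (and_congr_left' this) rfl rfl

theorem trunc_of_mem_symTop {z : Jet n (q + 1) κ} (hz : z ∈ symTop n (q + 1) κ) :
    trunc n q κ z = 0 := funext fun μ => hz μ.emb (by
  have : ∑ i, μ.1 i ≤ q := mem_multiIdx.1 μ.2
  have h : μ.emb.len = ∑ i, μ.1 i := rfl
  omega)

/-- If `xʲ` does not occur in `μ`, the jet has no coordinate of the form `l + 1ⱼ`, so only the
derivative of the coefficient remains. For a leading jet in solved form this coefficient is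
constant. -/
theorem evalD_basisJet_emb [Fintype κ] (a : LinOp n q κ ι) (x : Pt n) {j : Fin n} (τ : ι)
    {μ : MIdx n q} (hμ : μ.1 j = 0) (k : κ) :
    a.evalD x j τ (basisJet μ.emb k) = pderiv j (fun z => a z τ μ k) x := by
  have h0 : shift n q κ j (basisJet μ.emb k) = 0 :=
    shift_basisJet_eq_zero (by rw [emb_val, hμ]) k
  rw [evalD_eq, h0, trunc_basisJet]
  have h1 := eval_basisJet (fun z τ μ k => pderiv j (fun z => a z τ μ k) z) x τ μ k
  rw [LinOp.eval] at h1
  rw [h1]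
  simp [LinOp.eval]

theorem evalD_of_mem_symTop [Fintype κ] (a : LinOp n q κ ι) (x : Pt n) (j : Fin n) (τ : ι)
    {z : Jet n (q + 1) κ} (hz : z ∈ symTop n (q + 1) κ) :
    a.evalD x j τ z = a.eval x τ (shift n q κ j z) := by
  rw [evalD_eq, trunc_of_mem_symTop hz]
  simp

end BasisJet

/-! ### Symbols of first order operators and their exactness -/

section Symbols

variable {n q : ℕ} {κ ι ι' : Type} [Fintype κ] [Fintype ι] {V : Set (Pt n)}

/-- The symbol `T* ⊗ F → F'` of a first order operator `F → F'`. -/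
noncomputable def LinOp.symb (b : LinOp n 1 ι ι') (x : Pt n) : (Fin n → ι → ℝ) →ₗ[ℝ] (ι' → ℝ) where
  toFun v ρ := ∑ i, ∑ τ, b x ρ (MIdx.unit i) τ * v i τ
  map_add' v w := by
    funext ρ
    simp [mul_add, Finset.sum_add_distrib]
  map_smul' c v := by
    funext ρ
    simp only [Pi.smul_apply, smul_eq_mul, Finset.mul_sum, RingHom.id_apply]
    exact Finset.sum_congr rfl fun _ _ => Finset.sum_congr rfl fun _ _ => by ring

theorem LinOp.symb_apply (b : LinOp n 1 ι ι') (x : Pt n) (v : Fin n → ι → ℝ) (ρ : ι') :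
    b.symb x v ρ = ∑ i, ∑ τ, b x ρ (MIdx.unit i) τ * v i τ := rfl

/-- The symbol of the first prolongation is defined by the multiplicative prolongations. -/
def SymbolInvolutive (a : LinOp n q κ ι) (piv : ι → MIdx n q × κ) (x : Pt n) : Prop :=
  ∀ z ∈ symTop n (q + 1) κ,
    (∀ τ, ∀ j : Fin n, j.val + 1 ≤ eqClass piv τ → a.eval x τ (shift n q κ j z) = 0) →
    ∀ τ, ∀ j : Fin n, a.eval x τ (shift n q κ j z) = 0

/-- The sequence `S_{q+1}T* ⊗ E → T* ⊗ F → F'` of symbols is exact. -/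
def SymbolExact (a : LinOp n q κ ι) (b : LinOp n 1 ι ι') (x : Pt n) : Prop :=
  ∀ v : Fin n → ι → ℝ, b.symb x v = 0 ↔
    ∃ z ∈ symTop n (q + 1) κ, ∀ i τ, v i τ = a.eval x τ (shift n q κ i z)

/-- The leading jets are the `u^τ_j` with `xʲ` not multiplicative for `Φ^τ`. -/
def LeadsComplete (c : ι → ℕ) (piv' : ι' → MIdx n 1 × ι) : Prop :=
  (∀ ρ, ∃ j τ, piv' ρ = (MIdx.unit j, τ) ∧ c τ < j.val + 1) ∧
    ∀ (j : Fin n) τ, c τ < j.val + 1 → ∃ ρ, piv' ρ = (MIdx.unit j, τ)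

end Symbols


/-! ### Compatibility conditions and involution of the next operator -/

section Compatibility

variable {n q : ℕ} {κ ι ι' : Type} {V : Set (Pt n)}

theorem eqClass_of_eq_unit {piv' : ι' → MIdx n 1 × ι} {ρ : ι'} {j : Fin n} {τ : ι}
    (h : piv' ρ = (MIdx.unit j, τ)) : eqClass piv' ρ = j.val + 1 := by
  rw [eqClass, h, if_pos (len_unit j), unit_val, jetClass_single]

/-- Every nonmultiplicative `u^σ_i` is itself a leading jet, hence absent from all equations but its
own. -/
theorem LeadsComplete.coeff_eq_zero {b : LinOp n 1 ι ι'} {c : ι → ℕ} {piv' : ι' → MIdx n 1 × ι}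
    (hL : LeadsComplete c piv') (hb : b.SolvedForm V piv') {x : Pt n} (hx : x ∈ V) {ρ : ι'}
    {j : Fin n} {τ : ι} (hρ : piv' ρ = (MIdx.unit j, τ)) {i : Fin n} {σ : ι}
    (h : c σ < i.val + 1) (hne : ¬(i = j ∧ σ = τ)) : b x ρ (MIdx.unit i) σ = 0 := by
  obtain ⟨ρ', hρ'⟩ := hL.2 i σ h
  have h1 : ρ ≠ ρ' := fun h1 => by
    subst h1
    rw [hρ, Prod.mk.injEq] at hρ'
    exact hne ⟨(unit_injective hρ'.1).symm, hρ'.2.symm⟩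
  have := hb.coeff_of_ne hx h1
  rwa [hρ'] at this

theorem coeff_eq_zero_of_lt {b : LinOp n 1 ι ι'} {piv' : ι' → MIdx n 1 × ι}
    (hb : b.SolvedForm V piv') {x : Pt n} (hx : x ∈ V) {ρ : ι'}
    {i : Fin n} (h : eqClass piv' ρ < i.val + 1) (σ : ι) : b x ρ (MIdx.unit i) σ = 0 :=
  hb.2 x hx ρ _ σ (len_unit i) (by rwa [unit_val, jetClass_single])

/-- On homogeneous jets of order `q + 1` the derivatives of the coefficients drop out of `dⱼΦ^τ`, so
the condition on prolongations restricts to one on symbols. -/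
theorem LinOp.MultiplicativeProlongation.symbolInvolutive [Fintype κ]
    {a : LinOp n q κ ι} {piv : ι → MIdx n q × κ} (h : a.MultiplicativeProlongation V piv) {x : Pt n} (hx : x ∈ V) :
    SymbolInvolutive a piv x := fun z hz hm τ j => by
  have := h x hx z (fun τ => by rw [trunc_of_mem_symTop hz]; simp [LinOp.eval])
    (fun τ j hj => by rw [evalD_of_mem_symTop a x j τ hz]; exact hm τ j hj) τ j
  rwa [evalD_of_mem_symTop a x j τ hz] at this

variable [Fintype κ] [Fintype ι]

/-- A section whose multiplicative derivatives vanish at a point and which is annihilated by the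
multiplicative prolongations of `b` is flat at this point. -/
theorem LeadsComplete.flat {b : LinOp n 1 ι ι'} {c : ι → ℕ} {piv' : ι' → MIdx n 1 × ι}
    (hL : LeadsComplete c piv') (hV : IsOpen V) (hbs : b.Smooth V) (hb : b.SolvedForm V piv')
    {x : Pt n} (hx : x ∈ V) {v : Pt n → ι → ℝ} (hv : ∀ k, ContDiffOn ℝ ∞ (fun z => v z k) V)
    (s : ℕ) (h0 : ∀ τ ν, ∑ i, ν i ≤ s + 1 → IsMult (c τ) ν → mderiv ν (fun z => v z τ) x = 0)
    (h1 : ∀ ρ ν, ∑ i, ν i ≤ s → IsMult (eqClass piv' ρ) ν →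
      mderiv ν (fun z => b.apply v z ρ) x = 0) (τ : ι) (ν : Fin n → ℕ) (hν : ∑ i, ν i ≤ s + 1) :
    mderiv ν (fun z => v z τ) x = 0 := by
  induction hN : ∑ i, ν i using Nat.strong_induction_on generalizing ν τ with
  | _ N ihN =>
  subst hN
  induction hW : weight ν using Nat.strong_induction_on generalizing ν τ with
  | _ W ihW =>
  subst hW
  by_cases hm : IsMult (c τ) ν
  · exact h0 τ ν hν hm
  obtain ⟨i0, hi0, hci0⟩ : ∃ i, ν i ≠ 0 ∧ c τ < i.val + 1 := by
    simpa [IsMult] using hm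
  have hne : (Finset.univ.filter fun i => ν i ≠ 0).Nonempty := ⟨i0, by simp [hi0]⟩
  -- The largest variable `xʲ` in `ν` is nonmultiplicative for `τ`, so `u^τ_j` leads an equation of
  -- class `j + 1` (counting from `j = 0`), for which all other variables of `ν` are multiplicative.
  obtain ⟨j, hj, hjmax⟩ := Finset.exists_max_image _ id hne
  simp only [Finset.mem_filter, Finset.mem_univ, true_and, id] at hj hjmax
  have hcj : c τ < j.val + 1 := by
    have : i0.val ≤ j.val := hjmax i0 hi0
    omega
  obtain ⟨ρ, hρ⟩ := hL.2 j τ hcj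
  obtain ⟨ν0, rfl⟩ : ∃ ν0 : Fin n → ℕ, ν = ν0 + Pi.single j 1 := by
    refine ⟨ν - Pi.single j 1, funext fun i => ?_⟩
    by_cases hi : i = j
    · subst hi; simp; omega
    · simp [hi]
  have hsum : ∀ i : Fin n, ∑ l, (ν0 + Pi.single i 1 : Fin n → ℕ) l = ∑ l, ν0 l + 1 := fun i => by
    simp [Finset.sum_add_distrib]
  have hwt : ∀ i : Fin n, weight (ν0 + Pi.single i 1) = weight ν0 + i.val := fun i => by
    simp [weight, mul_add, Finset.sum_add_distrib, Pi.single_apply]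
  have hsupp : ∀ i, ν0 i ≠ 0 → i.val ≤ j.val := fun i hi =>
    hjmax i (by simp only [Pi.add_apply]; omega)
  have hbρ := h1 ρ ν0 (by rw [hsum] at hν; omega) fun i hi => by
    rw [eqClass_of_eq_unit hρ]
    have := hsupp i hi
    omega
  -- Lower derivatives of `v` vanish by the outer induction, so only the symbol of the prolonged
  -- equation survives.
  rw [mderiv_apply_of_flat hV hbs hv ρ hx ν0 fun l hl k =>
      ihN _ (by rw [hsum]; omega) k l (by rw [hsum] at hν; omega) rfl,
    sum_midx_one, Finset.sum_eq_zero fun k _ => if_neg (by rw [len_zero]; omega), zero_add] at hbρ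
  simp only [len_unit, if_true, unit_val] at hbρ
  rw [Finset.sum_eq_single j, Finset.sum_eq_single τ] at hbρ
  · have h2 := hb.coeff_self hx ρ
    rw [hρ] at h2
    rw [h2, one_mul] at hbρ
    rw [add_comm]
    exact hbρ
  -- Another unknown with the same `xʲ`: either its jet leads another equation, or `ν` is
  -- multiplicative for it because `j` is the largest variable in `ν`.
  · intro σ _ hσ
    by_cases hc : c σ < j.val + 1
    · rw [hL.coeff_eq_zero hb hx hρ hc fun h => hσ h.2, zero_mul]
    · rw [add_comm, h0 σ _ hν, mul_zero]
      intro i hi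
      have : i.val ≤ j.val := hjmax i hi
      omega
  · simp
  -- A smaller `i` lowers the weight, which is the inner induction; a larger `i` is excluded by the
  -- class of the equation.
  · intro i _ hij
    refine Finset.sum_eq_zero fun σ _ => ?_
    by_cases hi : i.val ≤ j.val
    · have hlt : i.val < j.val := lt_of_le_of_ne hi fun h => hij (Fin.ext h)
      rw [add_comm, ihW (weight (ν0 + Pi.single i 1)) (by rw [hwt, hwt]; omega) σ
        (ν0 + Pi.single i 1) (by rw [hsum] at hν ⊢; omega)
        (fun m hm' τ ν h h' => ihN m (by rw [hsum] at hm' ⊢; omega) τ ν h h') rfl, mul_zero]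
    · rw [coeff_eq_zero_of_lt hb hx (by rw [eqClass_of_eq_unit hρ]; omega), zero_mul]
  · simp

variable {a : LinOp n q κ ι} {b : LinOp n 1 ι ι'} {piv : ι → MIdx n q × κ}
  {piv' : ι' → MIdx n 1 × ι}

/-- Choose `f` whose image has the same multiplicative derivatives at `x` as `u`. Since `b ∘ a = 0`,
the difference `u - a f` satisfies at `x` the same prolonged equations of `b` as `u`, so it is flat
by `LeadsComplete.flat`. -/
theorem generatesCC (hq : 1 ≤ q) (hV : IsOpen V) (has : a.Smooth V) (ha : a.SolvedForm V piv)
    (hbs : b.Smooth V) (hb : b.SolvedForm V piv')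
    (hL : ∀ x ∈ V, LeadsComplete (eqClass piv) piv')
    (hcomp : ∀ f : Pt n → κ → ℝ, ContDiffOn ℝ ∞ f V → ∀ x ∈ V, b.apply (a.apply f) x = 0) :
    GeneratesCC V a b := by
  refine ⟨hcomp, fun x hx s u hu hbu => ?_⟩
  have huk : ∀ k, ContDiffOn ℝ ∞ (fun z => u z k) V := contDiffOn_pi.1 hu
  obtain ⟨f, hf, hft⟩ := ha.exists_section hq hV has hx (s + 1) fun τ ν => mderiv ν (fun z => u z τ) x
  have hak : ∀ k, ContDiffOn ℝ ∞ (fun z => a.apply f z k) V :=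
    fun k => contDiffOn_apply hV has (contDiffOn_pi.1 hf.contDiffOn) k
  have hsub : ∀ τ, ∀ ν : Fin n → ℕ, mderiv ν (fun z => u z τ - a.apply f z τ) x
      = mderiv ν (fun z => u z τ) x - mderiv ν (fun z => a.apply f z τ) x := fun τ ν => by
    have h1 : (fun z => u z τ - a.apply f z τ) = fun z => u z τ + (-1) * a.apply f z τ := by
      funext z; ring
    rw [h1, mderiv_add hV (huk τ) (contDiffOn_const.mul (hak τ)) ν hx]
    beta_reduce
    rw [mderiv_const_mul hV (-1) (hak τ) ν hx]
    ring
  refine ⟨f, hf.contDiffOn, fun ν τ => ?_⟩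
  refine (hL x hx).flat hV hbs hb hx (v := fun z k => u z k - a.apply f z k)
    (fun k => (huk k).sub (hak k)) s (fun τ ν hν hm => ?_) (fun ρ ν hν _ => ?_) τ ν.1
    (mem_multiIdx.1 ν.2)
  · rw [hsub, hft τ ν hν hm, sub_self]
  · have : Set.EqOn (fun z => b.apply (fun z k => u z k - a.apply f z k) z ρ)
        (fun z => b.apply u z ρ) V := fun z hz => by
      have h1 := congrFun (apply_sub (a := b) hV huk hak hz) ρ
      have h2 := congrFun (hcomp f hf.contDiffOn z hz) ρ
      simp only [Pi.sub_apply] at h1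
      simp only [h1]
      have h3 : b.apply (fun z k => a.apply f z k) z ρ = 0 := h2
      change b.apply u z ρ - b.apply (fun z k => a.apply f z k) z ρ = _
      rw [h3, sub_zero]
    rw [mderiv_eqOn hV ν this hx]
    exact hbu ⟨ν, mem_multiIdx.2 hν⟩ ρ

/-- The subtraction used for `generatesCC`, with a polynomial section realising the two-jet `y`.
Flatness uses only the multiplicative prolongations of `b`; once the two-jet of the difference
vanishes, so do all prolongations on `y`. -/
theorem multiplicativeProlongation (hq : 1 ≤ q) (hV : IsOpen V) (has : a.Smooth V)
    (ha : a.SolvedForm V piv) (hbs : b.Smooth V) (hb : b.SolvedForm V piv')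
    (hL : ∀ x ∈ V, LeadsComplete (eqClass piv) piv')
    (hcomp : ∀ f : Pt n → κ → ℝ, ContDiffOn ℝ ∞ f V → ∀ x ∈ V, b.apply (a.apply f) x = 0) :
    b.MultiplicativeProlongation V piv' := by
  intro x hx y hy0 hy1
  set u : Pt n → ι → ℝ := jetSection x y
  have huc : ContDiffOn ℝ ∞ u V := (contDiff_jetSection x y).contDiffOn
  have huk : ∀ k, ContDiffOn ℝ ∞ (fun z => u z k) V := contDiffOn_pi.1 huc
  have hjet : jet 2 u x = y := jet_jetSection x y
  obtain ⟨f, hf, hft⟩ := ha.exists_section hq hV has hx 2 fun τ ν => mderiv ν (fun z => u z τ) x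
  have hak : ∀ k, ContDiffOn ℝ ∞ (fun z => a.apply f z k) V :=
    fun k => contDiffOn_apply hV has (contDiffOn_pi.1 hf.contDiffOn) k
  have hsub : ∀ τ, ∀ ν : Fin n → ℕ, mderiv ν (fun z => u z τ - a.apply f z τ) x
      = mderiv ν (fun z => u z τ) x - mderiv ν (fun z => a.apply f z τ) x := fun τ ν => by
    have h1 : (fun z => u z τ - a.apply f z τ) = fun z => u z τ + (-1) * a.apply f z τ := by
      funext z; ring
    rw [h1, mderiv_add hV (huk τ) (contDiffOn_const.mul (hak τ)) ν hx]
    beta_reduce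
    rw [mderiv_const_mul hV (-1) (hak τ) ν hx]
    ring
  have hbv : ∀ ρ, Set.EqOn (fun z => b.apply (fun z k => u z k - a.apply f z k) z ρ)
      (fun z => b.apply u z ρ) V := fun ρ z hz => by
    have h1 := congrFun (apply_sub (a := b) hV huk hak hz) ρ
    have h3 : b.apply (fun z k => a.apply f z k) z ρ = 0 :=
      congrFun (hcomp f hf.contDiffOn z hz) ρ
    simp only [Pi.sub_apply] at h1
    simp only [h1]
    change b.apply u z ρ - b.apply (fun z k => a.apply f z k) z ρ = _
    rw [h3, sub_zero]
  have hvk : ∀ k, ContDiffOn ℝ ∞ (fun z => u z k - a.apply f z k) V :=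
    fun k => (huk k).sub (hak k)
  have hflat := (hL x hx).flat hV hbs hb hx (v := fun z k => u z k - a.apply f z k) hvk 1
    (fun τ ν hν hm => by rw [hsub, hft τ ν hν hm, sub_self]) (fun ρ ν hν hm => by
      rw [mderiv_eqOn hV ν (hbv ρ) hx]
      rcases eq_zero_or_eq_unit ⟨ν, mem_multiIdx.2 hν⟩ with h | ⟨j, h⟩
      · have : ν = 0 := congrArg Subtype.val h
        rw [this, mderiv_zero]
        have h2 := hy0 ρ
        rwa [← hjet] at h2
      · have hνj : ν = Pi.single j 1 := (congrArg Subtype.val h).trans (unit_val j)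
        have h2 := hy1 ρ j (hm j (by simp [hνj]))
        rw [hνj, mderiv_single hV j (contDiffOn_apply hV hbs huk ρ) hx,
          pderiv_apply hV hbs huk ρ j hx, hjet, h2])
  intro ρ j
  have hj0 : jet 2 (fun z k => u z k - a.apply f z k) x = 0 := by
    funext μ k
    exact hflat k μ.1 (mem_multiIdx.1 μ.2)
  have h2 := pderiv_apply hV hbs hvk ρ j hx
  rw [pderiv_eqOn hV (hbv ρ) j hx, pderiv_apply hV hbs huk ρ j hx, hjet, hj0] at h2
  rw [h2]
  simp [LinOp.evalD]

end Compatibility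


/-! ### Location of the leading jets and reduced Spencer form -/

section LeadingJets

variable {n q : ℕ} {κ ι ι' : Type} {V : Set (Pt n)} {a : LinOp n q κ ι}
  {piv : ι → MIdx n q × κ}

theorem pivot_mem_symTop {τ : ι} (j : Fin n) (h : 0 < eqClass piv τ) :
    basisJet ((piv τ).1.succ j) (piv τ).2 ∈ symTop n (q + 1) κ :=
  basisJet_mem_symTop (by rw [len_succ, (len_eq_of_eqClass_pos h).1]) _

variable [Fintype κ]

/-- Prolonging the leading jet of order `q` of an equation. -/
theorem eval_shift_pivot_self [DecidableEq ι] {x : Pt n} (hx : x ∈ V) (ha : a.SolvedForm V piv) (σ τ : ι) (j : Fin n) :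
    a.eval x σ (shift n q κ j (basisJet ((piv τ).1.succ j) (piv τ).2))
      = if σ = τ then 1 else 0 := by
  rw [shift_basisJet_succ, eval_basisJet, ha.1 x hx]
  split_ifs <;> rfl

/-- With `xʲ` multiplicative, the leading multi-index has no entry below `j`, so `xⁱ` does not occur
after adding `1ⱼ` either. -/
theorem eval_shift_pivot_of_lt (σ : ι) {τ : ι} {i j : Fin n} (x : Pt n)
    (hj : j.val + 1 ≤ eqClass piv τ) (hij : i < j) :
    a.eval x σ (shift n q κ i (basisJet ((piv τ).1.succ j) (piv τ).2)) = 0 := by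
  obtain ⟨hl, hc⟩ := len_eq_of_eqClass_pos (piv := piv) (τ := τ) (by omega)
  have hij' : i.val < j.val := hij
  have h0 : (piv τ).1.1 i = 0 := by
    by_contra h0
    have := jetClass_le h0
    omega
  rw [shift_basisJet_eq_zero (by rw [succ_apply_of_ne _ hij.ne, h0])]
  simp [LinOp.eval]

variable [Fintype ι] {b : LinOp n 1 ι ι'} {piv' : ι' → MIdx n 1 × ι}

/-- Surjectivity of the symbol excludes leading jets of order zero, and exactness excludes
multiplicative ones. Conversely, by involution the symbol of `b` is injective on elements supported
at nonmultiplicative positions. Hence there are at least as many equations as such positions, and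
the injection from equations to leading jets is a bijection. -/
theorem leadsComplete [Fintype ι'] {x : Pt n} (hx : x ∈ V) (ha : a.SolvedForm V piv)
    (hinv : SymbolInvolutive a piv x) (hb : b.SolvedForm V piv') (hex : SymbolExact a b x)
    (hsurj : Function.Surjective (b.symb x)) : LeadsComplete (eqClass piv) piv' := by
  classical
  have h1 : ∀ ρ, ∃ j τ, piv' ρ = (MIdx.unit j, τ) ∧ eqClass piv τ < j.val + 1 := by
    intro ρ
    rcases eq_zero_or_eq_unit (piv' ρ).1 with h | ⟨j, h⟩
    · exfalso
      have hc : eqClass piv' ρ = 0 := by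
        rw [eqClass, h, len_zero, if_neg (by omega)]
      obtain ⟨v, hv⟩ := hsurj fun _ => 1
      have h2 := congrFun hv ρ
      rw [LinOp.symb_apply, Finset.sum_eq_zero] at h2
      · exact zero_ne_one h2
      · refine fun i _ => Finset.sum_eq_zero fun τ _ => ?_
        rw [coeff_eq_zero_of_lt hb hx (by omega), zero_mul]
    · refine ⟨j, (piv' ρ).2, Prod.ext h rfl, ?_⟩
      by_contra! hj
      set τ := (piv' ρ).2 with hτ
      have hρ : piv' ρ = (MIdx.unit j, τ) := Prod.ext h rfl
      -- The image of this jet is `e_τ` in place `j` and zero below `j`, while above `j` the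
      -- equation `ρ` has no coefficients. So the leading coefficient of `ρ` would vanish.
      have h2 := (hex fun i σ => a.eval x σ (shift n q κ i
        (basisJet ((piv τ).1.succ j) (piv τ).2))).2
          ⟨_, pivot_mem_symTop j (by omega), fun _ _ => rfl⟩
      have h3 := congrFun h2 ρ
      rw [LinOp.symb_apply, Finset.sum_eq_single j, Finset.sum_eq_single τ] at h3
      · rw [eval_shift_pivot_self hx ha, if_pos rfl, mul_one] at h3
        have h4 := hb.coeff_self hx ρ
        rw [hρ, h3] at h4
        exact zero_ne_one h4
      · intro σ _ hσ
        rw [eval_shift_pivot_self hx ha, if_neg hσ, mul_zero]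
      · simp
      · intro i _ hij
        refine Finset.sum_eq_zero fun σ _ => ?_
        rcases lt_or_gt_of_ne hij with hlt | hgt
        · rw [eval_shift_pivot_of_lt σ x hj hlt, mul_zero]
        · have : j.val < i.val := hgt
          rw [coeff_eq_zero_of_lt hb hx (by rw [eqClass_of_eq_unit hρ]; omega), zero_mul]
      · simp
  refine ⟨h1, ?_⟩
  let P := {p : Fin n × ι // eqClass piv p.2 < p.1.val + 1}
  let E : (P → ℝ) →ₗ[ℝ] (Fin n → ι → ℝ) :=
    { toFun := fun l i τ => if h : eqClass piv τ < i.val + 1 then l ⟨(i, τ), h⟩ else 0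
      map_add' := fun l l' => by
        funext i τ
        simp only [Pi.add_apply]
        split_ifs <;> simp
      map_smul' := fun c l => by
        funext i τ
        simp only [Pi.smul_apply, RingHom.id_apply]
        split_ifs <;> simp }
  have hE : ∀ l i τ, E l i τ = if h : eqClass piv τ < i.val + 1 then l ⟨(i, τ), h⟩ else 0 :=
    fun _ _ _ => rfl
  have hinj : Function.Injective ((b.symb x).comp E) := by
    rw [← LinearMap.ker_eq_bot, LinearMap.ker_eq_bot']
    intro l hl
    obtain ⟨z, hz, hzE⟩ := (hex (E l)).1 hl
    -- `E l` vanishes at the multiplicative positions, so involution makes the whole image of `z`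
    -- vanish.
    have h0 := hinv z hz fun τ j hj => by
      rw [← hzE, hE, dif_neg (by omega)]
    funext p
    have := hzE p.1.1 p.1.2
    rw [h0, hE, dif_pos p.2] at this
    exact this
  have hcard : Fintype.card P ≤ Fintype.card ι' := by
    simpa using LinearMap.finrank_le_finrank_of_injective hinj
  choose j τ hj hjτ using h1
  let φ : ι' → P := fun ρ => ⟨(j ρ, τ ρ), hjτ ρ⟩
  have hφ : Function.Injective φ := fun ρ ρ' h => by
    have h2 : (j ρ, τ ρ) = (j ρ', τ ρ') := congrArg Subtype.val h
    apply hb.piv_injective hx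
    rw [hj, hj, (Prod.mk.inj h2).1, (Prod.mk.inj h2).2]
  have hbij : Function.Bijective φ := (Fintype.bijective_iff_injective_and_card φ).2
    ⟨hφ, le_antisymm (Fintype.card_le_of_injective φ hφ) hcard⟩
  intro i σ hiσ
  obtain ⟨ρ, hρ⟩ := hbij.2 ⟨(i, σ), hiσ⟩
  have h2 : (j ρ, τ ρ) = (i, σ) := congrArg Subtype.val hρ
  exact ⟨ρ, by rw [hj, (Prod.mk.inj h2).1, (Prod.mk.inj h2).2]⟩

/-- The leading multi-index of an equation of class `n` is a multiple of `1ₙ`. Raised by `1ₙ` once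
more, it is a jet whose image under the symbol is `dxⁿ ⊗ e_l` alone. -/
theorem coeff_last_eq_zero {x : Pt n} (hx : x ∈ V) (ha : a.SolvedForm V piv)
    (hex : SymbolExact a b x) {i : Fin n} (hi : i.val + 1 = n) {l : ι}
    (hl : i.val + 1 ≤ eqClass piv l) (ρ : ι') : b x ρ (MIdx.unit i) l = 0 := by
  classical
  have h3 := congrFun ((hex fun i' σ => a.eval x σ (shift n q κ i'
    (basisJet ((piv l).1.succ i) (piv l).2))).2
      ⟨_, pivot_mem_symTop i (by omega), fun _ _ => rfl⟩) ρ
  rw [LinOp.symb_apply, Finset.sum_eq_single i, Finset.sum_eq_single l] at h3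
  · rwa [eval_shift_pivot_self hx ha, if_pos rfl, mul_one] at h3
  · intro σ _ hσ
    rw [eval_shift_pivot_self hx ha, if_neg hσ, mul_zero]
  · simp
  · intro i' _ hii'
    refine Finset.sum_eq_zero fun σ _ => ?_
    have hlt : i' < i := lt_of_le_of_ne (by have := i'.2; exact Fin.le_def.2 (by omega)) hii'
    rw [eval_shift_pivot_of_lt σ x hl hlt, mul_zero]
  · simp

/-- Apply `b ∘ a = 0` to a section whose `(q+1)`-jet at `x` is the leading jet of `l`. Its image is
`e_l` at `x`, with no derivatives there except along `xⁱ`, because the coefficients at a leading jet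
are constant; `w` is the derivative along `xⁱ`. -/
theorem exists_zero_order_coeff (hV : IsOpen V) (has : a.Smooth V)
    (ha : a.SolvedForm V piv) {x : Pt n} (hx : x ∈ V)
    (hcomp : ∀ f : Pt n → κ → ℝ, ContDiffOn ℝ ∞ f V → ∀ x ∈ V, b.apply (a.apply f) x = 0)
    {i : Fin n} {l : ι} (hμ : ∀ i', i' ≠ i → (piv l).1.1 i' = 0) :
    ∃ w : ι → ℝ, ∀ ρ, b x ρ (MIdx.zero n 1) l + ∑ σ, b x ρ (MIdx.unit i) σ * w σ = 0 := by
  classical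
  set f : Pt n → κ → ℝ := jetSection x (basisJet (piv l).1.emb (piv l).2)
  have hf : ContDiff ℝ ∞ f := contDiff_jetSection _ _
  have hfk : ∀ k, ContDiffOn ℝ ∞ (fun z => f z k) V := contDiffOn_pi.1 hf.contDiffOn
  have hjet : jet (q + 1) f x = basisJet (piv l).1.emb (piv l).2 := jet_jetSection _ _
  have hw : ∀ σ, a.apply f x σ = if σ = l then 1 else 0 := fun σ => by
    rw [apply_eq_eval, ← trunc_jet, hjet, trunc_basisJet, eval_basisJet, ha.1 x hx]
  have hdw : ∀ i', i' ≠ i → ∀ σ, pderiv i' (fun z => a.apply f z σ) x = 0 := by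
    intro i' hi' σ
    have : Set.EqOn (fun z => a z σ (piv l).1 (piv l).2) (fun _ => a x σ (piv l).1 (piv l).2) V :=
      fun z hz => by
        beta_reduce
        rw [ha.1 z hz, ha.1 x hx]
    rw [pderiv_apply hV has hfk σ i' hx, hjet, evalD_basisJet_emb a x σ (hμ i' hi'),
      pderiv_eqOn hV this i' hx]
    simp [pderiv]
  refine ⟨fun σ => pderiv i (fun z => a.apply f z σ) x, fun ρ => ?_⟩
  have h1 : b.apply (a.apply f) x ρ = 0 := congrFun (hcomp f hf.contDiffOn x hx) ρ
  rw [LinOp.apply, sum_midx_one, Finset.sum_eq_single i] at h1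
  · rw [← h1]
    congr 1
    · have : (MIdx.zero n 1).1 = 0 := rfl
      simp [this, hw]
    · refine Finset.sum_congr rfl fun σ _ => ?_
      rw [unit_val, mderiv_single hV i (contDiffOn_apply hV has hfk σ) hx]
  · intro i' _ hi'
    refine Finset.sum_eq_zero fun σ _ => ?_
    rw [unit_val, mderiv_single hV i' (contDiffOn_apply hV has hfk σ) hx, hdw i' hi', mul_zero]
  · simp

/-- The leading multi-index of `l` raised by `1_{i'}` involves only `xⁱ` and `x^{i'}`. Its image
under the symbol has a `dx^{i'}` part, which is `e_l`, and a `dxⁱ` part, which is `w`. -/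
theorem exists_unit_coeff (ha : a.SolvedForm V piv) {x : Pt n} (hx : x ∈ V)
    (hex : SymbolExact a b x) {i i' : Fin n} (hii' : i' ≠ i) {l : ι} (hl : 0 < eqClass piv l)
    (hμ : ∀ i', i' ≠ i → (piv l).1.1 i' = 0) :
    ∃ w : ι → ℝ, ∀ ρ, b x ρ (MIdx.unit i') l + ∑ σ, b x ρ (MIdx.unit i) σ * w σ = 0 := by
  classical
  have hv0 := (hex fun i'' σ => a.eval x σ (shift n q κ i''
    (basisJet ((piv l).1.succ i') (piv l).2))).2 ⟨_, pivot_mem_symTop i' hl, fun _ _ => rfl⟩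
  refine ⟨fun σ => a.eval x σ (shift n q κ i (basisJet ((piv l).1.succ i') (piv l).2)),
    fun ρ => ?_⟩
  have h1 := congrFun hv0 ρ
  rw [LinOp.symb_apply, ← Finset.add_sum_erase _ _ (Finset.mem_univ i'),
    Finset.sum_eq_single i, Finset.sum_eq_single l] at h1
  · rwa [eval_shift_pivot_self hx ha, if_pos rfl, mul_one] at h1
  · intro σ _ hσ
    rw [eval_shift_pivot_self hx ha, if_neg hσ, mul_zero]
  · simp
  · intro i'' hi'' h
    refine Finset.sum_eq_zero fun σ _ => ?_
    rw [shift_basisJet_eq_zero (by rw [succ_apply_of_ne _ (Finset.ne_of_mem_erase hi''), hμ _ h])]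
    simp [LinOp.eval]
  · exact fun h => absurd (Finset.mem_erase.2 ⟨hii'.symm, Finset.mem_univ i⟩) h

/-- The unknowns `y¹, …, y^β` are those numbered by the equations of class below `n` of the
preceding operator. For any other `l`, `exists_zero_order_coeff` and `exists_unit_coeff` express its
coefficients through the coefficients of the `u^σ_n`, so a combination of equations free of the
latter is free of `u^l`. -/
theorem reducedSpencerForm {N : ℕ} {b : LinOp n 1 ι (Fin N)} {piv' : Fin N → MIdx n 1 × ι}
    (hq : 1 ≤ q) (hV : IsOpen V) (has : a.Smooth V) (ha : a.SolvedForm V piv)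
    (hbs : b.Smooth V) (hb : b.SolvedForm V piv')
    (hL : ∀ x ∈ V, LeadsComplete (eqClass piv) piv')
    (hex : ∀ x ∈ V, SymbolExact a b x) (hsurj : ∀ x ∈ V, Function.Surjective (b.symb x))
    (hcomp : ∀ f : Pt n → κ → ℝ, ContDiffOn ℝ ∞ f V → ∀ x ∈ V, b.apply (a.apply f) x = 0) :
    ReducedSpencerForm b V := by
  classical
  refine ⟨fun x hx => ⟨V, hV, hx, le_rfl, N, b, piv', hbs, fun _ _ => rfl, hb,
    multiplicativeProlongation hq hV has ha hbs hb hL hcomp⟩, ?_, ?_⟩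
  · intro x hx c hc k
    obtain ⟨v, hv⟩ := hsurj x hx c
    -- `c` is orthogonal to the range of the symbol, which contains `c` itself.
    have h0 : ∑ ρ, c ρ * c ρ = 0 := by
      calc ∑ ρ, c ρ * c ρ = ∑ ρ, ∑ i, ∑ τ, c ρ * b x ρ (MIdx.unit i) τ * v i τ := by
            refine Finset.sum_congr rfl fun ρ _ => ?_
            conv_lhs => rw [← hv]
            conv_lhs => arg 1; rw [hv]
            simp only [LinOp.symb_apply, Finset.mul_sum, mul_assoc]
        _ = ∑ i, ∑ τ, (∑ ρ, c ρ * b x ρ (MIdx.unit i) τ) * v i τ := by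
            rw [Finset.sum_comm]
            refine Finset.sum_congr rfl fun i _ => ?_
            rw [Finset.sum_comm]
            simp only [Finset.sum_mul]
        _ = 0 := by simp [hc]
    have hc0 : ∀ ρ, c ρ = 0 := fun ρ => mul_self_eq_zero.1
      ((Finset.sum_eq_zero_iff_of_nonneg fun ρ _ => mul_self_nonneg (c ρ)).1 h0 ρ
        (Finset.mem_univ ρ))
    simp [hc0]
  · intro i hi
    have hlast : ∀ i' : Fin n, i' ≠ i → i' < i := fun i' h =>
      lt_of_le_of_ne (by have := i'.2; exact Fin.le_def.2 (by omega)) h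
    refine ⟨{τ | eqClass piv τ < n}, ?_, ?_, ?_⟩
    · intro x hx ρ l hl
      have hl' : ¬eqClass piv l < n := hl
      exact coeff_last_eq_zero hx ha (hex x hx) hi (by omega) ρ
    · intro x hx k hk
      have hk' : eqClass piv k < n := hk
      obtain ⟨ρ, hρ⟩ := (hL x hx).2 i k (by omega)
      refine ⟨Pi.single ρ 1, ?_, fun l hl => ?_⟩
      · have := hb.coeff_self hx ρ
        rw [hρ] at this
        simp [Pi.single_apply, this]
      · simp only [Pi.single_apply, ite_mul, one_mul, zero_mul, Finset.sum_ite_eq',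
          Finset.mem_univ, if_true]
        by_cases hl' : eqClass piv l < i.val + 1
        · exact (hL x hx).coeff_eq_zero hb hx hρ hl' fun h => hl h.2
        · exact coeff_last_eq_zero hx ha (hex x hx) hi (by omega) ρ
    · intro x hx c hc l hl
      have hl' : ¬eqClass piv l < n := hl
      obtain ⟨hlen, hcl⟩ := len_eq_of_eqClass_pos (piv := piv) (τ := l) (by omega)
      have hμ : ∀ i', i' ≠ i → (piv l).1.1 i' = 0 := fun i' h => by
        by_contra h0
        have := jetClass_le h0
        have h4 : i'.val < i.val := hlast i' h
        omega
      have hkill : ∀ (g : Fin N → ℝ) (w : ι → ℝ),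
          (∀ ρ, g ρ + ∑ σ, b x ρ (MIdx.unit i) σ * w σ = 0) → ∑ ρ, c ρ * g ρ = 0 := by
        intro g w hg
        calc _ = -∑ ρ, ∑ σ, c ρ * b x ρ (MIdx.unit i) σ * w σ := by
              rw [← Finset.sum_neg_distrib]
              refine Finset.sum_congr rfl fun ρ _ => ?_
              rw [eq_neg_of_add_eq_zero_left (hg ρ), mul_neg, Finset.mul_sum]
              simp only [mul_assoc]
          _ = -∑ σ, (∑ ρ, c ρ * b x ρ (MIdx.unit i) σ) * w σ := by
              rw [Finset.sum_comm]
              simp only [Finset.sum_mul]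
          _ = 0 := by simp [hc]
      intro μ
      rcases eq_zero_or_eq_unit μ with rfl | ⟨i', rfl⟩
      · obtain ⟨w, hw⟩ := exists_zero_order_coeff hV has ha hx hcomp hμ
        exact hkill _ w hw
      · by_cases hii' : i' = i
        · rw [hii']
          exact hc l
        · obtain ⟨w, hw⟩ := exists_unit_coeff ha hx (hex x hx) hii' (by omega) hμ
          exact hkill _ w hw

end LeadingJets


/-! ### Independence of the symbol condition from the choice of equations -/

section Independence

variable {n q : ℕ} {κ ι ι' : Type} [Fintype κ] [Fintype ι] [Fintype ι'] {V V' : Set (Pt n)}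
  {a : LinOp n q κ ι} {piv : ι → MIdx n q × κ} {a' : LinOp n q κ ι'} {piv' : ι' → MIdx n q × κ}

/-- The symbols of the multiplicative prolongations can be prescribed. -/
theorem LinOp.SolvedForm.exists_mem_symTop (hq : 1 ≤ q) (ha : a.SolvedForm V piv) {x : Pt n}
    (hx : x ∈ V) (t : ι → Fin n → ℝ) :
    ∃ z ∈ symTop n (q + 1) κ, ∀ τ, ∀ j : Fin n, j.val + 1 ≤ eqClass piv τ →
      a.eval x τ (shift n q κ j z) = t τ j := by
  obtain ⟨y, hy⟩ := ha.exists_symbol hq hx 1 fun τ ν => ∑ j, ν j * t τ j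
  refine ⟨fun l k => if l.len = q + 1 then y l.1 k else 0, fun l hl => ?_, fun τ j hj => ?_⟩
  · funext k
    exact if_neg (by omega)
  · have h1 := hy τ (Pi.single j 1) (by omega) (by simp) (isMult_single hj)
    rw [Finset.sum_eq_single j (fun i _ h => by simp [h]) (by simp)] at h1
    simp only [Pi.single_eq_same, Nat.cast_one, one_mul] at h1
    rw [← h1, LinOp.eval]
    refine Finset.sum_congr rfl fun μ _ => Finset.sum_congr rfl fun k _ => ?_
    rw [shift_apply, len_succ]
    split_ifs with h h' h'
    · rfl
    · omega
    · omega
    · simp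

/-- Consider combinations of the leading jets of those equations of `a'` that have class at least `j
+ 1`. Equations of `a` of smaller class do not see them. If the remaining equations of `a` vanish
too, the combination lies in the common kernel, and `a'` reads off that its coefficients are zero.
-/
theorem card_class_le (ha : a.SolvedForm V piv) (ha' : a'.SolvedForm V' piv') {x : Pt n}
    (hx : x ∈ V) (hx' : x ∈ V')
    (hker : ∀ y, (∀ τ, a.eval x τ y = 0) ↔ ∀ τ, a'.eval x τ y = 0) (j : ℕ) :
    Fintype.card {τ // j + 1 ≤ eqClass piv' τ} ≤ Fintype.card {τ // j + 1 ≤ eqClass piv τ} := by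
  classical
  let E : ({τ // j + 1 ≤ eqClass piv' τ} → ℝ) →ₗ[ℝ] (ι' → ℝ) :=
    { toFun := fun t τ => if h : j + 1 ≤ eqClass piv' τ then t ⟨τ, h⟩ else 0
      map_add' := fun t t' => by
        funext τ
        simp only [Pi.add_apply]
        split_ifs <;> simp
      map_smul' := fun c t => by
        funext τ
        simp only [Pi.smul_apply, RingHom.id_apply]
        split_ifs <;> simp }
  have hE : ∀ t τ, E t τ = if h : j + 1 ≤ eqClass piv' τ then t ⟨τ, h⟩ else 0 := fun _ _ => rfl
  let B : (ι' → ℝ) →ₗ[ℝ] Jet n q κ :=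
    { toFun := fun t => ∑ τ, t τ • basisJet (piv' τ).1 (piv' τ).2
      map_add' := fun t t' => by simp [add_smul, Finset.sum_add_distrib]
      map_smul' := fun c t => by simp [mul_smul, Finset.smul_sum] }
  have hB : ∀ t, B t = ∑ τ, t τ • basisJet (piv' τ).1 (piv' τ).2 := fun _ => rfl
  have heval : ∀ {ι : Type} (a : LinOp n q κ ι) (t : ι' → ℝ) (σ : ι), a.eval x σ (B t)
      = ∑ τ, t τ * a x σ (piv' τ).1 (piv' τ).2 := fun a t σ => by
    have h1 : a.eval x σ (B t) = a.evalLin x (B t) σ := rfl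
    rw [h1, hB, map_sum, Finset.sum_apply]
    refine Finset.sum_congr rfl fun τ _ => ?_
    rw [map_smul, Pi.smul_apply, smul_eq_mul, ← eval_basisJet a]
    rfl
  let L := (LinearMap.funLeft ℝ ℝ (Subtype.val : {τ // j + 1 ≤ eqClass piv τ} → ι)).comp
    ((a.evalLin x).comp (B.comp E))
  have hL : ∀ t σ, L t σ = a.eval x σ.1 (B (E t)) := fun _ _ => rfl
  have hinj : Function.Injective L := by
    rw [← LinearMap.ker_eq_bot, LinearMap.ker_eq_bot']
    intro t ht
    have h0 : ∀ σ, a.eval x σ (B (E t)) = 0 := fun σ => by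
      by_cases hσ : j + 1 ≤ eqClass piv σ
      · exact (hL t ⟨σ, hσ⟩).symm.trans (congrFun ht _)
      · rw [heval]
        refine Finset.sum_eq_zero fun τ _ => ?_
        rw [hE]
        split_ifs with h
        · obtain ⟨hl, hc⟩ := len_eq_of_eqClass_pos (piv := piv') (τ := τ) (by omega)
          rw [ha.2 x hx σ _ _ hl (by omega), mul_zero]
        · simp
    have h1 := (hker _).1 h0
    funext τ
    have h2 := h1 τ.1
    rw [heval, Finset.sum_eq_single τ.1 (fun σ _ h => by
      rw [ha'.coeff_of_ne hx' (Ne.symm h), mul_zero]) (by simp), ha'.coeff_self hx', hE,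
      dif_pos τ.2, mul_one] at h2
    exact h2
  simpa using LinearMap.finrank_le_finrank_of_injective hinj

/-- Whether the symbol is involutive does not depend on the equations in solved form chosen to
define the system. -/
theorem SymbolInvolutive.of_same_kernel (hq : 1 ≤ q) (ha : a.SolvedForm V piv)
    (ha' : a'.SolvedForm V' piv') {x : Pt n} (hx : x ∈ V) (hx' : x ∈ V')
    (hker : ∀ y, (∀ τ, a.eval x τ y = 0) ↔ ∀ τ, a'.eval x τ y = 0)
    (h : SymbolInvolutive a' piv' x) : SymbolInvolutive a piv x := by
  classical
  let mult : ∀ {ι : Type} (a : LinOp n q κ ι) (c : ι → ℕ),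
      symTop n (q + 1) κ →ₗ[ℝ] ((Σ j : Fin n, {τ // j.val + 1 ≤ c τ}) → ℝ) := fun a c =>
    LinearMap.pi fun p => (LinearMap.proj p.2.1).comp ((a.evalLin x).comp
      ((shift n q κ p.1).toLinearMap.comp (symTop n (q + 1) κ).subtype))
  have hmult : ∀ {ι : Type} (a : LinOp n q κ ι) (c : ι → ℕ) z p,
    mult a c z p = a.eval x p.2.1 (shift n q κ p.1 z.1) := fun _ _ _ _ => rfl
  have hsurj : Function.Surjective (mult a (eqClass piv)) := fun t => by
    obtain ⟨z, hz, hzt⟩ := ha.exists_mem_symTop hq hx fun τ j =>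
      if h : j.val + 1 ≤ eqClass piv τ then t ⟨j, τ, h⟩ else 0
    refine ⟨⟨z, hz⟩, funext fun p => ?_⟩
    rw [hmult, hzt p.2.1 p.1 p.2.2, dif_pos p.2.2]
  have hall : ∀ z : symTop n (q + 1) κ, mult a' (eqClass piv') z = 0 →
      ∀ τ j, a.eval x τ (shift n q κ j z.1) = 0 := fun z hz τ j =>
    (hker _).2 (fun σ => h z.1 z.2 (fun τ j hj => congrFun hz ⟨j, τ, hj⟩) σ j) τ
  -- Involution of `a'` puts the kernel of its multiplicative part inside that of `a`. As the
  -- multiplicative part of `a` is onto and has at least as many components, the two kernels have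
  -- equal dimension.
  have hle : LinearMap.ker (mult a' (eqClass piv')) ≤ LinearMap.ker (mult a (eqClass piv)) :=
    fun z hz => funext fun p => hall z hz _ _
  have hcard : Fintype.card (Σ j : Fin n, {τ // j.val + 1 ≤ eqClass piv' τ})
      ≤ Fintype.card (Σ j : Fin n, {τ // j.val + 1 ≤ eqClass piv τ}) := by
    rw [Fintype.card_sigma, Fintype.card_sigma]
    exact Finset.sum_le_sum fun j _ => card_class_le ha ha' hx hx' hker j.val
  have hdim : Module.finrank ℝ (LinearMap.ker (mult a (eqClass piv)))
      ≤ Module.finrank ℝ (LinearMap.ker (mult a' (eqClass piv'))) := by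
    have h1 := LinearMap.finrank_range_add_finrank_ker (mult a (eqClass piv))
    have h2 := LinearMap.finrank_range_add_finrank_ker (mult a' (eqClass piv'))
    have h3 := (LinearMap.range (mult a' (eqClass piv'))).finrank_le
    rw [LinearMap.range_eq_top.2 hsurj, finrank_top, Module.finrank_fintype_fun_eq_card] at h1
    rw [Module.finrank_fintype_fun_eq_card] at h3
    omega
  have heq := Submodule.eq_of_le_of_finrank_le hle hdim
  intro z hz hm
  have hz' : (⟨z, hz⟩ : symTop n (q + 1) κ) ∈ LinearMap.ker (mult a (eqClass piv)) :=
    funext fun p => hm _ _ p.2.2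
  rw [← heq] at hz'
  exact fun τ j => hall _ hz' τ j

end Independence


/-! ### Exterior multiplication, contraction and the Koszul complex -/

open ContinuousAlternatingMap (alternatizeUncurryFinCLM alternatizeUncurryFin curryLeftLI
  alternatizeUncurryFin_apply alternatizeUncurryFin_add alternatizeUncurryFin_curryLeft
  alternatizeUncurryFin_alternatizeUncurryFinCLM_comp_of_symmetric)

section Exterior

/-- Double alternation kills the symmetric map `p ⊗ p' + p' ⊗ p`; this is the algebraic fact behind
`d² = 0`. -/
theorem alternatizeUncurryFin_smulRight_add {E F : Type*} [NormedAddCommGroup E] [NormedSpace ℝ E]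
    [NormedAddCommGroup F] [NormedSpace ℝ F] {r : ℕ} (p p' : E →L[ℝ] ℝ) (θ : E [⋀^Fin r]→L[ℝ] F) :
    alternatizeUncurryFin (p.smulRight (alternatizeUncurryFin (p'.smulRight θ)))
      + alternatizeUncurryFin (p'.smulRight (alternatizeUncurryFin (p.smulRight θ))) = 0 := by
  let f : E →L[ℝ] E →L[ℝ] (E [⋀^Fin r]→L[ℝ] F) :=
    p.smulRight (p'.smulRight θ) + p'.smulRight (p.smulRight θ)
  have hf : ∀ x y, f x y = f y x := fun x y => by
    simp only [f, _root_.add_apply, ContinuousLinearMap.smulRight_apply,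
      _root_.smul_apply, smul_smul]
    rw [mul_comm, add_comm, mul_comm]
  rw [← alternatizeUncurryFin_add,
    ← alternatizeUncurryFin_alternatizeUncurryFinCLM_comp_of_symmetric hf]
  congr 1
  ext x : 1
  simp only [f, _root_.add_apply, ContinuousLinearMap.smulRight_apply,
    ContinuousLinearMap.comp_apply, map_add, map_smul]
  rfl

variable {n r : ℕ} {F G : Type*} [NormedAddCommGroup F] [NormedSpace ℝ F]
  [NormedAddCommGroup G] [NormedSpace ℝ G]

/-- Exterior multiplication `dxʲ ∧ ·` of forms. -/
noncomputable def wd (j : Fin n) :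
    ((Pt n) [⋀^Fin r]→L[ℝ] F) →L[ℝ] ((Pt n) [⋀^Fin (r + 1)]→L[ℝ] F) :=
  (alternatizeUncurryFinCLM ℝ (Pt n) F).comp
    (ContinuousLinearMap.smulRightL ℝ (Pt n) ((Pt n) [⋀^Fin r]→L[ℝ] F)
      (ContinuousLinearMap.proj j))

/-- Contraction of forms with `∂ⱼ`. -/
noncomputable def ct (j : Fin n) :
    ((Pt n) [⋀^Fin (r + 1)]→L[ℝ] F) →L[ℝ] ((Pt n) [⋀^Fin r]→L[ℝ] F) :=
  (ContinuousLinearMap.apply ℝ _ (Pi.single j 1 : Pt n)).comp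
    (curryLeftLI (𝕜 := ℝ) (E := Pt n) (F := F)).toContinuousLinearMap

theorem wd_eq (j : Fin n) (θ : (Pt n) [⋀^Fin r]→L[ℝ] F) :
    wd j θ = alternatizeUncurryFin
      ((ContinuousLinearMap.proj j : Pt n →L[ℝ] ℝ).smulRight θ) := rfl

theorem ct_apply (j : Fin n) (θ : (Pt n) [⋀^Fin (r + 1)]→L[ℝ] F) (v : Fin r → Pt n) :
    ct j θ v = θ (Matrix.vecCons (Pi.single j 1) v) := rfl

theorem wd_apply (j : Fin n) (θ : (Pt n) [⋀^Fin r]→L[ℝ] F) (v : Fin (r + 1) → Pt n) :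
    wd j θ v = ∑ p, (-1) ^ p.val • (v p j • θ (p.removeNth v)) := by
  rw [wd_eq, alternatizeUncurryFin_apply]
  rfl

theorem wd_compContinuousAlternatingMap (g : F →L[ℝ] G) (j : Fin n)
    (θ : (Pt n) [⋀^Fin r]→L[ℝ] F) :
    g.compContinuousAlternatingMap (wd j θ) = wd j (g.compContinuousAlternatingMap θ) := by
  ext v
  simp [wd_apply]

theorem wd_wd (i j : Fin n) (θ : (Pt n) [⋀^Fin r]→L[ℝ] F) :
    wd i (wd j θ) + wd j (wd i θ) = 0 :=
  alternatizeUncurryFin_smulRight_add _ _ θ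

/-- In the alternating sum the first term pairs `∂ᵢ` with `dxʲ`; the remaining terms are shifted by
one place, whence the sign. -/
theorem ct_wd (i j : Fin n) (θ : (Pt n) [⋀^Fin (r + 1)]→L[ℝ] F) :
    ct i (wd j θ) = (if i = j then θ else 0) - wd j (ct i θ) := by
  ext v : 1
  rw [ct_apply, wd_apply, Fin.sum_univ_succ, ContinuousAlternatingMap.sub_apply, wd_apply, sub_eq_add_neg,
    ← Finset.sum_neg_distrib]
  congr 1
  · have : Fin.removeNth 0 (Matrix.vecCons (Pi.single i (1 : ℝ)) v) = v := rfl
    rw [this]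
    by_cases h : i = j
    · simp [h]
    · simp [h, Ne.symm h]
  · refine Finset.sum_congr rfl fun p _ => ?_
    have : Fin.removeNth p.succ (Matrix.vecCons (Pi.single i (1 : ℝ)) v)
        = Matrix.vecCons (Pi.single i (1 : ℝ)) (p.removeNth v) :=
      funext (Fin.cases rfl fun _ => by simp [Fin.removeNth])
    rw [this, ct_apply]
    simp [pow_succ]

theorem ct_wd_zero (i j : Fin n) (θ : (Pt n) [⋀^Fin 0]→L[ℝ] F) :
    ct i (wd j θ) = if i = j then θ else 0 := by
  ext v : 1
  rw [ct_apply, wd_apply, Fin.sum_univ_succ]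
  have : Fin.removeNth 0 (Matrix.vecCons (Pi.single i (1 : ℝ)) v) = v := rfl
  rw [this]
  by_cases h : i = j
  · simp [h]
  · simp [h, Ne.symm h]

theorem clm_eq_sum_smulRight (f : Pt n →L[ℝ] F) :
    f = ∑ j, (ContinuousLinearMap.proj j : Pt n →L[ℝ] ℝ).smulRight (f (Pi.single j 1)) := by
  ext x
  conv_lhs => rw [pi_eq_sum_univ' x]
  simp [_root_.sum_apply]

theorem alternatizeUncurryFin_eq_sum_wd (f : Pt n →L[ℝ] ((Pt n) [⋀^Fin r]→L[ℝ] F)) :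
    alternatizeUncurryFin f = ∑ j, wd j (f (Pi.single j 1)) := by
  conv_lhs => rw [clm_eq_sum_smulRight f]
  exact map_sum (alternatizeUncurryFinCLM ℝ (Pt n) F) _ _

/-- Alternating the curried form reproduces `θ` once per argument. This makes the rescaled
contractions canonical coefficients of `θ`, see `eq_sum_wd`. -/
theorem sum_wd_ct (θ : (Pt n) [⋀^Fin (r + 1)]→L[ℝ] F) :
    ∑ j, wd j (ct j θ) = (r + 1 : ℝ) • θ := by
  have h := alternatizeUncurryFin_eq_sum_wd θ.curryLeft
  rw [alternatizeUncurryFin_curryLeft] at h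
  rw [show ∑ j, wd j (ct j θ) = ∑ j, wd j (θ.curryLeft (Pi.single j 1)) from rfl, ← h]
  module

theorem eq_sum_wd (θ : (Pt n) [⋀^Fin (r + 1)]→L[ℝ] F) :
    θ = ∑ j, wd j ((r + 1 : ℝ)⁻¹ • ct j θ) := by
  have h : (r + 1 : ℝ) ≠ 0 := by positivity
  simp only [map_smul, ← Finset.smul_sum, sum_wd_ct]
  rw [smul_smul, inv_mul_cancel₀ h, one_smul]

/-- Interchanging `i` and `j` changes the sign of the sum. -/
theorem sum_wd_wd_of_symm {s : Fin n → Fin n → ((Pt n) [⋀^Fin r]→L[ℝ] F)}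
    (hs : ∀ i j, s i j = s j i) : ∑ i, ∑ j, wd i (wd j (s i j)) = 0 := by
  have h : ∑ i, ∑ j, wd i (wd j (s i j)) = -∑ i, ∑ j, wd i (wd j (s i j)) := by
    conv_lhs => rw [Finset.sum_comm]
    simp only [← Finset.sum_neg_distrib]
    refine Finset.sum_congr rfl fun i _ => Finset.sum_congr rfl fun j _ => ?_
    rw [hs j i]
    exact eq_neg_of_add_eq_zero_left (wd_wd j i _)
  have h2 : (2 : ℝ) • ∑ i, ∑ j, wd i (wd j (s i j)) = 0 := by
    rw [two_smul]
    exact add_eq_zero_iff_eq_neg.2 h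
  exact (smul_eq_zero.1 h2).resolve_left two_ne_zero

theorem eq_zero_of_sum_wd_eq_zero {w : Fin n → ((Pt n) [⋀^Fin 0]→L[ℝ] F)}
    (h : ∑ j, wd j (w j) = 0) (i : Fin n) : w i = 0 := by
  have h1 := congrArg (ct i) h
  simpa [map_sum, ct_wd_zero] using h1

/-- Exactness of the Koszul complex. -/
theorem exists_symm_of_sum_wd_eq_zero {w : Fin n → ((Pt n) [⋀^Fin (r + 1)]→L[ℝ] F)}
    (h : ∑ j, wd j (w j) = 0) : ∃ s : Fin n → Fin n → ((Pt n) [⋀^Fin r]→L[ℝ] F),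
      (∀ i j, s i j = s j i) ∧ ∀ j, w j = ∑ i, wd i (s i j) := by
  have hr : (r + 1 + 1 : ℝ) ≠ 0 := by positivity
  -- The contracting homotopy. Contracting the relation with `∂ⱼ` gives `w j = ∑ dxⁱ ∧ ct j (w i)`,
  -- and `sum_wd_ct` contributes another `(r + 1) • w j`; the total `r + 2` is divided out.
  refine ⟨fun i j => (r + 1 + 1 : ℝ)⁻¹ • (ct i (w j) + ct j (w i)), fun i j => by
    beta_reduce; rw [add_comm (ct i (w j))], fun j => ?_⟩
  have h1 : w j = ∑ i, wd i (ct j (w i)) := by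
    have h2 := congrArg (ct j) h
    simp only [map_sum, ct_wd, Finset.sum_sub_distrib, Finset.sum_ite_eq, Finset.mem_univ, if_true,
      map_zero] at h2
    exact sub_eq_zero.1 h2
  simp only [map_smul, map_add, ← Finset.smul_sum, Finset.sum_add_distrib, sum_wd_ct, ← h1]
  rw [show (r + 1 : ℝ) • w j + w j = (r + 1 + 1 : ℝ) • w j by module, smul_smul,
    inv_mul_cancel₀ hr, one_smul]

theorem extDeriv_eq_sum_wd (η : Pt n → ((Pt n) [⋀^Fin r]→L[ℝ] F)) (x : Pt n) :
    extDeriv η x = ∑ j, wd j (fderiv ℝ η x (Pi.single j 1)) :=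
  alternatizeUncurryFin_eq_sum_wd _

end Exterior

/-! ### The Spencer operator -/

section Spencer

variable {n q m r : ℕ}

/-- The map `⋀ʳT* ⊗ J_{q+1}(E) → ⋀ʳT* ⊗ J_q(E)` with `θᵏ_μ ↦ θᵏ_{μ+1ᵢ}`. -/
noncomputable def shiftForm (i : Fin n) : FormJet n (q + 1) m r →L[ℝ] FormJet n q m r :=
  ContinuousLinearMap.compContinuousAlternatingMapCLM ℝ (Pt n) _ _ (Fin r) (shift n q (Fin m) i)

theorem shiftForm_apply (i : Fin n) (θ : FormJet n (q + 1) m r) (v : Fin r → Pt n) :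
    shiftForm i θ v = shift n q (Fin m) i (θ v) := rfl

theorem shiftForm_wd (i j : Fin n) (θ : FormJet n (q + 1) m r) :
    shiftForm i (wd j θ) = wd j (shiftForm i θ) :=
  wd_compContinuousAlternatingMap _ _ _

theorem truncForm_wd (j : Fin n) (θ : FormJet n (q + 1) m r) :
    truncForm n q m (r + 1) (wd j θ) = wd j (truncForm n q m r θ) :=
  wd_compContinuousAlternatingMap _ _ _

theorem delta_eq (θ : FormJet n (q + 1) m r) :
    delta n q m r θ = ∑ i, wd i (shiftForm i θ) := by
  unfold delta
  rw [ContinuousLinearMap.comp_apply, _root_.sum_apply, map_sum]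
  rfl

theorem delta_wd (j : Fin n) (θ : FormJet n (q + 1) m r) :
    delta n q m (r + 1) (wd j θ) = -wd j (delta n q m r θ) := by
  rw [delta_eq, delta_eq, map_sum, ← Finset.sum_neg_distrib]
  refine Finset.sum_congr rfl fun i _ => ?_
  rw [shiftForm_wd]
  exact eq_neg_of_add_eq_zero_left (wd_wd i j _)

theorem truncForm_shiftForm (i : Fin n) (θ : FormJet n (q + 2) m r) :
    truncForm n q m r (shiftForm i θ) = shiftForm i (truncForm n (q + 1) m r θ) := rfl

theorem shiftForm_shiftForm (i j : Fin n) (θ : FormJet n (q + 2) m r) :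
    shiftForm (q := q) i (shiftForm j θ) = shiftForm j (shiftForm i θ) := by
  ext v μ k
  simp only [shiftForm_apply, shift_apply]
  have : (μ.succ i).succ j = (μ.succ j).succ i := Subtype.ext (add_right_comm _ _ _)
  rw [this]

variable {V : Set (Pt n)}

theorem differentiableAt_clm_comp {F G : Type*} [NormedAddCommGroup F] [NormedSpace ℝ F]
    [NormedAddCommGroup G] [NormedSpace ℝ G] (L : F →L[ℝ] G) {f : Pt n → F} {x : Pt n}
    (hf : DifferentiableAt ℝ f x) : DifferentiableAt ℝ (fun z => L (f z)) x :=
  L.differentiableAt.comp x hf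

theorem contDiffOn_clm_comp {F G : Type*} [NormedAddCommGroup F] [NormedSpace ℝ F]
    [NormedAddCommGroup G] [NormedSpace ℝ G] (L : F →L[ℝ] G) {f : Pt n → F}
    (hf : ContDiffOn ℝ ∞ f V) : ContDiffOn ℝ ∞ (fun z => L (f z)) V :=
  L.contDiff.comp_contDiffOn hf

theorem fderiv_clm_comp {F G : Type*} [NormedAddCommGroup F] [NormedSpace ℝ F]
    [NormedAddCommGroup G] [NormedSpace ℝ G] (L : F →L[ℝ] G) {f : Pt n → F} {x : Pt n}
    (hf : DifferentiableAt ℝ f x) (v : Pt n) :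
    fderiv ℝ (fun z => L (f z)) x v = L (fderiv ℝ f x v) := by
  have h := (L.hasFDerivAt.comp x hf.hasFDerivAt).fderiv
  have h2 : fderiv ℝ (fun z => L (f z)) x = L.comp (fderiv ℝ f x) := h
  rw [h2]
  rfl

theorem spencerD_eq {θ : Pt n → FormJet n (q + 1) m r} {x : Pt n} (hθ : DifferentiableAt ℝ θ x) :
    spencerD r θ x = ∑ i, wd i (truncForm n q m r (fderiv ℝ θ x (Pi.single i 1))
      - shiftForm i (θ x)) := by
  rw [spencerD, extDeriv_eq_sum_wd, delta_eq, ← Finset.sum_sub_distrib]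
  refine Finset.sum_congr rfl fun i _ => ?_
  rw [fderiv_clm_comp _ hθ, map_sub]

theorem contDiffOn_fderiv_apply {F : Type*} [NormedAddCommGroup F] [NormedSpace ℝ F]
    (hV : IsOpen V) {f : Pt n → F} (hf : ContDiffOn ℝ ∞ f V) (v : Pt n) :
    ContDiffOn ℝ ∞ (fun z => fderiv ℝ f z v) V :=
  (hf.fderiv_of_isOpen (m := ∞) hV (by simp)).clm_apply contDiffOn_const

theorem contDiffOn_spencerD (hV : IsOpen V) {θ : Pt n → FormJet n (q + 1) m r}
    (hθ : ContDiffOn ℝ ∞ θ V) : ContDiffOn ℝ ∞ (spencerD r θ) V := by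
  have : ContDiffOn ℝ ∞ (fun x => ∑ i, wd i (truncForm n q m r (fderiv ℝ θ x (Pi.single i 1))
      - shiftForm i (θ x))) V := by
    have h1 : ∀ i, ContDiffOn ℝ ∞ (fun x => truncForm n q m r (fderiv ℝ θ x (Pi.single i 1))) V :=
      fun i => contDiffOn_clm_comp (truncForm n q m r) (contDiffOn_fderiv_apply hV hθ _)
    have h2 : ∀ i : Fin n, ContDiffOn ℝ ∞ (fun x => shiftForm i (θ x)) V :=
      fun i => contDiffOn_clm_comp (shiftForm i) hθ
    exact ContDiffOn.sum fun i _ => contDiffOn_clm_comp (wd i) ((h1 i).sub (h2 i))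
  exact this.congr fun x hx => spencerD_eq (differentiableAt_of_contDiffOn hV hθ hx)

theorem fderiv_fderiv_comm {F : Type*} [NormedAddCommGroup F] [NormedSpace ℝ F]
    (hV : IsOpen V) {f : Pt n → F} (hf : ContDiffOn ℝ ∞ f V) {x : Pt n} (hx : x ∈ V) (v w : Pt n) :
    fderiv ℝ (fun z => fderiv ℝ f z v) x w = fderiv ℝ (fun z => fderiv ℝ f z w) x v := by
  have hd : DifferentiableAt ℝ (fderiv ℝ f) x :=
    differentiableAt_of_contDiffOn hV (hf.fderiv_of_isOpen (m := ∞) hV (by simp)) hx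
  have hs : IsSymmSndFDerivAt ℝ f x :=
    (hf.contDiffAt (hV.mem_nhds hx)).isSymmSndFDerivAt (by
      simp only [minSmoothness_of_isRCLikeNormedField]
      exact WithTop.coe_le_coe.2 le_top)
  have h : ∀ v w : Pt n, fderiv ℝ (fun z => fderiv ℝ f z v) x w
      = fderiv ℝ (fderiv ℝ f) x w v := fun v w => by
    rw [fderiv_clm_apply hd (differentiableAt_const _)]
    simp
  rw [h, h, hs.eq]

theorem fderiv_spencerD (hV : IsOpen V) {θ : Pt n → FormJet n (q + 1) m r}
    (hθ : ContDiffOn ℝ ∞ θ V) {x : Pt n} (hx : x ∈ V) (v : Pt n) :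
    fderiv ℝ (spencerD r θ) x v = ∑ j, wd j
      (truncForm n q m r (fderiv ℝ (fun z => fderiv ℝ θ z (Pi.single j 1)) x v)
        - shiftForm j (fderiv ℝ θ x v)) := by
  have hd : ∀ z ∈ V, DifferentiableAt ℝ θ z := fun z hz => differentiableAt_of_contDiffOn hV hθ hz
  have hdd : ∀ v, DifferentiableAt ℝ (fun z => fderiv ℝ θ z v) x := fun v =>
    differentiableAt_of_contDiffOn hV (contDiffOn_fderiv_apply hV hθ v) hx
  have hev : spencerD r θ =ᶠ[nhds x] fun z => ∑ j, wd j
      (truncForm n q m r (fderiv ℝ θ z (Pi.single j 1)) - shiftForm j (θ z)) :=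
    Filter.eventuallyEq_of_mem (hV.mem_nhds hx) fun z hz => spencerD_eq (hd z hz)
  have ht := fun j : Fin n => differentiableAt_clm_comp (truncForm n q m r) (hdd (Pi.single j 1))
  have hs := fun j : Fin n => differentiableAt_clm_comp (shiftForm j) (hd x hx)
  rw [hev.fderiv_eq, fderiv_fun_sum fun j _ =>
    differentiableAt_clm_comp (wd j) ((ht j).fun_sub (hs j)), _root_.sum_apply]
  refine Finset.sum_congr rfl fun j _ => ?_
  rw [fderiv_clm_comp (wd j) ((ht j).fun_sub (hs j)), fderiv_fun_sub (ht j) (hs j),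
    _root_.sub_apply, fderiv_clm_comp _ (hdd _), fderiv_clm_comp _ (hd x hx)]

/-- The Spencer operator squares to zero. -/
theorem spencerD_spencerD (hV : IsOpen V) {θ : Pt n → FormJet n (q + 2) m r}
    (hθ : ContDiffOn ℝ ∞ θ V) {x : Pt n} (hx : x ∈ V) :
    spencerD (q := q) (r + 1) (spencerD (q := q + 1) r θ) x = 0 := by
  rw [spencerD_eq (differentiableAt_of_contDiffOn hV (contDiffOn_spencerD hV hθ) hx)]
  -- `D D θ` is `∑ dxⁱ ∧ dxʲ ∧ sᵢⱼ`, where `s` is symmetric: second derivatives commute, shifts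
  -- commute, and the two mixed terms are exchanged.
  rw [← sum_wd_wd_of_symm (s := fun i j =>
    truncForm n q m r (truncForm n (q + 1) m r
      (fderiv ℝ (fun z => fderiv ℝ θ z (Pi.single j 1)) x (Pi.single i 1)))
    - truncForm n q m r (shiftForm j (fderiv ℝ θ x (Pi.single i 1)))
    - (shiftForm i (truncForm n (q + 1) m r (fderiv ℝ θ x (Pi.single j 1)))
    - shiftForm i (shiftForm j (θ x)))) fun i j => by
      beta_reduce
      rw [fderiv_fderiv_comm hV hθ hx (Pi.single j 1), shiftForm_shiftForm i j,
        truncForm_shiftForm, truncForm_shiftForm]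
      abel]
  refine Finset.sum_congr rfl fun i _ => ?_
  rw [fderiv_spencerD hV hθ hx, spencerD_eq (differentiableAt_of_contDiffOn hV hθ hx), map_sum,
    map_sum, ← Finset.sum_sub_distrib, map_sum]
  refine Finset.sum_congr rfl fun j _ => ?_
  rw [truncForm_wd, shiftForm_wd]
  simp only [map_sub]

theorem spencerD_wd {θ : Pt n → FormJet n (q + 1) m r} {x : Pt n} (hθ : DifferentiableAt ℝ θ x)
    (j : Fin n) : spencerD (r + 1) (fun z => wd j (θ z)) x = -wd j (spencerD r θ x) := by
  rw [spencerD_eq (differentiableAt_clm_comp (wd j) hθ), spencerD_eq hθ, map_sum,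
    ← Finset.sum_neg_distrib]
  refine Finset.sum_congr rfl fun i _ => ?_
  rw [fderiv_clm_comp _ hθ, truncForm_wd, shiftForm_wd, ← map_sub]
  exact eq_neg_of_add_eq_zero_left (wd_wd i j _)

theorem spencerD_sum {ι : Type*} [Fintype ι] {θ : ι → Pt n → FormJet n (q + 1) m r} {x : Pt n}
    (hθ : ∀ τ, DifferentiableAt ℝ (θ τ) x) :
    spencerD r (fun z => ∑ τ, θ τ z) x = ∑ τ, spencerD r (θ τ) x := by
  rw [spencerD_eq (DifferentiableAt.fun_sum fun τ _ => hθ τ)]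
  simp only [spencerD_eq (hθ _)]
  rw [Finset.sum_comm]
  refine Finset.sum_congr rfl fun i _ => ?_
  rw [fderiv_fun_sum fun τ _ => hθ τ]
  simp [map_sum, Finset.sum_sub_distrib]

theorem spencerD_add {θ θ' : Pt n → FormJet n (q + 1) m r} {x : Pt n}
    (hθ : DifferentiableAt ℝ θ x) (hθ' : DifferentiableAt ℝ θ' x) :
    spencerD r (fun z => θ z + θ' z) x = spencerD r θ x + spencerD r θ' x := by
  have := spencerD_sum (θ := fun b : Bool => cond b θ θ') (x := x) (by
    rintro (_ | _) <;> assumption)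
  simpa using this

theorem spencerD_smul_const {u : Pt n → ℝ} {x : Pt n} (hu : DifferentiableAt ℝ u x)
    (θ : FormJet n (q + 1) m r) : spencerD r (fun z => u z • θ) x
      = ∑ i, pderiv i u x • wd i (truncForm n q m r θ) - u x • delta n q m r θ := by
  rw [spencerD_eq (hu.smul_const θ), delta_eq, Finset.smul_sum, ← Finset.sum_sub_distrib]
  refine Finset.sum_congr rfl fun i _ => ?_
  rw [(hu.hasFDerivAt.smul_const θ).fderiv]
  simp [pderiv]

/-- The inclusion `J_q(E) → J_{q+1}(E)` putting the coordinates of order `q + 1` to zero. -/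
noncomputable def extJet (n q m : ℕ) : Jet n q (Fin m) →L[ℝ] Jet n (q + 1) (Fin m) :=
  ContinuousLinearMap.pi fun μ =>
    if h : μ.1 ∈ multiIdx n q then ContinuousLinearMap.proj ⟨μ.1, h⟩ else 0

/-- The inclusion `⋀ʳT* ⊗ J_q(E) → ⋀ʳT* ⊗ J_{q+1}(E)`. -/
noncomputable def extForm (n q m r : ℕ) : FormJet n q m r →L[ℝ] FormJet n (q + 1) m r :=
  ContinuousLinearMap.compContinuousAlternatingMapCLM ℝ (Pt n) _ _ (Fin r) (extJet n q m)

theorem trunc_extJet (y : Jet n q (Fin m)) : trunc n q (Fin m) (extJet n q m y) = y := by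
  funext μ
  have h : μ.emb.1 ∈ multiIdx n q := μ.2
  rw [trunc_apply, extJet, ContinuousLinearMap.coe_pi']
  beta_reduce
  rw [dif_pos h]
  rfl

theorem truncForm_extForm (θ : FormJet n q m r) :
    truncForm n q m r (extForm n q m r θ) = θ := by
  ext v : 1
  exact trunc_extJet _

end Spencer


/-! ### First order operators split into order zero part and symbol -/

section OrderOne

variable {n : ℕ} {ι ι' : Type} [Fintype ι] {V : Set (Pt n)}

theorem eval_order_one (b : LinOp n 1 ι ι') (x : Pt n) (ρ : ι') (y : Jet n 1 ι) :
    b.eval x ρ y = ∑ τ, b x ρ (MIdx.zero n 1) τ * y (MIdx.zero n 1) τ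
      + b.symb x (fun i => y (MIdx.unit i)) ρ := by
  rw [LinOp.eval, sum_midx_one]
  rfl

theorem apply_order_one (hV : IsOpen V) (b : LinOp n 1 ι ι') {u : Pt n → ι → ℝ}
    (hu : ∀ τ, ContDiffOn ℝ ∞ (fun z => u z τ) V) {x : Pt n} (hx : x ∈ V) (ρ : ι') :
    b.apply u x ρ = ∑ τ, b x ρ (MIdx.zero n 1) τ * u x τ
      + b.symb x (fun i τ => pderiv i (fun z => u z τ) x) ρ := by
  have h1 : ∀ i, jet 1 u x (MIdx.unit i) = fun τ => pderiv i (fun z => u z τ) x := fun i => by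
    funext τ
    rw [jet, unit_val, mderiv_single hV i (hu τ) hx]
  have h0 : jet 1 u x (MIdx.zero n 1) = u x := by
    funext τ
    exact congrFun (mderiv_zero _) x
  rw [apply_eq_eval, eval_order_one, h0]
  simp only [h1]

theorem pderiv_coord_sub (x : Pt n) (i j : Fin n) :
    pderiv i (fun z => z j - x j) x = if i = j then 1 else 0 := by
  have : fderiv ℝ (fun z : Pt n => z j - x j) x = ContinuousLinearMap.proj j := by
    rw [fderiv_sub_const]
    exact (ContinuousLinearMap.proj (R := ℝ) (φ := fun _ : Fin n => ℝ) j).fderiv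
  rw [pderiv, this]
  simp [Pi.single_apply, eq_comm]

end OrderOne

/-! ### Operators induced by the Spencer operator -/

section Induced

variable {n q m r : ℕ} {V : Set (Pt n)} {R : Pt n → Submodule ℝ (Jet n q (Fin m))} {ι ι' ι'' : Type}
  [Fintype ι]

/-- Smooth fibre coordinates of the Janet bundle `F_r` over `V`. -/
structure IsJanetCoord (V : Set (Pt n)) (R : Pt n → Submodule ℝ (Jet n q (Fin m)))
    (c : Pt n → FormJet n q m r →L[ℝ] (ι → ℝ)) : Prop where
  smooth : ContDiffOn ℝ ∞ c V
  surjective : ∀ x ∈ V, Function.Surjective (c x)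
  ker : ∀ x ∈ V, (c x).toLinearMap.ker = janetDenom R x r

/-- The operator `b` is induced by the Spencer operator. -/
def Induced (V : Set (Pt n)) (c : Pt n → FormJet n q m r →L[ℝ] (ι → ℝ))
    (c' : Pt n → FormJet n q m (r + 1) →L[ℝ] (ι' → ℝ)) (b : LinOp n 1 ι ι') : Prop :=
  ∀ θ : Pt n → FormJet n (q + 1) m r, ContDiffOn ℝ ∞ θ V → ∀ x ∈ V,
    b.apply (fun z => c z (truncForm n q m r (θ z))) x = c' x (spencerD r θ x)

variable {c : Pt n → FormJet n q m r →L[ℝ] (ι → ℝ)}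
  {c' : Pt n → FormJet n q m (r + 1) →L[ℝ] (ι' → ℝ)}
  {c'' : Pt n → FormJet n q m (r + 2) →L[ℝ] (ι'' → ℝ)}
  {b : LinOp n 1 ι ι'} {b' : LinOp n 1 ι' ι''}

theorem contDiffOn_coord (hc : ContDiffOn ℝ ∞ c V) {θ : Pt n → FormJet n q m r}
    (hθ : ContDiffOn ℝ ∞ θ V) (τ : ι) : ContDiffOn ℝ ∞ (fun z => c z (θ z) τ) V :=
  contDiffOn_pi.1 (hc.clm_apply hθ) τ

theorem contDiffOn_sum_smul {F : Type*} [NormedAddCommGroup F] [NormedSpace ℝ F]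
    {u : Pt n → ι → ℝ} (hu : ∀ τ, ContDiffOn ℝ ∞ (fun z => u z τ) V) (f : ι → F) :
    ContDiffOn ℝ ∞ (fun z => ∑ τ, u z τ • f τ) V :=
  ContDiffOn.sum fun τ _ => (hu τ).smul contDiffOn_const

/-- Test on `∑ (zʲ - xʲ) wⱼ`, extended by zero in order `q + 1`: it vanishes at `x`, so the `δ`-part
of the Spencer operator and the order zero part of `b` contribute nothing there. -/
theorem Induced.symb_eq (h : Induced V c c' b) (hV : IsOpen V) (hc : ContDiffOn ℝ ∞ c V)
    {x : Pt n} (hx : x ∈ V) (w : Fin n → FormJet n q m r) :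
    b.symb x (fun j => c x (w j)) = c' x (∑ j, wd j (w j)) := by
  have hu : ∀ j : Fin n, ContDiffOn ℝ ∞ (fun z : Pt n => z j - x j) V := fun j => by fun_prop
  have hd : ∀ j : Fin n, DifferentiableAt ℝ (fun z : Pt n => z j - x j) x := fun j => by fun_prop
  have h1 := h _ (contDiffOn_sum_smul (u := fun z j => z j - x j) hu
    fun j => extForm n q m r (w j)) x hx
  have h2 : (fun z => c z (truncForm n q m r (∑ j, (z j - x j) • extForm n q m r (w j))))
      = fun z τ => ∑ j, (z j - x j) * c z (w j) τ := by
    funext z τ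
    simp only [map_sum, map_smul, truncForm_extForm, Finset.sum_apply, Pi.smul_apply, smul_eq_mul]
  have hcw : ∀ j τ, ContDiffOn ℝ ∞ (fun z => c z (w j) τ) V := fun j τ =>
    contDiffOn_coord hc contDiffOn_const τ
  rw [h2, spencerD_sum fun j => (hd j).smul_const _] at h1
  funext ρ
  have h3 := congrFun h1 ρ
  rw [apply_order_one hV b (fun τ => ContDiffOn.sum fun j _ => (hu j).mul (hcw j τ)) hx] at h3
  have h4 : (fun i τ => pderiv i (fun z => ∑ j, (z j - x j) * c z (w j) τ) x)
      = fun i => c x (w i) := by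
    funext i τ
    rw [pderiv_sum hV _ fun j _ => (hu j).mul (hcw j τ)]
    · simp [pderiv_mul hV (hu _) (hcw _ τ) i hx, pderiv_coord_sub]
    · exact hx
  rw [h4] at h3
  simp only [spencerD_smul_const (hd _), pderiv_coord_sub, truncForm_extForm, sub_self,
    zero_mul, Finset.sum_const_zero, mul_zero, zero_add, zero_smul, sub_zero, ite_smul, one_smul,
    Finset.sum_ite_eq', Finset.mem_univ, if_true] at h3
  exact h3

/-- Every form of positive degree is a sum of terms `dxʲ ∧ ·`, by `eq_sum_wd`. -/
theorem Induced.symb_surjective (h : Induced V c c' b) (hV : IsOpen V) (hc : ContDiffOn ℝ ∞ c V)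
    {x : Pt n} (hx : x ∈ V) (hs : Function.Surjective (c' x)) :
    Function.Surjective (b.symb x) := fun v => by
  obtain ⟨θ, hθ⟩ := hs v
  refine ⟨fun j => c x ((r + 1 : ℝ)⁻¹ • ct j θ), ?_⟩
  rw [h.symb_eq hV hc hx fun j => (r + 1 : ℝ)⁻¹ • ct j θ, ← eq_sum_wd, hθ]

variable [Fintype ι']

theorem truncForm_spencerD (hV : IsOpen V) {θ : Pt n → FormJet n (q + 2) m r}
    (hθ : ContDiffOn ℝ ∞ θ V) {x : Pt n} (hx : x ∈ V) :
    truncForm n q m (r + 1) (spencerD r θ x)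
      = spencerD r (fun z => truncForm n (q + 1) m r (θ z)) x := by
  have hd := differentiableAt_of_contDiffOn hV hθ hx
  rw [spencerD_eq hd, spencerD_eq (differentiableAt_clm_comp _ hd), map_sum]
  refine Finset.sum_congr rfl fun i _ => ?_
  rw [fderiv_clm_comp _ hd, truncForm_wd, map_sub, truncForm_shiftForm]

/-- The composite of two consecutive operators vanishes. -/
theorem Induced.apply_spencer (h : Induced V c c' b) (h' : Induced V c' c'' b') (hV : IsOpen V)
    {θ : Pt n → FormJet n (q + 2) m r} (hθ : ContDiffOn ℝ ∞ θ V) {x : Pt n} (hx : x ∈ V) :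
    b'.apply (b.apply fun z => c z (truncForm n q m r (truncForm n (q + 1) m r (θ z)))) x = 0 := by
  have h1 : Set.EqOn
      (b.apply fun z => c z (truncForm n q m r (truncForm n (q + 1) m r (θ z))))
      (fun z => c' z (truncForm n q m (r + 1) (spencerD r θ z))) V := fun z hz => by
    beta_reduce
    rw [truncForm_spencerD hV hθ hz, h _ (contDiffOn_clm_comp (truncForm n (q + 1) m r) hθ) z hz]
  rw [apply_eqOn hV h1 hx, h' _ (contDiffOn_spencerD hV hθ) x hx, spencerD_spencerD hV hθ hx,
    map_zero]

/-- Constant forms `L τ` dual to the fibre coordinates. -/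
def ConstLift (V : Set (Pt n)) {N : ℕ} (c : Pt n → FormJet n q m r →L[ℝ] (Fin N → ℝ))
    (L : Fin N → FormJet n q m r) : Prop :=
  ∀ x ∈ V, ∀ τ, c x (L τ) = Pi.single τ 1

theorem ConstLift.coord_sum {N : ℕ} {c : Pt n → FormJet n q m r →L[ℝ] (Fin N → ℝ)}
    {L : Fin N → FormJet n q m r} (hL : ConstLift V c L) {x : Pt n} (hx : x ∈ V)
    (u : Fin N → ℝ) : c x (∑ τ, u τ • L τ) = u := by
  simp only [map_sum, map_smul, hL x hx]
  funext τ
  simp [Finset.sum_apply, Pi.single_apply]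

/-- A section `u` lifts smoothly to `∑ u^τ L_τ`; extended twice by zero to jets of order `q + 2`, it
becomes an argument to which `D ∘ D = 0` applies. -/
theorem Induced.composite {N : ℕ} {c : Pt n → FormJet n q m r →L[ℝ] (Fin N → ℝ)}
    {b : LinOp n 1 (Fin N) ι'} (h : Induced V c c' b) (h' : Induced V c' c'' b') (hV : IsOpen V)
    {L : Fin N → FormJet n q m r} (hL : ConstLift V c L)
    (u : Pt n → Fin N → ℝ) (hu : ContDiffOn ℝ ∞ u V) (x : Pt n) (hx : x ∈ V) :
    b'.apply (b.apply u) x = 0 := by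
  have h1 := h.apply_spencer h' hV (contDiffOn_sum_smul (contDiffOn_pi.1 hu) fun τ =>
    extForm n (q + 1) m r (extForm n q m r (L τ))) hx
  rw [← h1]
  refine apply_eqOn hV (apply_eqOn hV fun z hz => ?_) hx
  simp only [map_sum, map_smul, truncForm_extForm]
  have h2 := hL.coord_sum hz (u z)
  simp only [map_sum, map_smul] at h2
  exact h2.symm

end Induced


/-! ### Degree zero: the operator `𝒟` and holonomic sections -/

section ZeroForms

variable {n q m : ℕ} {V : Set (Pt n)} {R : Pt n → Submodule ℝ (Jet n q (Fin m))} {ι ι' : Type}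

/-- Jets as forms of degree zero. -/
noncomputable def cst (y : Jet n q (Fin m)) : FormJet n q m 0 :=
  ContinuousAlternatingMap.constOfIsEmpty ℝ (Pt n) (Fin 0) y

/-- Jets as forms of degree zero, as a linear map. -/
noncomputable def cstL : Jet n q (Fin m) →L[ℝ] FormJet n q m 0 :=
  (ContinuousAlternatingMap.constOfIsEmptyLIE ℝ (Pt n) (Jet n q (Fin m))
    (Fin 0)).toContinuousLinearEquiv.toContinuousLinearMap

theorem cstL_apply (y : Jet n q (Fin m)) : cstL y = cst y := rfl

theorem cst_apply (y : Jet n q (Fin m)) (v : Fin 0 → Pt n) : cst y v = y := rfl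

theorem eq_cst (θ : FormJet n q m 0) : θ = cst (θ ![]) := by
  ext v : 1
  rw [cst_apply, Subsingleton.elim v ![]]

theorem truncForm_cst (y : Jet n (q + 1) (Fin m)) :
    truncForm n q m 0 (cst y) = cst (trunc n q (Fin m) y) := rfl

theorem shiftForm_cst (i : Fin n) (y : Jet n (q + 1) (Fin m)) :
    shiftForm i (cst y) = cst (shift n q (Fin m) i y) := rfl

/-- The operator of order `q` with values in `F_0 = J_q(E)/R_q`. -/
noncomputable def projOp (c : Pt n → FormJet n q m 0 →L[ℝ] (ι → ℝ)) : LinOp n q (Fin m) ι :=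
  fun x τ μ k => c x (cst (Pi.single μ (Pi.single k 1))) τ

variable {c : Pt n → FormJet n q m 0 →L[ℝ] (ι → ℝ)}
  {c' : Pt n → FormJet n q m 1 →L[ℝ] (ι' → ℝ)} {b : LinOp n 1 ι ι'}

theorem projOp_eval (c : Pt n → FormJet n q m 0 →L[ℝ] (ι → ℝ)) (x : Pt n) (τ : ι)
    (y : Jet n q (Fin m)) : (projOp c).eval x τ y = c x (cst y) τ := by
  have hy : y = ∑ μ, ∑ k, y μ k • (Pi.single μ (Pi.single k 1) : Jet n q (Fin m)) := by
    funext μ k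
    simp only [Finset.sum_apply, Pi.smul_apply, smul_eq_mul]
    rw [Finset.sum_eq_single μ, Finset.sum_eq_single k]
    · simp
    · intro k' _ h
      simp [h]
    · simp
    · intro l _ h
      simp [h]
    · simp
  conv_rhs => rw [hy]
  simp only [← cstL_apply, map_sum, map_smul, Finset.sum_apply, Pi.smul_apply, smul_eq_mul]
  exact Finset.sum_congr rfl fun μ _ => Finset.sum_congr rfl fun k _ => mul_comm _ _

theorem projOp_smooth [Fintype ι] (hc : ContDiffOn ℝ ∞ c V) : (projOp c).Smooth V := fun τ _ _ =>
  contDiffOn_coord hc contDiffOn_const τ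

theorem mem_janetDenom_zero {x : Pt n} {y : Jet n q (Fin m)} :
    cst y ∈ janetDenom R x 0 ↔ y ∈ R x :=
  ⟨fun h => h ![], fun h _ => h⟩

theorem IsJanetCoord.coord_eq_zero [Fintype ι] {r : ℕ}
    {c : Pt n → FormJet n q m r →L[ℝ] (ι → ℝ)} (hc : IsJanetCoord V R c) {x : Pt n} (hx : x ∈ V)
    {θ : FormJet n q m r} : c x θ = 0 ↔ θ ∈ janetDenom R x r := by
  rw [← hc.ker x hx]
  rfl

theorem IsJanetCoord.projOp_eval_eq_zero [Fintype ι] (hc : IsJanetCoord V R c) {x : Pt n}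
    (hx : x ∈ V) (y : Jet n q (Fin m)) : (∀ τ, (projOp c).eval x τ y = 0) ↔ y ∈ R x := by
  rw [← mem_janetDenom_zero, ← hc.coord_eq_zero hx, funext_iff]
  simp only [projOp_eval, Pi.zero_apply]

theorem contDiffOn_jet (hV : IsOpen V) {f : Pt n → Fin m → ℝ} (hf : ContDiffOn ℝ ∞ f V) :
    ContDiffOn ℝ ∞ (jet q f) V :=
  contDiffOn_pi.2 fun μ => contDiffOn_pi.2 fun k =>
    contDiffOn_mderiv hV μ.1 (contDiffOn_pi.1 hf k)

theorem trunc_fderiv_jet (hV : IsOpen V) {f : Pt n → Fin m → ℝ} (hf : ContDiffOn ℝ ∞ f V)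
    {x : Pt n} (hx : x ∈ V) (i : Fin n) :
    trunc n q (Fin m) (fderiv ℝ (jet (q + 1) f) x (Pi.single i 1))
      = shift n q (Fin m) i (jet (q + 1) f x) := by
  have hd := differentiableAt_of_contDiffOn hV (contDiffOn_jet (q := q + 1) hV hf) hx
  funext μ k
  have h := fderiv_clm_comp ((ContinuousLinearMap.proj (R := ℝ) (φ := fun _ : Fin m => ℝ) k).comp
    (ContinuousLinearMap.proj (R := ℝ) (φ := fun _ : MIdx n (q + 1) => Fin m → ℝ) μ.emb)) hd
    (Pi.single i 1)
  exact h.symm.trans (pderiv_mderiv hV μ.1 i (contDiffOn_pi.1 hf k) hx)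

theorem contDiffOn_cst_jet (hV : IsOpen V) {f : Pt n → Fin m → ℝ} (hf : ContDiffOn ℝ ∞ f V) :
    ContDiffOn ℝ ∞ (fun z => (cst (jet q f z) : FormJet n q m 0)) V :=
  contDiffOn_clm_comp cstL (contDiffOn_jet hV hf)

/-- The Spencer operator measures the failure to be holonomic: on the jet of a section,
differentiating a coordinate and raising its multi-index agree. -/
theorem spencerD_jet (hV : IsOpen V) {f : Pt n → Fin m → ℝ} (hf : ContDiffOn ℝ ∞ f V)
    {x : Pt n} (hx : x ∈ V) :
    spencerD 0 (fun z => (cst (jet (q + 1) f z) : FormJet n (q + 1) m 0)) x = 0 := by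
  rw [spencerD_eq (differentiableAt_of_contDiffOn hV (contDiffOn_cst_jet hV hf) hx)]
  refine Finset.sum_eq_zero fun i _ => ?_
  have h : fderiv ℝ (fun z => (cst (jet (q + 1) f z) : FormJet n (q + 1) m 0)) x (Pi.single i 1)
      = cst (fderiv ℝ (jet (q + 1) f) x (Pi.single i 1)) :=
    fderiv_clm_comp cstL (differentiableAt_of_contDiffOn hV (contDiffOn_jet hV hf) hx) _
  rw [h, truncForm_cst, trunc_fderiv_jet hV hf hx, shiftForm_cst, sub_self, map_zero]

theorem Induced.composite_projOp [Fintype ι] (h : Induced V c c' b) (hV : IsOpen V)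
    (f : Pt n → Fin m → ℝ) (hf : ContDiffOn ℝ ∞ f V) (x : Pt n) (hx : x ∈ V) :
    b.apply ((projOp c).apply f) x = 0 := by
  have h1 := h _ (contDiffOn_cst_jet (q := q + 1) hV hf) x hx
  rw [spencerD_jet hV hf hx, map_zero] at h1
  rw [← h1]
  congr 1
  funext z τ
  rw [apply_eq_eval, projOp_eval, truncForm_cst, trunc_jet]

end ZeroForms

/-! ### Homogeneous jets of order two as symmetric families -/

section OrderTwo

variable {n : ℕ} {ι ι' : Type}

theorem unit_succ_comm (i j : Fin n) : (MIdx.unit i).succ j = (MIdx.unit j).succ i :=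
  Subtype.ext (by simp only [MIdx.succ, unit_val, add_comm])

/-- The value of a first order operator on the shift of a homogeneous jet of order two. -/
theorem eval_shift_of_mem_symTop [Fintype ι] (b : LinOp n 1 ι ι') (x : Pt n) {z : Jet n 2 ι}
    (hz : z ∈ symTop n 2 ι) (j : Fin n) (ρ : ι') :
    b.eval x ρ (shift n 1 ι j z) = b.symb x (fun i => z ((MIdx.unit i).succ j)) ρ := by
  have h0 : shift n 1 ι j z (MIdx.zero n 1) = 0 := hz _ (by rw [len_succ, len_zero]; norm_num)
  rw [eval_order_one, h0]
  simp

/-- The multi-index `1ᵢ + 1ⱼ` determines the unordered pair, so by symmetry of `s` any chosen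
decomposition gives the same value. -/
theorem exists_mem_symTop_two {s : Fin n → Fin n → ι → ℝ} (hs : ∀ i j, s i j = s j i) :
    ∃ z ∈ symTop n 2 ι, ∀ i j, z ((MIdx.unit i).succ j) = s i j := by
  classical
  let z : Jet n 2 ι := fun μ => if h : ∃ p : Fin n × Fin n, (MIdx.unit p.1).succ p.2 = μ then
    s h.choose.1 h.choose.2 else 0
  refine ⟨z, fun μ hμ => ?_, fun i j => ?_⟩
  · refine dif_neg ?_
    rintro ⟨p, rfl⟩
    rw [len_succ, len_unit] at hμ
    omega
  · have h : ∃ p : Fin n × Fin n, (MIdx.unit p.1).succ p.2 = (MIdx.unit i).succ j := ⟨(i, j), rfl⟩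
    have h1 : z ((MIdx.unit i).succ j) = s h.choose.1 h.choose.2 := dif_pos h
    rw [h1]
    have h2 := h.choose_spec
    generalize h.choose = p at h2
    obtain ⟨k, l⟩ := p
    have h3 : (Pi.single k 1 : Fin n → ℕ) + Pi.single l 1 = Pi.single i 1 + Pi.single j 1 := by
      have := congrArg Subtype.val h2
      simpa [MIdx.succ, unit_val] using this
    by_cases hk : k = i
    · subst hk
      have : l = j := by
        have h4 := congrFun (add_left_cancel h3) l
        by_contra hlj
        simp [hlj] at h4
      rw [this]
    · have h4 := congrFun h3 k
      have h5 := congrFun h3 i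
      have hkj : k = j := by
        by_contra hkj
        simp [hk, hkj] at h4
      subst hkj
      have : l = i := by
        have h6 := congrFun (add_left_cancel (h3.trans (add_comm _ _))) l
        by_contra hli
        simp [hli] at h6
      rw [this, hs]

end OrderTwo

/-! ### Exactness of the symbol sequences -/

section Exactness

variable {n q m r : ℕ} {V : Set (Pt n)} {R : Pt n → Submodule ℝ (Jet n q (Fin m))} {ι ι' ι'' : Type}
  [Fintype ι] [Fintype ι'] [Fintype ι'']

theorem ct_mem_valuedIn {P : Submodule ℝ (Jet n q (Fin m))} {θ : FormJet n q m (r + 1)}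
    (h : θ ∈ valuedIn (r + 1) P) (t : ℝ) (j : Fin n) : t • ct j θ ∈ valuedIn r P :=
  Submodule.smul_mem _ _ fun _ => h _

theorem mem_janetDenom_of_valuedIn {x : Pt n} {θ : FormJet n q m r} (h : θ ∈ valuedIn r (R x)) :
    θ ∈ janetDenom R x r := by
  cases r with
  | zero => exact h
  | succ r => exact Submodule.mem_sup_left h

theorem delta_mem_janetDenom {x : Pt n} {ζ : FormJet n (q + 1) m r}
    (h : ζ ∈ valuedIn r (symTop n (q + 1) (Fin m))) :
    delta n q m r ζ ∈ janetDenom R x (r + 1) :=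
  Submodule.mem_sup_right ⟨ζ, h, rfl⟩

theorem exists_of_mem_janetDenom {x : Pt n} {θ : FormJet n q m (r + 1)}
    (h : θ ∈ janetDenom R x (r + 1)) : ∃ φ ∈ valuedIn (r + 1) (R x),
      ∃ ζ ∈ valuedIn r (symTop n (q + 1) (Fin m)), θ = φ + delta n q m r ζ := by
  obtain ⟨φ, hφ, _, ⟨ζ, hζ, rfl⟩, rfl⟩ := Submodule.mem_sup.1 h
  exact ⟨φ, hφ, ζ, hζ, rfl⟩

theorem wd_mem_valuedIn {P : Submodule ℝ (Jet n q (Fin m))} (j : Fin n) {θ : FormJet n q m r}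
    (h : θ ∈ valuedIn r P) : wd j θ ∈ valuedIn (r + 1) P := fun v => by
  rw [wd_apply]
  exact P.sum_mem fun p _ => zsmul_mem (P.smul_mem _ (h _)) _

theorem wd_mem_janetDenom {x : Pt n} (j : Fin n) {θ : FormJet n q m r}
    (h : θ ∈ janetDenom R x r) : wd j θ ∈ janetDenom R x (r + 1) := by
  cases r with
  | zero => exact mem_janetDenom_of_valuedIn (wd_mem_valuedIn j h)
  | succ r =>
    obtain ⟨φ, hφ, ζ, hζ, rfl⟩ := exists_of_mem_janetDenom h
    have h1 : wd j (delta n q m r ζ) = -delta n q m (r + 1) (wd j ζ) := by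
      rw [delta_wd, neg_neg]
    rw [map_add, h1]
    exact Submodule.add_mem _ (mem_janetDenom_of_valuedIn (wd_mem_valuedIn j hφ))
      (Submodule.neg_mem _ (delta_mem_janetDenom (wd_mem_valuedIn j hζ)))

/-- On coefficients of degree zero, `∑ dxʲ ∧ ·` is injective. So membership means that each `w j` is
a contraction of an `R`-valued form plus the shift by `j` of a homogeneous jet. -/
theorem sum_wd_mem_projOp_iff {c : Pt n → FormJet n q m 0 →L[ℝ] (ι → ℝ)}
    (hc : IsJanetCoord V R c) {x : Pt n} (hx : x ∈ V) (w : Fin n → FormJet n q m 0) :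
    ∑ j, wd j (w j) ∈ janetDenom R x 1 ↔ ∃ z ∈ symTop n (q + 1) (Fin m), ∀ j τ,
      c x (w j) τ = (projOp c).eval x τ (shift n q (Fin m) j z) := by
  constructor
  · intro h1
    obtain ⟨φ, hφ, ζ, hζ, h2⟩ := exists_of_mem_janetDenom h1
    rw [delta_eq, eq_sum_wd φ, ← Finset.sum_add_distrib, ← sub_eq_zero,
      ← Finset.sum_sub_distrib] at h2
    simp only [← map_add, ← map_sub] at h2
    refine ⟨ζ ![], hζ ![], fun i τ => ?_⟩
    have h3 := sub_eq_zero.1 (eq_zero_of_sum_wd_eq_zero h2 i)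
    rw [projOp_eval, h3, map_add,
      (hc.coord_eq_zero hx).2 (mem_janetDenom_of_valuedIn (ct_mem_valuedIn hφ _ i)), zero_add,
      eq_cst (shiftForm i ζ), shiftForm_apply]
  · rintro ⟨z, hz, h⟩
    have h1 : ∀ j, w j - shiftForm j (cst z) ∈ janetDenom R x 0 := fun j => by
      rw [← hc.coord_eq_zero hx, map_sub, sub_eq_zero]
      funext τ
      rw [h, projOp_eval, shiftForm_cst]
    have h2 := Submodule.add_mem _ (Submodule.sum_mem _ fun j (_ : j ∈ Finset.univ) =>
      wd_mem_janetDenom j (h1 j)) (delta_mem_janetDenom (R := R) (x := x) (ζ := cst z) fun _ => hz)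
    rw [delta_eq, ← Finset.sum_add_distrib] at h2
    simpa only [← map_add, sub_add_cancel] using h2

/-- Write `δζ` as `-∑ dxʲ ∧ δζⱼ`. The Koszul complex gives, modulo the denominator, `w j = ∑ dxⁱ ∧
sᵢⱼ` with `s` symmetric, whose class is the symbol of `b` on the homogeneous two-jet with entries
`c(sᵢⱼ)`. Conversely, such symmetric terms cancel in `∑ dxʲ ∧ w j`. -/
theorem sum_wd_mem_iff {c : Pt n → FormJet n q m r →L[ℝ] (ι → ℝ)}
    {c' : Pt n → FormJet n q m (r + 1) →L[ℝ] (ι' → ℝ)} {b : LinOp n 1 ι ι'} (hV : IsOpen V)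
    (hc : IsJanetCoord V R c) (hc' : IsJanetCoord V R c') (h : Induced V c c' b) {x : Pt n}
    (hx : x ∈ V) (w : Fin n → FormJet n q m (r + 1)) :
    ∑ j, wd j (w j) ∈ janetDenom R x (r + 2) ↔ ∃ z ∈ symTop n 2 ι, ∀ j ρ,
      c' x (w j) ρ = b.eval x ρ (shift n 1 ι j z) := by
  constructor
  · intro h1
    obtain ⟨φ, hφ, ζ, hζ, h2⟩ := exists_of_mem_janetDenom h1
    have h3 : delta n q m (r + 1) ζ
        = ∑ j, wd j (-delta n q m r ((r + 1 : ℝ)⁻¹ • ct j ζ)) := by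
      conv_lhs => rw [eq_sum_wd ζ, map_sum]
      refine Finset.sum_congr rfl fun j _ => ?_
      rw [delta_wd, map_neg]
    rw [h3, eq_sum_wd φ, ← Finset.sum_add_distrib, ← sub_eq_zero,
      ← Finset.sum_sub_distrib] at h2
    simp only [← map_add, ← map_sub] at h2
    obtain ⟨s, hs, h4⟩ := exists_symm_of_sum_wd_eq_zero h2
    obtain ⟨z, hz, hzs⟩ := exists_mem_symTop_two (s := fun i j => c x (s i j))
      fun i j => by rw [hs]
    refine ⟨z, hz, fun j ρ => ?_⟩
    have h5 := congrArg (c' x) (h4 j)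
    rw [map_sub, map_add, map_neg,
      (hc'.coord_eq_zero hx).2 (mem_janetDenom_of_valuedIn (ct_mem_valuedIn hφ _ j)),
      (hc'.coord_eq_zero hx).2 (delta_mem_janetDenom (ct_mem_valuedIn hζ _ j)), neg_zero,
      add_zero, sub_zero, ← h.symb_eq hV hc.smooth hx] at h5
    rw [h5, eval_shift_of_mem_symTop b x hz]
    simp only [hzs]
  · rintro ⟨z, hz, hv⟩
    choose g hg using hc.surjective x hx
    have h1 : ∀ j, w j - ∑ i, wd i (g (z ((MIdx.unit i).succ j))) ∈ janetDenom R x (r + 1) :=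
      fun j => by
      rw [← hc'.coord_eq_zero hx, map_sub, sub_eq_zero]
      funext ρ
      rw [hv, eval_shift_of_mem_symTop b x hz, ← h.symb_eq hV hc.smooth hx]
      simp only [hg]
    have h2 : ∑ j, wd j (∑ i, wd i (g (z ((MIdx.unit i).succ j)))) = 0 := by
      simp only [map_sum]
      exact sum_wd_wd_of_symm (s := fun j i => g (z ((MIdx.unit i).succ j)))
        fun i j => by rw [unit_succ_comm]
    have h3 := Submodule.sum_mem _ fun j (_ : j ∈ Finset.univ) => wd_mem_janetDenom j (h1 j)
    simp only [map_sub] at h3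
    rwa [Finset.sum_sub_distrib, h2, sub_zero] at h3

/-- The kernel of the symbol is described by `hw` on forms; surjectivity of the fibre coordinates
transfers this to vectors. -/
theorem Induced.symbolExact {q' : ℕ} {κ : Type} [Fintype κ] {a : LinOp n q' κ ι}
    {c : Pt n → FormJet n q m r →L[ℝ] (ι → ℝ)}
    {c' : Pt n → FormJet n q m (r + 1) →L[ℝ] (ι' → ℝ)} {b : LinOp n 1 ι ι'}
    (h : Induced V c c' b) (hV : IsOpen V) (hc : IsJanetCoord V R c) (hc' : IsJanetCoord V R c')
    {x : Pt n} (hx : x ∈ V) (hw : ∀ w : Fin n → FormJet n q m r,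
      ∑ j, wd j (w j) ∈ janetDenom R x (r + 1) ↔ ∃ z ∈ symTop n (q' + 1) κ, ∀ j τ,
        c x (w j) τ = a.eval x τ (shift n q' κ j z)) : SymbolExact a b x := fun v => by
  choose g hg using hc.surjective x hx
  have h1 := h.symb_eq hV hc.smooth hx fun j => g (v j)
  have h2 := hw fun j => g (v j)
  simp only [hg] at h1 h2
  rw [h1, hc'.coord_eq_zero hx, h2]

end Exactness


/-! ### Exactness and reduced form in arbitrary adapted coordinates -/

section Sequence

variable {n q m r : ℕ} {V : Set (Pt n)} {R : Pt n → Submodule ℝ (Jet n q (Fin m))}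

theorem Induced.coord_wd {ι ι' : Type} [Fintype ι] [Fintype ι']
    {c : Pt n → FormJet n q m r →L[ℝ] (ι → ℝ)}
    {c' : Pt n → FormJet n q m (r + 1) →L[ℝ] (ι' → ℝ)} {b : LinOp n 1 ι ι'}
    (h : Induced V c c' b) (hV : IsOpen V) (hc : ContDiffOn ℝ ∞ c V) {x : Pt n} (hx : x ∈ V)
    (j : Fin n) (w : FormJet n q m r) (ρ : ι') :
    c' x (wd j w) ρ = ∑ τ, b x ρ (MIdx.unit j) τ * c x w τ := by
  have h1 := congrFun (h.symb_eq hV hc hx (Pi.single j w)) ρ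
  rw [LinOp.symb_apply, Finset.sum_eq_single j, Finset.sum_eq_single j, Pi.single_eq_same] at h1
  · exact h1.symm
  · intro i _ hi
    rw [Pi.single_eq_of_ne hi, map_zero]
  · simp
  · intro i _ hi
    simp [Pi.single_eq_of_ne hi]
  · simp

theorem constLift_projOp {N : ℕ} {c : Pt n → FormJet n q m 0 →L[ℝ] (Fin N → ℝ)}
    {piv : Fin N → MIdx n q × Fin m} (ha : (projOp c).SolvedForm V piv) :
    ConstLift V c fun τ => cst (basisJet (piv τ).1 (piv τ).2) := fun x hx τ => by
  funext σ
  rw [← projOp_eval, eval_basisJet, ha.1 x hx σ τ, Pi.single_apply]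
  split_ifs <;> rfl

/-- For the leading jet `u^τ_j` of an equation, `dxʲ ∧ L_τ` is the dual form: its coordinates are
the coefficients of `u^τ_j` in all equations, which the solved form makes `0` or `1`. -/
theorem ConstLift.exists_succ {N N' : ℕ} {c : Pt n → FormJet n q m r →L[ℝ] (Fin N → ℝ)}
    {c' : Pt n → FormJet n q m (r + 1) →L[ℝ] (Fin N' → ℝ)} {b : LinOp n 1 (Fin N) (Fin N')}
    {piv : Fin N' → MIdx n 1 × Fin N} {k : Fin N → ℕ} {L : Fin N → FormJet n q m r}
    (hL : ConstLift V c L) (h : Induced V c c' b) (hV : IsOpen V) (hc : ContDiffOn ℝ ∞ c V)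
    (hb : b.SolvedForm V piv) (hl : ∀ x ∈ V, LeadsComplete k piv) :
    ∃ L' : Fin N' → FormJet n q m (r + 1), ConstLift V c' L' := by
  -- A base point serves only to see that the leading jets have order one; they do not vary with the
  -- point.
  rcases V.eq_empty_or_nonempty with rfl | ⟨x₀, hx₀⟩
  · exact ⟨0, fun x hx => hx.elim⟩
  choose j τ hj _ using (hl x₀ hx₀).1
  refine ⟨fun ρ => wd (j ρ) (L (τ ρ)), fun x hx ρ => ?_⟩
  funext σ
  have h1 := hb.1 x hx σ ρ
  rw [h.coord_wd hV hc hx, hL x hx]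
  rw [hj] at h1
  simp [Pi.single_apply, h1]

/-- Involution is known for some local equations of `R`; the given fibre coordinates provide other
equations in solved form with the same kernel. -/
theorem symbolInvolutive_projOp {U : Set (Pt n)} (hq : 1 ≤ q) (hR : IsInvolutive U R) (hVU : V ⊆ U)
    {N : ℕ} {c : Pt n → FormJet n q m 0 →L[ℝ] (Fin N → ℝ)} {piv : Fin N → MIdx n q × Fin m}
    (hc : IsJanetCoord V R c) (ha : (projOp c).SolvedForm V piv) {x : Pt n} (hx : x ∈ V) :
    SymbolInvolutive (projOp c) piv x := by
  obtain ⟨V', -, hx', -, N', a', piv', -, hs, ha', hm⟩ := hR x (hVU hx)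
  refine SymbolInvolutive.of_same_kernel hq ha ha' hx hx' (fun y => ?_) (hm.symbolInvolutive hx')
  rw [hc.projOp_eval_eq_zero hx, ← hs x hx']
  rfl

namespace JanetSequence

variable (J : JanetSequence V R)

theorem isJanetCoord (r : ℕ) : IsJanetCoord V R (J.coord r) :=
  ⟨J.coord_smooth r, J.coord_surjective r, J.coord_ker r⟩

theorem induced (r : ℕ) : Induced V (J.coord r) (J.coord (r + 1)) (J.op r) := J.op_induced r

theorem op₀_eq : J.op₀ = projOp (J.coord 0) := rfl

end JanetSequence

theorem janet_sequence {U : Set (Pt n)} (hq : 1 ≤ q) (hR : IsInvolutive U R) (hV : IsOpen V)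
    (hVU : V ⊆ U) (J : JanetSequence V R) (hJ : J.IsSolved) :
    GeneratesCC V J.op₀ (J.op 0) ∧ (∀ r, GeneratesCC V (J.op r) (J.op (r + 1))) ∧
      ∀ r, ReducedSpencerForm (J.op r) V := by
  obtain ⟨⟨piv₀, ha⟩, hop⟩ := hJ
  choose piv hb using hop
  rw [J.op₀_eq] at ha ⊢
  have hs (r x) (hx : x ∈ V) : Function.Surjective ((J.op r).symb x) :=
    (J.induced r).symb_surjective hV (J.coord_smooth r) hx (J.coord_surjective (r + 1) x hx)
  have has := projOp_smooth (J.coord_smooth 0)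
  have hex₀ : ∀ x ∈ V, SymbolExact (projOp (J.coord 0)) (J.op 0) x := fun x hx =>
    (J.induced 0).symbolExact hV (J.isJanetCoord 0) (J.isJanetCoord 1) hx
      (sum_wd_mem_projOp_iff (J.isJanetCoord 0) hx)
  have hex : ∀ r, ∀ x ∈ V, SymbolExact (J.op r) (J.op (r + 1)) x := fun r x hx =>
    (J.induced (r + 1)).symbolExact hV (J.isJanetCoord (r + 1)) (J.isJanetCoord (r + 2)) hx
      (sum_wd_mem_iff hV (J.isJanetCoord r) (J.isJanetCoord (r + 1)) (J.induced r) hx)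
  have hl₀ : ∀ x ∈ V, LeadsComplete (eqClass piv₀) (piv 0) := fun x hx =>
    leadsComplete hx ha (symbolInvolutive_projOp hq hR hVU (J.isJanetCoord 0) ha hx) (hb 0)
      (hex₀ x hx) (hs 0 x hx)
  have hcomp₀ := (J.induced 0).composite_projOp hV
  -- Involution of `op r` locates the leading jets of `op (r + 1)`, and the lift for `F_r` makes the
  -- composite of the two vanish. The lift for `F_{r+1}` is carried along for the next step.
  have key : ∀ r, (J.op r).MultiplicativeProlongation V (piv r) ∧
      (∃ L, ConstLift V (J.coord r) L) ∧ ∃ L, ConstLift V (J.coord (r + 1)) L := fun r => by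
    induction r with
    | zero =>
      exact ⟨multiplicativeProlongation hq hV has ha (J.op_smooth 0) (hb 0) hl₀ hcomp₀,
        ⟨_, constLift_projOp ha⟩, (constLift_projOp ha).exists_succ (J.induced 0) hV
          (J.coord_smooth 0) (hb 0) hl₀⟩
    | succ r ih =>
      obtain ⟨hm, ⟨L, hL⟩, L', hL'⟩ := ih
      have hl : ∀ x ∈ V, LeadsComplete (eqClass (piv r)) (piv (r + 1)) := fun x hx =>
        leadsComplete hx (hb r) (hm.symbolInvolutive hx) (hb (r + 1)) (hex r x hx)
          (hs (r + 1) x hx)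
      exact ⟨multiplicativeProlongation le_rfl hV (J.op_smooth r) (hb r) (J.op_smooth (r + 1))
        (hb (r + 1)) hl ((J.induced r).composite (J.induced (r + 1)) hV hL), ⟨L', hL'⟩,
        hL'.exists_succ (J.induced (r + 1)) hV (J.coord_smooth (r + 1)) (hb (r + 1)) hl⟩
  have hl : ∀ r, ∀ x ∈ V, LeadsComplete (eqClass (piv r)) (piv (r + 1)) := fun r x hx =>
    leadsComplete hx (hb r) ((key r).1.symbolInvolutive hx) (hb (r + 1)) (hex r x hx)
      (hs (r + 1) x hx)
  have hcomp (r) : ∀ u, ContDiffOn ℝ ∞ u V → ∀ x ∈ V,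
      (J.op (r + 1)).apply ((J.op r).apply u) x = 0 := by
    obtain ⟨L, hL⟩ := (key r).2.1
    exact (J.induced r).composite (J.induced (r + 1)) hV hL
  refine ⟨generatesCC hq hV has ha (J.op_smooth 0) (hb 0) hl₀ hcomp₀, fun r =>
    generatesCC le_rfl hV (J.op_smooth r) (hb r) (J.op_smooth (r + 1)) (hb (r + 1)) (hl r)
      (hcomp r), fun r => ?_⟩
  cases r with
  | zero => exact reducedSpencerForm hq hV has ha (J.op_smooth 0) (hb 0) hl₀ hex₀ (hs 0) hcomp₀
  | succ r =>
    exact reducedSpencerForm le_rfl hV (J.op_smooth r) (hb r) (J.op_smooth (r + 1)) (hb (r + 1))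
      (hl r) (hex r) (hs (r + 1)) (hcomp r)

end Sequence


/-! ### Smooth equations for the image of an involutive symbol -/

section SymbolImage

variable {n q : ℕ} {κ ι : Type} [Fintype κ] {V : Set (Pt n)} {a : LinOp n q κ ι}
  {piv : ι → MIdx n q × κ}

/-- The image of the symbol map `S_{q+1}T* ⊗ E → T* ⊗ F`. -/
noncomputable def LinOp.symbolImage (a : LinOp n q κ ι) (x : Pt n) :
    Submodule ℝ (Fin n → ι → ℝ) :=
  (symTop n (q + 1) κ).map
    (LinearMap.pi fun i => (a.evalLin x).comp (shift n q κ i).toLinearMap)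

theorem LinOp.mem_symbolImage {x : Pt n} {v : Fin n → ι → ℝ} : v ∈ a.symbolImage x ↔
    ∃ z ∈ symTop n (q + 1) κ, ∀ i τ, v i τ = a.eval x τ (shift n q κ i z) := by
  constructor
  · rintro ⟨z, hz, rfl⟩
    exact ⟨z, hz, fun _ _ => rfl⟩
  · rintro ⟨z, hz, h⟩
    exact ⟨z, hz, funext fun i => funext fun τ => (h i τ).symm⟩

variable [Fintype ι]

theorem eq_sum_single [DecidableEq ι] (v : Fin n → ι → ℝ) :
    v = ∑ i, ∑ τ, v i τ • (Pi.single i (Pi.single τ 1) : Fin n → ι → ℝ) := by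
  funext j σ
  simp only [Finset.sum_apply, Pi.smul_apply, smul_eq_mul]
  rw [Finset.sum_eq_single j, Finset.sum_eq_single σ]
  · simp
  · intro τ _ h
    simp [h.symm]
  · simp
  · intro i _ h
    simp [h.symm]
  · simp

/-- Reduction of `dxⁱ ⊗ e_τ` modulo the image of the symbol to the `dxʲ ⊗ e_σ` with `xʲ` not
multiplicative for `Φ^σ`. -/
theorem exists_reduction [DecidableEq ι] (has : a.Smooth V) (ha : a.SolvedForm V piv) (i : Fin n)
    (τ : ι) : ∃ p : Pt n → Fin n → ι → ℝ, (∀ j σ, ContDiffOn ℝ ∞ (fun x => p x j σ) V) ∧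
      (∀ x j σ, p x j σ ≠ 0 → eqClass piv σ < j.val + 1 ∧ i ≤ j) ∧
      (∀ x ∈ V, Pi.single i (Pi.single τ 1) - p x ∈ a.symbolImage x) ∧
      (eqClass piv τ < i.val + 1 → ∀ x, p x = Pi.single i (Pi.single τ 1)) := by
  induction i using WellFoundedGT.induction generalizing τ with
  | ind i ih =>
  by_cases hc : eqClass piv τ < i.val + 1
  · refine ⟨fun _ => Pi.single i (Pi.single τ 1), fun j σ => contDiffOn_const, fun x j σ h => ?_,
      fun x _ => ?_, fun _ _ => rfl⟩
    · have hj : j = i := by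
        by_contra hj
        exact h (by simp [hj])
      subst hj
      have hσ : σ = τ := by
        by_contra hσ
        exact h (by simp [hσ])
      subst hσ
      exact ⟨hc, le_rfl⟩
    · rw [sub_self]
      exact Submodule.zero_mem _
  -- Here `xⁱ` is multiplicative: the leading multi-index of `τ` raised by `1ᵢ` has image `dxⁱ ⊗
  -- e_τ` plus terms `dxʲ ⊗ e_σ` with `j > i`, whose reductions are known by descending induction on
  -- `i`.
  · choose p hps hp hpi _ using fun (j : {j // i < j}) σ => ih j.1 j.2 σ
    rw [not_lt] at hc
    set z := basisJet ((piv τ).1.succ i) (piv τ).2 with hz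
    refine ⟨fun x => -∑ j : {j // i < j}, ∑ σ, a.eval x σ (shift n q κ j.1 z) • p j σ x,
      fun k ρ => ?_, fun x k ρ h => ?_, fun x hx => ?_, fun h => absurd h (by omega)⟩
    · simp only [Pi.neg_apply, Finset.sum_apply, Pi.smul_apply, smul_eq_mul]
      exact (ContDiffOn.sum fun j _ => ContDiffOn.sum fun σ _ => ContDiffOn.mul
        (ContDiffOn.sum fun μ _ => ContDiffOn.sum fun k _ => (has σ μ k).mul contDiffOn_const)
        (hps j σ k ρ)).neg
    · simp only [Pi.neg_apply, Finset.sum_apply, Pi.smul_apply, smul_eq_mul] at h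
      obtain ⟨j, -, h1⟩ := Finset.exists_ne_zero_of_sum_ne_zero (neg_ne_zero.1 h)
      obtain ⟨σ, -, h2⟩ := Finset.exists_ne_zero_of_sum_ne_zero h1
      have h3 := hp j σ x k ρ (right_ne_zero_of_mul h2)
      exact ⟨h3.1, j.2.le.trans h3.2⟩
    · have h1 : (Pi.single i (Pi.single τ 1) : Fin n → ι → ℝ)
          = (fun j σ => a.eval x σ (shift n q κ j z)) - ∑ j : {j // i < j}, ∑ σ,
            a.eval x σ (shift n q κ j.1 z) •
              (Pi.single j.1 (Pi.single σ 1) : Fin n → ι → ℝ) := by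
        funext k ρ
        have h2 : (∑ j : {j // i < j}, ∑ σ, a.eval x σ (shift n q κ j.1 z) •
              (Pi.single j.1 (Pi.single σ 1) : Fin n → ι → ℝ)) k ρ
            = if i < k then a.eval x ρ (shift n q κ k z) else 0 := by
          have h3 : ∀ j : {j // i < j}, (∑ σ, a.eval x σ (shift n q κ j.1 z) •
              (Pi.single j.1 (Pi.single σ 1) : Fin n → ι → ℝ)) k ρ
              = if j.1 = k then a.eval x ρ (shift n q κ k z) else 0 := fun j => by
            simp only [Finset.sum_apply, Pi.smul_apply, smul_eq_mul]
            rw [Finset.sum_eq_single ρ]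
            · by_cases h : j.1 = k
              · subst h
                simp
              · simp [h]
            · intro σ _ h
              by_cases h' : j.1 = k
              · subst h'
                simp [h.symm]
              · simp [Pi.single_eq_of_ne (Ne.symm h')]
            · simp
          rw [Finset.sum_apply, Finset.sum_apply]
          simp only [h3]
          split_ifs with h
          · rw [Finset.sum_eq_single ⟨k, h⟩]
            · simp
            · intro j _ hj
              exact if_neg fun h' => hj (Subtype.ext h')
            · simp
          · exact Finset.sum_eq_zero fun j _ => if_neg fun h' : j.1 = k => h (h' ▸ j.2)
        rw [Pi.sub_apply, Pi.sub_apply, h2]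
        rcases lt_trichotomy i k with h | h | h
        · rw [if_pos h, sub_self, Pi.single_eq_of_ne h.ne', Pi.zero_apply]
        · subst h
          rw [if_neg (lt_irrefl _), sub_zero, eval_shift_pivot_self hx ha, Pi.single_eq_same,
            Pi.single_apply]
        · rw [if_neg h.not_gt, sub_zero, eval_shift_pivot_of_lt ρ x hc h,
            Pi.single_eq_of_ne h.ne, Pi.zero_apply]
      rw [h1, sub_neg_eq_add, sub_add, ← Finset.sum_sub_distrib]
      simp only [← Finset.sum_sub_distrib, ← smul_sub]
      refine Submodule.sub_mem _ (LinOp.mem_symbolImage.2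
        ⟨z, pivot_mem_symTop i (by omega), fun _ _ => rfl⟩)
        (Submodule.sum_mem _ fun j _ => Submodule.sum_mem _ fun σ _ =>
          Submodule.smul_mem _ _ (hpi j σ x hx))

/-- Smooth equations in solved form for the image of the symbol of an involutive system. -/
theorem exists_symbol_equations (has : a.Smooth V) (ha : a.SolvedForm V piv)
    (hinv : ∀ x ∈ V, SymbolInvolutive a piv x) :
    ∃ (N : ℕ) (s : Pt n → Fin N → Fin n → ι → ℝ) (l : Fin N → Fin n × ι),
      (∀ ρ i τ, ContDiffOn ℝ ∞ (fun x => s x ρ i τ) V) ∧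
      (∀ x ρ ρ', s x ρ (l ρ').1 (l ρ').2 = if ρ = ρ' then 1 else 0) ∧
      (∀ x ρ i τ, (l ρ).1 < i → s x ρ i τ = 0) ∧
      ∀ x ∈ V, ∀ v, (∀ ρ, ∑ i, ∑ τ, s x ρ i τ * v i τ = 0) ↔ v ∈ a.symbolImage x := by
  classical
  choose p hps hp hpi hp1 using exists_reduction has ha
  let P := {l : Fin n × ι // eqClass piv l.2 < l.1.val + 1}
  let e : Fin (Fintype.card P) ≃ P := (Fintype.equivFin P).symm
  -- The equations are the nonmultiplicative coefficients of the reduced form. Reduction fixes the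
  -- nonmultiplicative basis elements, which gives the solved form, and it never lowers the index
  -- `i` of `dxⁱ`, which gives the class condition.
  refine ⟨Fintype.card P, fun x ρ i τ => p i τ x (e ρ).1.1 (e ρ).1.2, fun ρ => (e ρ).1,
    fun ρ i τ => hps i τ _ _, fun x ρ ρ' => ?_, fun x ρ i τ h => ?_, fun x hx v => ?_⟩
  · beta_reduce
    rw [hp1 _ _ (e ρ').2]
    split_ifs with h
    · subst h
      simp
    · have h1 : (e ρ).1 ≠ (e ρ').1 := fun h' => h (e.injective (Subtype.ext h'))
      by_cases h2 : (e ρ).1.1 = (e ρ').1.1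
      · rw [h2, Pi.single_eq_same, Pi.single_eq_of_ne fun h3 => h1 (Prod.ext h2 h3)]
      · rw [Pi.single_eq_of_ne h2, Pi.zero_apply]
  · by_contra h1
    exact absurd h (hp i τ x _ _ h1).2.not_gt
  · set w : Fin n → ι → ℝ := ∑ i, ∑ τ, v i τ • p i τ x with hw
    have hvw : v - w ∈ a.symbolImage x := by
      rw [eq_sum_single v, hw, ← Finset.sum_sub_distrib]
      simp only [← Finset.sum_sub_distrib, ← smul_sub]
      exact Submodule.sum_mem _ fun i _ => Submodule.sum_mem _ fun τ _ =>
        Submodule.smul_mem _ _ (hpi i τ x hx)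
    have hwa : ∀ j σ, w j σ = ∑ i, ∑ τ, p i τ x j σ * v i τ := fun j σ => by
      rw [hw]
      simp only [Finset.sum_apply, Pi.smul_apply, smul_eq_mul]
      exact Finset.sum_congr rfl fun i _ => Finset.sum_congr rfl fun τ _ => mul_comm _ _
    have hw0 : ∀ j σ, j.val + 1 ≤ eqClass piv σ → w j σ = 0 := fun j σ h => by
      rw [hwa]
      refine Finset.sum_eq_zero fun i _ => Finset.sum_eq_zero fun τ _ => ?_
      by_contra h1
      have := (hp i τ x j σ (left_ne_zero_of_mul h1)).1
      omega
    simp only [← hwa]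
    constructor
    · intro h
      have : w = 0 := by
        funext j σ
        rcases Nat.lt_or_ge (eqClass piv σ) (j.val + 1) with h1 | h1
        · have h2 := h (e.symm ⟨(j, σ), h1⟩)
          simpa using h2
        · exact hw0 j σ h1
      rwa [this, sub_zero] at hvw
    -- If `v` lies in the image, so does its reduction `w`; having no multiplicative entries, `w`
    -- vanishes by involution.
    · intro h ρ
      have h1 := Submodule.sub_mem _ h hvw
      rw [sub_sub_cancel] at h1
      obtain ⟨z, hz, h2⟩ := LinOp.mem_symbolImage.1 h1
      rw [h2]
      exact hinv x hx z hz (fun σ j hj => by rw [← h2, hw0 j σ hj]) _ _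

end SymbolImage


/-! ### Consequences of involution for sections of the system -/

section Prolongation

variable {n q : ℕ} {κ ι : Type} [Fintype κ] {V : Set (Pt n)}

theorem LinOp.evalD_add (a : LinOp n q κ ι) (x : Pt n) (j : Fin n) (τ : ι)
    (y z : Jet n (q + 1) κ) : a.evalD x j τ (y + z) = a.evalD x j τ y + a.evalD x j τ z := by
  simp only [LinOp.evalD, ← Finset.sum_add_distrib, Pi.add_apply]
  exact Finset.sum_congr rfl fun _ _ => Finset.sum_congr rfl fun _ _ => by ring

theorem pderiv_eval (hV : IsOpen V) {a : LinOp n q κ ι} (has : a.Smooth V)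
    {y : Pt n → Jet n q κ} (hy : ∀ μ k, ContDiffOn ℝ ∞ (fun z => y z μ k) V) (j : Fin n) (τ : ι)
    {x : Pt n} (hx : x ∈ V) :
    pderiv j (fun z => a.eval z τ (y z)) x
      = a.eval x τ (fun μ k => pderiv j (fun z => y z μ k) x)
        + ∑ μ : MIdx n q, ∑ k, pderiv j (fun z => a z τ μ k) x * y x μ k := by
  have h := fun μ k => (has τ μ k).mul (hy μ k)
  unfold LinOp.eval
  rw [pderiv_sum hV _ (fun μ _ => ContDiffOn.sum fun k _ => h μ k) j hx, ← Finset.sum_add_distrib]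
  refine Finset.sum_congr rfl fun μ _ => ?_
  rw [pderiv_sum hV _ (fun k _ => h μ k) j hx, ← Finset.sum_add_distrib]
  refine Finset.sum_congr rfl fun k _ => ?_
  rw [pderiv_mul hV (has τ μ k) (hy μ k) j hx, add_comm]

variable [Fintype ι] {a : LinOp n q κ ι} {piv : ι → MIdx n q × κ}

/-- The Spencer operator applied to a solution `y` of the system, modulo the image of the
symbol. -/
theorem LinOp.MultiplicativeProlongation.exists_spencer (hm : a.MultiplicativeProlongation V piv)
    (hq : 1 ≤ q) (hV : IsOpen V) (has : a.Smooth V) (ha : a.SolvedForm V piv)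
    {y : Pt n → Jet n (q + 1) κ} (hy : ∀ μ k, ContDiffOn ℝ ∞ (fun z => y z μ k) V)
    (hay : ∀ z ∈ V, ∀ τ, a.eval z τ (trunc n q κ (y z)) = 0) {x : Pt n} (hx : x ∈ V) :
    ∃ z ∈ symTop n (q + 1) κ, ∀ i τ,
      a.eval x τ (trunc n q κ fun μ k => pderiv i (fun z => y z μ k) x)
        = a.eval x τ (shift n q κ i (y x)) + a.eval x τ (shift n q κ i z) := by
  -- This is the derivative along `xⁱ` of `a(y) = 0`, rewritten through the formal derivative.
  have h1 : ∀ i τ, a.eval x τ (trunc n q κ fun μ k => pderiv i (fun z => y z μ k) x)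
      = a.eval x τ (shift n q κ i (y x)) - a.evalD x i τ (y x) := fun i τ => by
    have h2 : Set.EqOn (fun z => a.eval z τ (trunc n q κ (y z))) (fun _ => 0) V := fun z hz =>
      hay z hz τ
    have h3 := (pderiv_eval hV has (y := fun z => trunc n q κ (y z)) (fun μ k => hy μ.emb k) i τ
      hx).symm.trans (pderiv_eqOn hV h2 i hx)
    have h4 : pderiv i (fun _ => (0 : ℝ)) x = 0 := by simp [pderiv]
    rw [evalD_eq, sub_add_eq_sub_sub, sub_self, zero_sub, ← add_eq_zero_iff_eq_neg, ← h4]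
    exact h3
  -- `z` corrects `y` so that the multiplicative prolongations vanish on `y + z`. By hypothesis all
  -- of them then vanish, so `evalD` on `y` is minus the symbol on `z`.
  obtain ⟨z, hz, hz1⟩ := ha.exists_mem_symTop hq hx fun τ j => -a.evalD x j τ (y x)
  refine ⟨z, hz, fun i τ => ?_⟩
  have h2 := hm x hx (y x + z) (fun τ => by
    rw [map_add, trunc_of_mem_symTop hz, add_zero, hay x hx]) (fun τ j hj => by
    rw [LinOp.evalD_add, evalD_of_mem_symTop a x j τ hz, hz1 τ j hj, add_neg_cancel]) τ i
  rw [LinOp.evalD_add, evalD_of_mem_symTop a x i τ hz] at h2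
  rw [h1, sub_eq_add_neg, eq_neg_of_add_eq_zero_right h2]

/-- If the symbol of a first order operator maps `∑ dxⁱ ⊗ yᵢ` to zero, then the values of the
operator on the `yⱼ` form an element of the image of the prolonged symbol. -/
theorem LinOp.MultiplicativeProlongation.exists_symm {b : LinOp n 1 κ ι} {piv : ι → MIdx n 1 × κ}
    (hm : b.MultiplicativeProlongation V piv)
    (hV : IsOpen V) (hbs : b.Smooth V) (hb : b.SolvedForm V piv) {y : Fin n → Pt n → κ → ℝ}
    (hy : ∀ i k, ContDiffOn ℝ ∞ (fun z => y i z k) V)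
    (hby : ∀ z ∈ V, b.symb z (fun i => y i z) = 0) {x : Pt n} (hx : x ∈ V) :
    (fun j => b.apply (y j) x) ∈ b.symbolImage x := by
  -- The two-jet with first order part `(yᵢ)` and nothing else (the factor `μ.1 i` selects `i` when
  -- `μ = 1ᵢ`). It solves the system by `hby`, and its shift by `j` has order zero part `yⱼ` and no
  -- first order part.
  let Y : Pt n → Jet n 2 κ := fun z μ k =>
    if μ.len = 1 then ∑ i, (μ.1 i : ℝ) * y i z k else 0
  have hY : ∀ μ k, ContDiffOn ℝ ∞ (fun z => Y z μ k) V := fun μ k => by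
    by_cases h : μ.len = 1
    · simp only [Y, if_pos h]
      exact ContDiffOn.sum fun i _ => contDiffOn_const.mul (hy i k)
    · simp only [Y, if_neg h]
      exact contDiffOn_const
  have hY0 : ∀ z, Y z (MIdx.zero n 1).emb = 0 := fun z =>
    funext fun k => if_neg (by simp [MIdx.len, MIdx.emb, MIdx.zero])
  have hY1 : ∀ z i, Y z (MIdx.unit i).emb = y i z := fun z i => by
    funext k
    have : (MIdx.unit i).emb.len = 1 := len_unit i
    simp only [Y, if_pos this, emb_val, unit_val]
    simp [Pi.single_apply]
  have hYs : ∀ z j, Y z ((MIdx.zero n 1).succ j) = y j z := fun z j => by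
    rw [← hY1]
    congr 1
  have hY2 : ∀ z i j, Y z ((MIdx.unit i).succ j) = 0 := fun z i j => by
    funext k
    exact if_neg (by rw [len_succ, len_unit]; norm_num)
  obtain ⟨z, hz, h⟩ := hm.exists_spencer le_rfl hV hbs hb hY (fun z hz τ => by
    rw [eval_order_one]
    simp only [trunc_apply, hY0, hY1, hby z hz]
    simp) hx
  -- By `exists_spencer`, the order zero part of `b(yⱼ)` is the symbol of `∂ⱼyᵢ - zᵢⱼ`. Adding the
  -- symbol of `∂ᵢyⱼ` makes the argument symmetric in `i` and `j`.
  obtain ⟨z', hz', h'⟩ := exists_mem_symTop_two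
    (s := fun i j k => pderiv i (fun z => y j z k) x + pderiv j (fun z => y i z k) x
      - z ((MIdx.unit i).succ j) k) fun i j => by
        funext k
        rw [add_comm, unit_succ_comm]
  refine LinOp.mem_symbolImage.2 ⟨z', hz', fun j τ => ?_⟩
  have h1 := h j τ
  have h2 : (fun i => trunc n 1 κ (fun μ k => pderiv j (fun z => Y z μ k) x) (MIdx.unit i))
      = fun i k => pderiv j (fun z => y i z k) x := by
    funext i k
    simp only [trunc_apply, hY1]
  have h3 : trunc n 1 κ (fun μ k => pderiv j (fun z => Y z μ k) x) (MIdx.zero n 1) = 0 := by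
    funext k
    simp [trunc_apply, hY0, pderiv]
  rw [eval_order_one, eval_order_one, h2, h3, eval_shift_of_mem_symTop b x hz] at h1
  simp only [shift_apply, hYs, hY2] at h1
  rw [apply_order_one hV b (hy j) hx, eval_shift_of_mem_symTop b x hz']
  simp only [h']
  have h4 : (fun i k => pderiv i (fun z => y j z k) x + pderiv j (fun z => y i z k) x
      - z ((MIdx.unit i).succ j) k) = (fun i k => pderiv i (fun z => y j z k) x)
        + (fun i k => pderiv j (fun z => y i z k) x) - fun i => z ((MIdx.unit i).succ j) := rfl
  have h5 : b.symb x (fun _ => (0 : κ → ℝ)) = 0 := map_zero (b.symb x)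
  rw [h4, map_sub, map_add, Pi.sub_apply, Pi.add_apply]
  rw [h5] at h1
  simp only [Pi.zero_apply, mul_zero, Finset.sum_const_zero, zero_add, add_zero] at h1
  rw [h1]
  ring

end Prolongation


/-! ### The Spencer operator descends to the Janet bundles -/

section WellDefined

variable {n q m r : ℕ} {V : Set (Pt n)} {R : Pt n → Submodule ℝ (Jet n q (Fin m))} {ι ι' : Type}
  [Fintype ι] [Fintype ι']

/-- Zero-forms as jets. -/
noncomputable def evL : FormJet n q m 0 →L[ℝ] Jet n q (Fin m) :=
  (ContinuousAlternatingMap.constOfIsEmptyLIE ℝ (Pt n) (Jet n q (Fin m))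
    (Fin 0)).symm.toContinuousLinearEquiv.toContinuousLinearMap

theorem cst_evL (θ : FormJet n q m 0) : cst (evL θ) = θ :=
  (ContinuousAlternatingMap.constOfIsEmptyLIE ℝ (Pt n) (Jet n q (Fin m))
    (Fin 0)).apply_symm_apply θ

theorem fderiv_jet_apply {y : Pt n → Jet n q (Fin m)} {x : Pt n} (hy : DifferentiableAt ℝ y x)
    (i : Fin n) (μ : MIdx n q) (k : Fin m) :
    fderiv ℝ y x (Pi.single i 1) μ k = pderiv i (fun z => y z μ k) x :=
  (fderiv_clm_comp ((ContinuousLinearMap.proj (R := ℝ) (φ := fun _ : Fin m => ℝ) k).comp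
    (ContinuousLinearMap.proj (R := ℝ) (φ := fun _ : MIdx n q => Fin m → ℝ) μ)) hy
    (Pi.single i 1)).symm

/-- The operator `𝒟₁` is well defined. -/
theorem spencerD_mem_janetDenom_zero {c : Pt n → FormJet n q m 0 →L[ℝ] (ι → ℝ)}
    {piv : ι → MIdx n q × Fin m} (hq : 1 ≤ q) (hV : IsOpen V) (hc : IsJanetCoord V R c)
    (ha : (projOp c).SolvedForm V piv) (hm : (projOp c).MultiplicativeProlongation V piv)
    {θ : Pt n → FormJet n (q + 1) m 0} (hθ : ContDiffOn ℝ ∞ θ V)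
    (h0 : ∀ z ∈ V, c z (truncForm n q m 0 (θ z)) = 0) {x : Pt n} (hx : x ∈ V) :
    spencerD 0 θ x ∈ janetDenom R x 1 := by
  obtain ⟨y, rfl⟩ : ∃ y : Pt n → Jet n (q + 1) (Fin m), θ = fun z => cst (y z) :=
    ⟨fun z => evL (θ z), funext fun z => (cst_evL _).symm⟩
  have hy : ContDiffOn ℝ ∞ y V := contDiffOn_clm_comp evL hθ
  have hd := differentiableAt_of_contDiffOn hV hy hx
  rw [spencerD_eq (differentiableAt_of_contDiffOn hV hθ hx), sum_wd_mem_projOp_iff hc hx]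
  obtain ⟨z, hz, h⟩ := hm.exists_spencer hq hV (projOp_smooth hc.smooth) ha
    (fun μ k => contDiffOn_pi.1 (contDiffOn_pi.1 hy μ) k)
    (fun z hz τ => by
      rw [projOp_eval, ← truncForm_cst, h0 z hz]
      rfl) hx
  refine ⟨z, hz, fun i τ => ?_⟩
  have h1 : fderiv ℝ (fun z => (cst (y z) : FormJet n (q + 1) m 0)) x (Pi.single i 1)
      = cst (fderiv ℝ y x (Pi.single i 1)) := fderiv_clm_comp cstL hd _
  have h2 : fderiv ℝ y x (Pi.single i 1) = fun μ k => pderiv i (fun z => y z μ k) x :=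
    funext fun μ => funext fun k => fderiv_jet_apply hd i μ k
  rw [h1, h2, map_sub, Pi.sub_apply, truncForm_cst, shiftForm_cst, ← projOp_eval, ← projOp_eval,
    h, add_sub_cancel_left]

/-- The operators `𝒟_r`, `r ≥ 2`, are well defined. -/
theorem spencerD_mem_janetDenom_succ {c : Pt n → FormJet n q m r →L[ℝ] (ι → ℝ)}
    {c' : Pt n → FormJet n q m (r + 1) →L[ℝ] (ι' → ℝ)} {b : LinOp n 1 ι ι'}
    {piv : ι' → MIdx n 1 × ι} (hV : IsOpen V) (hc : IsJanetCoord V R c)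
    (hc' : IsJanetCoord V R c') (h : Induced V c c' b) (hbs : b.Smooth V)
    (hb : b.SolvedForm V piv) (hm : b.MultiplicativeProlongation V piv)
    {θ : Pt n → FormJet n (q + 1) m (r + 1)} (hθ : ContDiffOn ℝ ∞ θ V)
    (h0 : ∀ z ∈ V, c' z (truncForm n q m (r + 1) (θ z)) = 0) {x : Pt n} (hx : x ∈ V) :
    spencerD (r + 1) θ x ∈ janetDenom R x (r + 2) := by
  -- With `θ = ∑ dxⁱ ∧ φᵢ`, hypothesis `h0` says that the symbol of `b` kills the sections of `F_r`
  -- given by the `φᵢ`. Up to sign, the coefficients `D φᵢ` of `D θ` have as classes the values of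
  -- `b` on these sections, so `exists_symm` applies.
  obtain ⟨φ, hφ, hθφ⟩ : ∃ φ : Fin n → Pt n → FormJet n (q + 1) m r,
      (∀ i, ContDiffOn ℝ ∞ (φ i) V) ∧ θ = fun z => ∑ i, wd i (φ i z) :=
    ⟨fun i z => (r + 1 : ℝ)⁻¹ • ct i (θ z), fun i =>
      (contDiffOn_clm_comp (ct i) hθ).const_smul _, funext fun z => eq_sum_wd (θ z)⟩
  subst hθφ
  have hd := fun i => differentiableAt_of_contDiffOn hV (hφ i) hx
  have h1 : spencerD (r + 1) (fun z => ∑ i, wd i (φ i z)) x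
      = ∑ i, wd i (-spencerD r (φ i) x) := by
    rw [spencerD_sum fun i => differentiableAt_clm_comp (wd i) (hd i)]
    refine Finset.sum_congr rfl fun i _ => ?_
    rw [spencerD_wd (hd i), map_neg]
  rw [h1, sum_wd_mem_iff hV hc hc' h hx, ← LinOp.mem_symbolImage
    (v := fun j => c' x (-spencerD r (φ j) x))]
  have h2 := hm.exists_symm hV hbs hb (y := fun i z => c z (truncForm n q m r (φ i z)))
    (fun i k => contDiffOn_coord hc.smooth (contDiffOn_clm_comp (truncForm n q m r) (hφ i)) k)
    (fun z hz => by
      rw [h.symb_eq hV hc.smooth hz fun i => truncForm n q m r (φ i z), ← h0 z hz]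
      simp only [map_sum, truncForm_wd]) hx
  have h3 : (fun j => c' x (-spencerD r (φ j) x))
      = -fun j => b.apply (fun z => c z (truncForm n q m r (φ j z))) x := by
    funext j
    rw [map_neg, Pi.neg_apply, h _ (hφ j) x hx]
  rw [h3]
  exact Submodule.neg_mem _ h2

end WellDefined

/-! ### Coordinates of the next bundle and the operator into it -/

section Construction

variable {n q m r N : ℕ} {V : Set (Pt n)} {R : Pt n → Submodule ℝ (Jet n q (Fin m))}
  {c : Pt n → FormJet n q m r →L[ℝ] (Fin N → ℝ)}

theorem ConstLift.surjective {L : Fin N → FormJet n q m r} (hL : ConstLift V c L) {x : Pt n}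
    (hx : x ∈ V) : Function.Surjective (c x) := fun u => ⟨_, hL.coord_sum hx u⟩

theorem sum_wd_single (j : Fin n) (θ : FormJet n q m r) :
    ∑ i, wd i ((Pi.single j θ : Fin n → FormJet n q m r) i) = wd j θ := by
  rw [Finset.sum_eq_single j]
  · rw [Pi.single_eq_same]
  · intro i _ h
    rw [Pi.single_eq_of_ne h, map_zero]
  · simp

/-- Fibre coordinates of `F_{r+1}` from equations `s` for the image of the symbol of the operator
with values in `F_r`. -/
theorem exists_coord_succ {N' : ℕ} {s : Pt n → Fin N' → Fin n → Fin N → ℝ}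
    {l : Fin N' → Fin n × Fin N} {L : Fin N → FormJet n q m r}
    (hs : ∀ ρ i τ, ContDiffOn ℝ ∞ (fun x => s x ρ i τ) V)
    (hl : ∀ x ρ ρ', s x ρ (l ρ').1 (l ρ').2 = if ρ = ρ' then 1 else 0)
    (hc : IsJanetCoord V R c) (hL : ConstLift V c L)
    (hw : ∀ x ∈ V, ∀ w : Fin n → FormJet n q m r, ∑ j, wd j (w j) ∈ janetDenom R x (r + 1) ↔
      ∀ ρ, ∑ i, ∑ τ, s x ρ i τ * c x (w i) τ = 0) :
    ∃ (c' : Pt n → FormJet n q m (r + 1) →L[ℝ] (Fin N' → ℝ)) (L' : Fin N' → FormJet n q m (r + 1)),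
      IsJanetCoord V R c' ∧ ConstLift V c' L' ∧
      ∀ x ∈ V, ∀ j θ ρ, c' x (wd j θ) ρ = ∑ τ, s x ρ j τ * c x θ τ := by
  let A : Pt n → Fin n → (Fin N → ℝ) →L[ℝ] (Fin N' → ℝ) := fun x i =>
    ∑ ρ, ∑ τ, s x ρ i τ • (ContinuousLinearMap.proj (R := ℝ) (φ := fun _ : Fin N => ℝ) τ).smulRight
      (Pi.single ρ 1 : Fin N' → ℝ)
  have hA : ∀ x i u ρ, A x i u ρ = ∑ τ, s x ρ i τ * u τ := fun x i u ρ => by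
    simp only [A, _root_.sum_apply, _root_.smul_apply, ContinuousLinearMap.smulRight_apply,
      ContinuousLinearMap.proj_apply, Finset.sum_apply, Pi.smul_apply, smul_eq_mul]
    rw [Finset.sum_eq_single ρ]
    · simp
    · intro ρ' _ h
      simp [h.symm]
    · simp
  have hAs : ∀ i, ContDiffOn ℝ ∞ (fun x => A x i) V := fun i =>
    ContDiffOn.sum fun ρ _ => ContDiffOn.sum fun τ _ => (hs ρ i τ).smul contDiffOn_const
  let c' : Pt n → FormJet n q m (r + 1) →L[ℝ] (Fin N' → ℝ) := fun x =>
    ∑ i, (A x i).comp ((c x).comp ((r + 1 : ℝ)⁻¹ • ct i))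
  have hc's : ContDiffOn ℝ ∞ c' V := ContDiffOn.sum fun i _ =>
    (hAs i).clm_comp (hc.smooth.clm_comp contDiffOn_const)
  have hc' : ∀ x θ ρ, c' x θ ρ = ∑ i, ∑ τ, s x ρ i τ * c x ((r + 1 : ℝ)⁻¹ • ct i θ) τ :=
    fun x θ ρ => by
    simp only [c', _root_.sum_apply, ContinuousLinearMap.comp_apply, _root_.smul_apply,
      Finset.sum_apply, hA]
  have hker : ∀ x ∈ V, ∀ θ, c' x θ = 0 ↔ θ ∈ janetDenom R x (r + 1) := fun x hx θ => by
    have h1 := hw x hx fun i => (r + 1 : ℝ)⁻¹ • ct i θ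
    rw [← eq_sum_wd] at h1
    rw [h1, funext_iff]
    simp only [hc', Pi.zero_apply]
  -- The value does not depend on the decomposition of the form: the difference of two
  -- decompositions sums to zero, which lies in the denominator and is therefore killed by `s`.
  have hwd : ∀ x ∈ V, ∀ w : Fin n → FormJet n q m r, ∀ ρ,
      c' x (∑ j, wd j (w j)) ρ = ∑ i, ∑ τ, s x ρ i τ * c x (w i) τ := fun x hx w ρ => by
    have h1 := (hw x hx fun i => w i - (r + 1 : ℝ)⁻¹ • ct i (∑ j, wd j (w j))).1 (by
      simp only [map_sub]
      rw [Finset.sum_sub_distrib, ← eq_sum_wd, sub_self]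
      exact Submodule.zero_mem _) ρ
    rw [hc', eq_comm, ← sub_eq_zero, ← h1, ← Finset.sum_sub_distrib]
    refine Finset.sum_congr rfl fun i _ => ?_
    rw [← Finset.sum_sub_distrib, map_sub]
    refine Finset.sum_congr rfl fun τ _ => ?_
    rw [← mul_sub, Pi.sub_apply]
  have hwd1 : ∀ x ∈ V, ∀ j θ ρ, c' x (wd j θ) ρ = ∑ τ, s x ρ j τ * c x θ τ :=
    fun x hx j θ ρ => by
    rw [← sum_wd_single j θ, hwd x hx, Finset.sum_eq_single j, Pi.single_eq_same]
    · intro i _ h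
      simp [Pi.single_eq_of_ne h]
    · simp
  have hL' : ConstLift V c' fun ρ => wd (l ρ).1 (L (l ρ).2) := fun x hx ρ => by
    funext σ
    rw [hwd1 x hx, hL x hx, Pi.single_apply, ← hl x σ ρ]
    simp [Pi.single_apply]
  exact ⟨c', _, ⟨hc's, fun x hx => hL'.surjective hx, fun x hx => Submodule.ext fun θ =>
    hker x hx θ⟩, hL', hwd1⟩

/-- The operator `F_r → F_{r+1}` in coordinates. -/
theorem exists_induced {N' : ℕ} {s : Pt n → Fin N' → Fin n → Fin N → ℝ}
    {l : Fin N' → Fin n × Fin N} {L : Fin N → FormJet n q m r} (hV : IsOpen V)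
    (hs : ∀ ρ i τ, ContDiffOn ℝ ∞ (fun x => s x ρ i τ) V)
    (hl : ∀ x ρ ρ', s x ρ (l ρ').1 (l ρ').2 = if ρ = ρ' then 1 else 0)
    (hl' : ∀ x ρ i τ, (l ρ).1 < i → s x ρ i τ = 0)
    (hc : IsJanetCoord V R c) (hL : ConstLift V c L)
    {c' : Pt n → FormJet n q m (r + 1) →L[ℝ] (Fin N' → ℝ)} (hc' : IsJanetCoord V R c')
    (hwd : ∀ x ∈ V, ∀ j θ ρ, c' x (wd j θ) ρ = ∑ τ, s x ρ j τ * c x θ τ)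
    (hD : ∀ θ : Pt n → FormJet n (q + 1) m r, ContDiffOn ℝ ∞ θ V →
      (∀ z ∈ V, c z (truncForm n q m r (θ z)) = 0) →
        ∀ x ∈ V, spencerD r θ x ∈ janetDenom R x (r + 1)) :
    ∃ (b : LinOp n 1 (Fin N) (Fin N')) (piv : Fin N' → MIdx n 1 × Fin N),
      b.Smooth V ∧ b.SolvedForm V piv ∧ Induced V c c' b := by
  -- Dictated by the Leibniz rule for `D(u L_τ)`: the first order part is `s` and the order zero
  -- part comes from `-δ`. As `|μ| ≤ 1`, the factors `1 - |μ|` and `μⱼ` select between them.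
  let b : LinOp n 1 (Fin N) (Fin N') := fun x ρ μ τ =>
    (1 - (μ.len : ℝ)) * (-c' x (delta n q m r (extForm n q m r (L τ))) ρ)
      + ∑ j, (μ.1 j : ℝ) * s x ρ j τ
  have hb0 : ∀ x ρ τ, b x ρ (MIdx.zero n 1) τ
      = -c' x (delta n q m r (extForm n q m r (L τ))) ρ := fun x ρ τ => by
    have h0 : ∀ j, (MIdx.zero n 1).1 j = 0 := fun _ => rfl
    simp [b, len_zero, h0]
  have hb1 : ∀ x ρ j τ, b x ρ (MIdx.unit j) τ = s x ρ j τ := fun x ρ j τ => by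
    simp [b, len_unit, unit_val, Pi.single_apply]
  have hbs : b.Smooth V := fun ρ μ τ => (contDiffOn_const.mul
    (contDiffOn_coord hc'.smooth contDiffOn_const ρ).neg).add
      (ContDiffOn.sum fun j _ => contDiffOn_const.mul (hs ρ j τ))
  let piv : Fin N' → MIdx n 1 × Fin N := fun ρ => (MIdx.unit (l ρ).1, (l ρ).2)
  have hpiv : ∀ ρ, eqClass piv ρ = (l ρ).1.val + 1 := fun ρ =>
    eqClass_of_eq_unit (τ := (l ρ).2) rfl
  refine ⟨b, piv, hbs, ⟨fun x _ σ ρ => ?_,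
    fun x _ ρ μ τ hμ hcl => ?_⟩, fun θ hθ x hx => ?_⟩
  · simp only [piv]
    rw [hb1, hl]
    split_ifs <;> rfl
  · rcases eq_zero_or_eq_unit μ with rfl | ⟨i, rfl⟩
    · rw [len_zero] at hμ
      omega
    · rw [hpiv, unit_val, jetClass_single] at hcl
      rw [hb1]
      exact hl' x ρ i τ (Fin.lt_def.2 (by omega))
  · set u : Pt n → Fin N → ℝ := fun z => c z (truncForm n q m r (θ z)) with hu
    have hus : ∀ τ, ContDiffOn ℝ ∞ (fun z => u z τ) V := fun τ =>
      contDiffOn_coord hc.smooth (contDiffOn_clm_comp (truncForm n q m r) hθ) τ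
    have hud := fun τ => differentiableAt_of_contDiffOn hV (hus τ) hx
    -- `η` is the standard section whose projection has the same coordinates as that of `θ`. By `hD`
    -- the difference contributes nothing, and `D η` is explicit.
    set η : Pt n → FormJet n (q + 1) m r := fun z => ∑ τ, u z τ • extForm n q m r (L τ) with hη
    have hηs : ContDiffOn ℝ ∞ η V := contDiffOn_sum_smul hus _
    have h1 : spencerD r θ x = spencerD r (fun z => θ z - η z) x + spencerD r η x := by
      rw [← spencerD_add (differentiableAt_of_contDiffOn hV (hθ.sub hηs) hx)
        (differentiableAt_of_contDiffOn hV hηs hx)]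
      simp only [sub_add_cancel]
    have h2 : c' x (spencerD r (fun z => θ z - η z) x) = 0 := by
      rw [hc'.coord_eq_zero hx]
      refine hD _ (hθ.sub hηs) (fun z hz => ?_) x hx
      have h3 : truncForm n q m r (η z) = ∑ τ, u z τ • L τ := by
        simp only [hη, map_sum, map_smul, truncForm_extForm]
      rw [map_sub, map_sub, h3, hL.coord_sum hz, hu, sub_self]
    rw [h1, map_add, h2, zero_add, hη, spencerD_sum fun τ => (hud τ).smul_const _]
    funext ρ
    rw [apply_order_one hV b hus hx, LinOp.symb_apply]
    simp only [spencerD_smul_const (hud _), truncForm_extForm, map_sum, map_sub, map_smul, hb0, hb1,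
      Finset.sum_apply, Pi.sub_apply, Pi.smul_apply, smul_eq_mul, hwd x hx, hL x hx,
      Pi.single_apply, mul_ite, mul_one, mul_zero, Finset.sum_ite_eq', Finset.mem_univ, if_true]
    rw [Finset.sum_sub_distrib, Finset.sum_comm, add_comm, sub_eq_add_neg,
      ← Finset.sum_neg_distrib]
    congr 1
    · exact Finset.sum_congr rfl fun _ _ => Finset.sum_congr rfl fun _ _ => mul_comm _ _
    · exact Finset.sum_congr rfl fun _ _ => by ring

end Construction


/-! ### Local existence of adapted coordinates -/

section Existence

variable {n q m r : ℕ} {V : Set (Pt n)} {R : Pt n → Submodule ℝ (Jet n q (Fin m))}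

/-- Fibre coordinates of a Janet bundle, together with constant dual forms. -/
structure Frame (V : Set (Pt n)) (R : Pt n → Submodule ℝ (Jet n q (Fin m))) (r : ℕ) where
  /-- the fibre dimension -/
  rank : ℕ
  /-- the fibre coordinates -/
  coord : Pt n → FormJet n q m r →L[ℝ] (Fin rank → ℝ)
  /-- the dual forms -/
  lift : Fin rank → FormJet n q m r
  isJanetCoord : IsJanetCoord V R coord
  constLift : ConstLift V coord lift

/-- `b` is the operator `F_r → F_{r+1}` in adapted coordinates. -/
structure Frame.Adapted (A : Frame V R r) (B : Frame V R (r + 1))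
    (b : LinOp n 1 (Fin A.rank) (Fin B.rank)) (piv : Fin B.rank → MIdx n 1 × Fin A.rank) :
    Prop where
  smooth : b.Smooth V
  solved : b.SolvedForm V piv
  induced : Induced V A.coord B.coord b
  prolongation : b.MultiplicativeProlongation V piv

/-- One inductive step for all degrees: the preceding operator `a` is `𝒟`, of order `q`, at the
start and a first order operator afterwards. What depends on the degree enters through `hw`, `hD`
and `hcomp`. -/
theorem Frame.exists_succ {q' : ℕ} {κ : Type} [Fintype κ] (hV : IsOpen V) (A : Frame V R r)
    {a : LinOp n q' κ (Fin A.rank)} {piv : Fin A.rank → MIdx n q' × κ} (hq : 1 ≤ q')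
    (has : a.Smooth V) (ha : a.SolvedForm V piv) (hm : a.MultiplicativeProlongation V piv)
    (hw : ∀ x ∈ V, ∀ w : Fin n → FormJet n q m r,
      ∑ j, wd j (w j) ∈ janetDenom R x (r + 1) ↔ ∃ z ∈ symTop n (q' + 1) κ, ∀ j τ,
        A.coord x (w j) τ = a.eval x τ (shift n q' κ j z))
    (hD : ∀ θ : Pt n → FormJet n (q + 1) m r, ContDiffOn ℝ ∞ θ V →
      (∀ z ∈ V, A.coord z (truncForm n q m r (θ z)) = 0) →
        ∀ x ∈ V, spencerD r θ x ∈ janetDenom R x (r + 1))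
    (hcomp : ∀ {N' : ℕ} {c' : Pt n → FormJet n q m (r + 1) →L[ℝ] (Fin N' → ℝ)}
      {b : LinOp n 1 (Fin A.rank) (Fin N')}, Induced V A.coord c' b →
      ∀ f, ContDiffOn ℝ ∞ f V → ∀ x ∈ V, b.apply (a.apply f) x = 0) :
    ∃ (B : Frame V R (r + 1)) (b : _) (piv' : _), A.Adapted B b piv' := by
  obtain ⟨N', s, l, hs, hl, hl', hsk⟩ :=
    exists_symbol_equations has ha fun x hx => hm.symbolInvolutive hx
  obtain ⟨c', L', hc', hL', hwd⟩ := exists_coord_succ hs hl A.isJanetCoord A.constLift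
    fun x hx w => by
      rw [hw x hx, ← LinOp.mem_symbolImage (v := fun j => A.coord x (w j)), ← hsk x hx]
  obtain ⟨b, piv', hbs, hb, hi⟩ := exists_induced hV hs hl hl' A.isJanetCoord A.constLift hc' hwd hD
  refine ⟨⟨N', c', L', hc', hL'⟩, b, piv', hbs, hb, hi,
    multiplicativeProlongation hq hV has ha hbs hb (fun x hx => ?_) (hcomp hi)⟩
  exact leadsComplete hx ha (hm.symbolInvolutive hx) hb
    (hi.symbolExact hV A.isJanetCoord hc' hx (hw x hx))
    (hi.symb_surjective hV A.isJanetCoord.smooth hx (hc'.surjective x hx))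

theorem Frame.Adapted.exists_succ (hV : IsOpen V) {A : Frame V R r} {B : Frame V R (r + 1)}
    {b : LinOp n 1 (Fin A.rank) (Fin B.rank)} {piv : Fin B.rank → MIdx n 1 × Fin A.rank}
    (h : A.Adapted B b piv) : ∃ (C : Frame V R (r + 2)) (b' : _) (piv' : _),
      B.Adapted C b' piv' :=
  B.exists_succ hV le_rfl h.smooth h.solved h.prolongation
    (fun _ hx => sum_wd_mem_iff hV A.isJanetCoord B.isJanetCoord h.induced hx)
    (fun _ hθ h0 _ hx => spencerD_mem_janetDenom_succ hV A.isJanetCoord B.isJanetCoord h.induced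
      h.smooth h.solved h.prolongation hθ h0 hx)
    fun hi => h.induced.composite hi hV A.constLift

/-- The equations of an involutive system are fibre coordinates of `F_0`. -/
theorem exists_coord_zero {N : ℕ} {a : LinOp n q (Fin m) (Fin N)}
    {piv : Fin N → MIdx n q × Fin m} (has : a.Smooth V) (ha : a.SolvedForm V piv)
    (hR : ∀ x ∈ V, a.system x = R x) : ∃ c : Pt n → FormJet n q m 0 →L[ℝ] (Fin N → ℝ),
      IsJanetCoord V R c ∧ projOp c = a := by
  let A : Pt n → Jet n q (Fin m) →L[ℝ] (Fin N → ℝ) := fun x =>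
    ∑ τ, ∑ μ, ∑ k, a x τ μ k • ((ContinuousLinearMap.proj (R := ℝ) (φ := fun _ : Fin m => ℝ) k).comp
      (ContinuousLinearMap.proj (R := ℝ) (φ := fun _ : MIdx n q => Fin m → ℝ) μ)).smulRight
        (Pi.single τ 1 : Fin N → ℝ)
  have hA : ∀ x y τ, A x y τ = a.eval x τ y := fun x y τ => by
    simp only [A, _root_.sum_apply, _root_.smul_apply, ContinuousLinearMap.smulRight_apply,
      ContinuousLinearMap.comp_apply, ContinuousLinearMap.proj_apply, Finset.sum_apply,
      Pi.smul_apply, smul_eq_mul, LinOp.eval]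
    rw [Finset.sum_eq_single τ]
    · simp
    · intro σ _ h
      simp [h.symm]
    · simp
  have hAs : ContDiffOn ℝ ∞ A V := ContDiffOn.sum fun τ _ => ContDiffOn.sum fun μ _ =>
    ContDiffOn.sum fun k _ => (has τ μ k).smul contDiffOn_const
  let c : Pt n → FormJet n q m 0 →L[ℝ] (Fin N → ℝ) := fun x => (A x).comp evL
  have hca : projOp c = a := by
    funext x τ μ k
    have h1 : evL (cst (Pi.single μ (Pi.single k 1) : Jet n q (Fin m)))
        = Pi.single μ (Pi.single k 1) := rfl
    change A x (evL (cst (Pi.single μ (Pi.single k 1)))) τ = a x τ μ k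
    rw [h1, hA, LinOp.eval, Finset.sum_eq_single μ, Finset.sum_eq_single k]
    · simp
    · intro k' _ h
      simp [h]
    · simp
    · intro l _ h
      simp [h]
    · simp
  refine ⟨c, ⟨hAs.clm_comp contDiffOn_const, fun x hx => ?_, fun x hx => Submodule.ext fun θ => ?_⟩,
    hca⟩
  · exact (constLift_projOp (c := c) (by rwa [hca])).surjective hx
  · rw [← cst_evL θ, mem_janetDenom_zero, ← hR x hx]
    exact funext_iff.trans (forall_congr' fun τ => by
      rw [← hA]
      rfl)

theorem exists_adapted_zero (hq : 1 ≤ q) (hV : IsOpen V) {N : ℕ} {a : LinOp n q (Fin m) (Fin N)}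
    {piv : Fin N → MIdx n q × Fin m} (has : a.Smooth V) (ha : a.SolvedForm V piv)
    (hm : a.MultiplicativeProlongation V piv) (hR : ∀ x ∈ V, a.system x = R x) :
    ∃ (A : Frame V R 0) (B : Frame V R 1) (b : _) (piv' : _),
      (∃ piv, (projOp A.coord).SolvedForm V piv) ∧ A.Adapted B b piv' := by
  obtain ⟨c, hc, rfl⟩ := exists_coord_zero has ha hR
  let A : Frame V R 0 := ⟨N, c, _, hc, constLift_projOp ha⟩
  obtain ⟨B, b, piv', h⟩ := A.exists_succ hV hq has ha hm (fun _ hx => sum_wd_mem_projOp_iff hc hx)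
    (fun _ hθ h0 _ hx => spencerD_mem_janetDenom_zero hq hV hc ha hm hθ h0 hx)
    fun hi => hi.composite_projOp hV
  exact ⟨A, B, b, piv', ⟨piv, ha⟩, h⟩

/-- Two consecutive Janet bundles and the operator between them. -/
structure FramePair (V : Set (Pt n)) (R : Pt n → Submodule ℝ (Jet n q (Fin m))) (r : ℕ) where
  /-- the coordinates of `F_r` -/
  fst : Frame V R r
  /-- the coordinates of `F_{r+1}` -/
  snd : Frame V R (r + 1)
  /-- the operator -/
  op : LinOp n 1 (Fin fst.rank) (Fin snd.rank)
  /-- its leading jets -/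
  piv : Fin snd.rank → MIdx n 1 × Fin fst.rank
  adapted : fst.Adapted snd op piv

/-- The following pair. -/
noncomputable def FramePair.next (hV : IsOpen V) (p : FramePair V R r) : FramePair V R (r + 1) where
  fst := p.snd
  snd := (p.adapted.exists_succ hV).choose
  op := (p.adapted.exists_succ hV).choose_spec.choose
  piv := (p.adapted.exists_succ hV).choose_spec.choose_spec.choose
  adapted := (p.adapted.exists_succ hV).choose_spec.choose_spec.choose_spec

/-- The sequence of pairs. -/
noncomputable def FramePair.seq (hV : IsOpen V) (p : FramePair V R 0) : ∀ r, FramePair V R r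
  | 0 => p
  | r + 1 => (p.seq hV r).next hV

/-- The Janet sequence. -/
noncomputable def FramePair.janetSequence (hV : IsOpen V) (p : FramePair V R 0) :
    JanetSequence V R where
  rank r := (p.seq hV r).fst.rank
  coord r := (p.seq hV r).fst.coord
  coord_smooth r := (p.seq hV r).fst.isJanetCoord.smooth
  coord_surjective r := (p.seq hV r).fst.isJanetCoord.surjective
  coord_ker r := (p.seq hV r).fst.isJanetCoord.ker
  op r := (p.seq hV r).op
  op_smooth r := (p.seq hV r).adapted.smooth
  op_induced r := (p.seq hV r).adapted.induced

/-- Every involutive system has a Janet sequence in adapted coordinates, locally. -/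
theorem exists_janetSequence {U : Set (Pt n)} (hq : 1 ≤ q) (hR : IsInvolutive U R) {x₀ : Pt n}
    (hx₀ : x₀ ∈ U) : ∃ V : Set (Pt n), IsOpen V ∧ x₀ ∈ V ∧ V ⊆ U ∧
      ∃ J : JanetSequence V R, J.IsSolved := by
  obtain ⟨V, hV, hxV, hVU, N, a, piv, has, hs, ha, hm⟩ := hR x₀ hx₀
  obtain ⟨A, B, b, piv', h0, h⟩ := exists_adapted_zero hq hV has ha hm hs
  -- The recursion runs on pairs because constructing a new bundle requires the operator into the
  -- preceding one, not just that bundle.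
  let p : FramePair V R 0 := ⟨A, B, b, piv', h⟩
  exact ⟨V, hV, hxV, hVU, p.janetSequence hV, h0, fun r => ⟨_, (p.seq hV r).adapted.solved⟩⟩

end Existence

end Janet

theorem theorem2p12 (n q m : ℕ) (hq : 1 ≤ q) (U : Set (Pt n)) (hU : IsOpen U)
    (R : Pt n → Submodule ℝ (Jet n q (Fin m))) (hR : IsInvolutive U R) :
    (∀ x₀ ∈ U, ∃ V : Set (Pt n), IsOpen V ∧ x₀ ∈ V ∧ V ⊆ U ∧
      ∃ J : JanetSequence V R, J.IsSolved) ∧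
    ∀ V : Set (Pt n), IsOpen V → V ⊆ U → ∀ J : JanetSequence V R, J.IsSolved →
      GeneratesCC V J.op₀ (J.op 0) ∧
      (∀ r, GeneratesCC V (J.op r) (J.op (r + 1))) ∧
      ∀ r, r < n → ReducedSpencerForm (J.op r) V := by
  refine ⟨fun x₀ hx₀ => exists_janetSequence hq hR hx₀, fun V hV hVU J hJ => ?_⟩
  obtain ⟨h0, h1, h2⟩ := janet_sequence hq hR hV hVU J hJ
  exact ⟨h0, h1, fun r _ => h2 r⟩
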